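/- Let $F$ be a global function field with field of constants $k$, $q=|k|$. Fix a place $\infty$ of $F$; let $A\subseteq F$ be the ring of functions regular away from $\infty$, $F_\infty$ the completion of $F$ at $\infty$ with normalized valuation $\operatorname{ord}_\infty$, and $d_\infty$ the degree over $k$ of the residue field of $F_\infty$. Let $L$ be an extension field of $k$, $\bar L$ an algebraic closure of $L$, and $L^{\mathrm{sep}}$, $L^{\mathrm{perf}}$, $\bar k$ the separable closure of $L$, the perfect closure of $L$ and the algebraic closure of $k$ in $\bar L$. Let $\bar L((\tau^{-1}))$ be the skew field of twisted Laurent series $\sum_{i\ge i_0}a_i\tau^{-i}$ with $\tau a=a^q\tau$, with valuation $\operatorname{ord}_{\tau^{-1}}(\sum_i a_i\tau^{-i})=\inf\{i: a_i\ne 0\}$ and the $\tau^{-1}$-adic topology; it contains $L[\tau]$ and $L^{\mathrm{perf}}((\tau^{-1}))$. Let $\phi\colon A\to L[\tau]$ be a Drinfeld module, that is, a ring homomorphism whose image is not contained in the constants $L$. There is a unique positive integer $n$ (the rank of $\phi$) with $\operatorname{ord}_{\tau^{-1}}(\phi_a)=n d_\infty\operatorname{ord}_\infty(a)$ for all nonzero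 $a\in A$, and $\phi$ extends uniquely to a ring homomorphism $\phi\colon F_\infty\to L^{\mathrm{perf}}((\tau^{-1}))$ such that $\operatorname{ord}_{\tau^{-1}}(\phi_x)=n d_\infty\operatorname{ord}_\infty(x)$ for all $x\in F_\infty^\times$. Let $D_\phi$ be the centralizer of $\phi(A)$ in $\bar L((\tau^{-1}))$, with the subspace topology, let $D_\phi^\times$ be its unit group, and let $\operatorname{End}_L(\phi)$ be the centralizer of $\phi(A)$ in $L[\tau]$. Let $W_L$ be the Weil group, that is, the group of those $\sigma\in\operatorname{Gal}(L^{\mathrm{sep}}/L)$ that act on $\bar k$ as $x\mapsto x^{q^{\deg\sigma}}$ for some $\deg\sigma\in\mathbb Z$, with its usual topology (the coarsest one for which the inclusion in $\operatorname{Gal}(L^{\mathrm{sep}}/L)$ and $\deg\colon W_L\to\mathbb Z$, with $\mathbb Z$ discrete, are continuous). For a series $u$ with coefficients in $L^{\mathrm{sep}}$, $\sigma(u)$ is obtained by applying $\sigma$ to its coefficients. Then: 1. There is a series $u\in\bar L((\tau^{-1}))^\times$ with $u^{-1}\phi(F_\infty)u\subseteq\bar k((\tau^{-1}))$, and every such $u$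 has coefficients in $L^{\mathrm{sep}}$. 2. $D_\phi$, as an $F_\infty$-algebra via $\phi$, is a central $F_\infty$-division algebra with invariant $-1/n$ in $\mathbb Q/\mathbb Z$ (the invariant being the class of $w(\gamma)$, where $x\mapsto\gamma x\gamma^{-1}$ induces the arithmetic Frobenius on an unramified maximal subfield and $w$ is the valuation extending $\operatorname{ord}_\infty$); in particular it has dimension $n^2$ over $F_\infty$. 3. For $\sigma\in W_L$ and $u$ as in 1, the series $\rho_\infty(\sigma):=\sigma(u)\tau^{\deg\sigma}u^{-1}$ belongs to $D_\phi^\times$ and does not depend on the choice of $u$. 4. For all $\sigma\in W_L$, $\operatorname{ord}_{\tau^{-1}}\rho_\infty(\sigma)=-\deg\sigma$. 5. The map $\rho_\infty\colon W_L\to D_\phi^\times$ is a continuous group homomorphism. 6. Every element of $\rho_\infty(W_L)$ commutes with every element of $\operatorname{End}_L(\phi)$. -/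

import Mathlib

open scoped WithZero RatFunc

/-! ### Twisted Laurent series in `τ⁻¹` -/

/-- Twisted Laurent series `∑ aᵢ τ⁻ⁱ` over `K`, with only finitely many nonzero `aᵢ` for `i < 0`,
for the commutation rule `τ a = θ(a) τ`, where `θ` is an automorphism of the field `K`.
`coeff i` is the coefficient `aᵢ` of `τ⁻ⁱ` (coefficients are written on the left). -/
@[ext]
structure TwistedLaurent (K : Type*) [Field K] (θ : K ≃+* K) where
  coeff : ℤ → K
  bdd : ∃ N : ℤ, ∀ i < N, coeff i = 0

namespace TwistedLaurent

variable {K : Type*} [Field K] {θ : K ≃+* K}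

instance : Zero (TwistedLaurent K θ) := ⟨⟨fun _ => 0, 0, fun _ _ => rfl⟩⟩

instance : Add (TwistedLaurent K θ) :=
  ⟨fun f g => ⟨fun i => f.coeff i + g.coeff i, by
    obtain ⟨M, hM⟩ := f.bdd
    obtain ⟨N, hN⟩ := g.bdd
    refine ⟨min M N, fun i hi => ?_⟩
    rw [hM i (lt_of_lt_of_le hi (min_le_left _ _)), hN i (lt_of_lt_of_le hi (min_le_right _ _)),
      add_zero]⟩⟩

instance : Neg (TwistedLaurent K θ) :=
  ⟨fun f => ⟨fun i => -f.coeff i, by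
    obtain ⟨M, hM⟩ := f.bdd
    exact ⟨M, fun i hi => by rw [hM i hi, neg_zero]⟩⟩⟩

/-- The monomial `a τ⁻ⁱ`. -/
def monomial (θ : K ≃+* K) (i : ℤ) (a : K) : TwistedLaurent K θ :=
  ⟨fun j => if j = i then a else 0, i, fun _ hj => if_neg hj.ne⟩

instance : One (TwistedLaurent K θ) := ⟨monomial θ 0 1⟩

theorem twistedSum_eq (a b : ℤ → K) {M N : ℤ} (ha : ∀ i < M, a i = 0) (hb : ∀ i < N, b i = 0)
    (m : ℤ) (s : Finset ℤ) (hs : Finset.Icc M (m - N) ⊆ s) :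
    ∑ᶠ i : ℤ, a i * (θ ^ (-i)) (b (m - i)) = ∑ i ∈ s, a i * (θ ^ (-i)) (b (m - i)) := by
  refine finsum_eq_sum_of_support_subset _ fun i hi => ?_
  refine Finset.mem_coe.2 (hs (Finset.mem_Icc.2 ⟨?_, ?_⟩))
  · by_contra h
    exact hi (by simp [ha i (not_le.1 h)])
  · by_contra h
    exact hi (by simp [hb (m - i) (by omega)])

/-- Multiplication: since `τ⁻ⁱ b = θ⁻ⁱ(b) τ⁻ⁱ`, the coefficient of `τ⁻ᵐ` in `f g` is
`∑ᵢ fᵢ θ⁻ⁱ(gₘ₋ᵢ)`, a sum with finitely many nonzero terms. -/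
noncomputable instance : Mul (TwistedLaurent K θ) :=
  ⟨fun f g => ⟨fun m => ∑ᶠ i : ℤ, f.coeff i * (θ ^ (-i)) (g.coeff (m - i)), by
    obtain ⟨M, hM⟩ := f.bdd
    obtain ⟨N, hN⟩ := g.bdd
    refine ⟨M + N, fun m hm => ?_⟩
    rw [twistedSum_eq _ _ hM hN m ∅ (by rw [Finset.Icc_eq_empty (by omega)])]
    simp⟩⟩

@[simp] theorem coeff_zero (i : ℤ) : (0 : TwistedLaurent K θ).coeff i = 0 := rfl

@[simp] theorem coeff_add (f g : TwistedLaurent K θ) (i : ℤ) :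
    (f + g).coeff i = f.coeff i + g.coeff i := rfl

@[simp] theorem coeff_neg (f : TwistedLaurent K θ) (i : ℤ) : (-f).coeff i = -f.coeff i := rfl

theorem coeff_monomial (i j : ℤ) (a : K) :
    (monomial θ i a).coeff j = if j = i then a else 0 := rfl

theorem coeff_one (i : ℤ) : (1 : TwistedLaurent K θ).coeff i = if i = 0 then 1 else 0 := rfl

theorem coeff_mul (f g : TwistedLaurent K θ) (m : ℤ) :
    (f * g).coeff m = ∑ᶠ i : ℤ, f.coeff i * (θ ^ (-i)) (g.coeff (m - i)) := rfl

theorem coeff_mul_eq_sum (f g : TwistedLaurent K θ) {M N : ℤ} (hM : ∀ i < M, f.coeff i = 0)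
    (hN : ∀ i < N, g.coeff i = 0) (m : ℤ) (s : Finset ℤ) (hs : Finset.Icc M (m - N) ⊆ s) :
    (f * g).coeff m = ∑ i ∈ s, f.coeff i * (θ ^ (-i)) (g.coeff (m - i)) :=
  twistedSum_eq _ _ hM hN m s hs

theorem coeff_mul_eq_sum_shift (f g : TwistedLaurent K θ) {M N : ℤ}
    (hM : ∀ i < M, f.coeff i = 0) (hN : ∀ i < N, g.coeff i = 0) (m i : ℤ) (s : Finset ℤ)
    (hs : Finset.Icc (M + i) (m - N) ⊆ s) :
    (f * g).coeff (m - i) =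
      ∑ l ∈ s, f.coeff (l - i) * (θ ^ (-(l - i))) (g.coeff (m - l)) := by
  rw [coeff_mul_eq_sum f g hM hN (m - i) (s.map (Equiv.subRight i).toEmbedding) ?_]
  · rw [Finset.sum_map]
    refine Finset.sum_congr rfl fun l _ => ?_
    simp only [Equiv.coe_toEmbedding, Equiv.subRight_apply]
    congr 3
    omega
  · intro j hj
    rw [Finset.mem_Icc] at hj
    refine Finset.mem_map.2 ⟨j + i, hs (Finset.mem_Icc.2 ⟨by omega, by omega⟩), ?_⟩
    simp

theorem mul_assoc' (f g h : TwistedLaurent K θ) : f * g * h = f * (g * h) := by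
  obtain ⟨a, ha⟩ := f.bdd
  obtain ⟨b, hb⟩ := g.bdd
  obtain ⟨c, hc⟩ := h.bdd
  have hfg : ∀ i < a + b, (f * g).coeff i = 0 := fun i hi => by
    rw [coeff_mul_eq_sum f g ha hb i ∅ (by rw [Finset.Icc_eq_empty (by omega)])]; simp
  have hgh : ∀ i < b + c, (g * h).coeff i = 0 := fun i hi => by
    rw [coeff_mul_eq_sum g h hb hc i ∅ (by rw [Finset.Icc_eq_empty (by omega)])]; simp
  ext m
  rw [coeff_mul_eq_sum (f * g) h hfg hc m (Finset.Icc (a + b) (m - c)) subset_rfl,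
    coeff_mul_eq_sum f (g * h) ha hgh m (Finset.Icc a (m - (b + c))) subset_rfl]
  have h1 : ∀ l ∈ Finset.Icc (a + b) (m - c), (f * g).coeff l * (θ ^ (-l)) (h.coeff (m - l)) =
      ∑ i ∈ Finset.Icc a (m - (b + c)),
        f.coeff i * (θ ^ (-i)) (g.coeff (l - i)) * (θ ^ (-l)) (h.coeff (m - l)) := by
    intro l hl
    rw [Finset.mem_Icc] at hl
    rw [coeff_mul_eq_sum f g ha hb l (Finset.Icc a (m - (b + c)))
      (Finset.Icc_subset_Icc le_rfl (by omega)), Finset.sum_mul]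
  have h2 : ∀ i ∈ Finset.Icc a (m - (b + c)),
      f.coeff i * (θ ^ (-i)) ((g * h).coeff (m - i)) =
      ∑ l ∈ Finset.Icc (a + b) (m - c),
        f.coeff i * (θ ^ (-i)) (g.coeff (l - i)) * (θ ^ (-l)) (h.coeff (m - l)) := by
    intro i hi
    rw [Finset.mem_Icc] at hi
    rw [coeff_mul_eq_sum_shift g h hb hc m i (Finset.Icc (a + b) (m - c))
      (Finset.Icc_subset_Icc (by omega) le_rfl), map_sum, Finset.mul_sum]
    refine Finset.sum_congr rfl fun l _ => ?_
    rw [map_mul, mul_assoc, ← RingAut.mul_apply, ← zpow_add]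
    congr 4
    omega
  rw [Finset.sum_congr rfl h1, Finset.sum_congr rfl h2, Finset.sum_comm]

theorem monomial_mul_monomial (i j : ℤ) (a b : K) :
    monomial θ i a * monomial θ j b = monomial θ (i + j) (a * (θ ^ (-i)) b) := by
  ext m
  rw [coeff_mul, finsum_eq_single _ i]
  · simp only [coeff_monomial, if_true]
    by_cases h : m = i + j
    · rw [if_pos (by omega), if_pos h]
    · rw [if_neg (by omega), if_neg h, map_zero, mul_zero]
  · intro l hl
    rw [coeff_monomial, if_neg hl, zero_mul]

noncomputable instance : Ring (TwistedLaurent K θ) where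
  add_assoc f g h := by ext; simp [add_assoc]
  zero_add f := by ext; simp
  add_zero f := by ext; simp
  add_comm f g := by ext; simp [add_comm]
  neg_add_cancel f := by ext; simp
  nsmul := nsmulRec
  zsmul := zsmulRec
  mul_assoc := mul_assoc'
  zero_mul f := by ext; simp [coeff_mul]
  mul_zero f := by ext; simp [coeff_mul]
  one_mul f := by
    ext m
    rw [coeff_mul, finsum_eq_single _ 0]
    · simp [coeff_one]
    · intro i hi; simp [coeff_one, hi]
  mul_one f := by
    ext m
    rw [coeff_mul, finsum_eq_single _ m]
    · simp [coeff_one]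
    · intro i hi; simp [coeff_one, sub_eq_zero, hi.symm]
  left_distrib f g h := by
    ext m
    obtain ⟨a, ha⟩ := f.bdd
    obtain ⟨b, hb⟩ := g.bdd
    obtain ⟨c, hc⟩ := h.bdd
    have hs : ∀ d, min b c ≤ d → Finset.Icc a (m - d) ⊆ Finset.Icc a (m - min b c) :=
      fun d hd => Finset.Icc_subset_Icc le_rfl (by omega)
    rw [coeff_add, coeff_mul_eq_sum f g ha hb m _ (hs b (min_le_left _ _)),
      coeff_mul_eq_sum f h ha hc m _ (hs c (min_le_right _ _)),
      coeff_mul_eq_sum f (g + h) ha (N := min b c) (fun i hi => by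
        rw [coeff_add, hb i (by omega), hc i (by omega), add_zero]) m _ subset_rfl,
      ← Finset.sum_add_distrib]
    exact Finset.sum_congr rfl fun i _ => by rw [coeff_add, map_add, mul_add]
  right_distrib f g h := by
    ext m
    obtain ⟨a, ha⟩ := f.bdd
    obtain ⟨b, hb⟩ := g.bdd
    obtain ⟨c, hc⟩ := h.bdd
    have hs : ∀ d, min a b ≤ d → Finset.Icc d (m - c) ⊆ Finset.Icc (min a b) (m - c) :=
      fun d hd => Finset.Icc_subset_Icc hd le_rfl
    rw [coeff_add, coeff_mul_eq_sum f h ha hc m _ (hs a (min_le_left _ _)),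
      coeff_mul_eq_sum g h hb hc m _ (hs b (min_le_right _ _)),
      coeff_mul_eq_sum (f + g) h (M := min a b) (fun i hi => by
        rw [coeff_add, ha i (by omega), hb i (by omega), add_zero]) hc m _ subset_rfl,
      ← Finset.sum_add_distrib]
    exact Finset.sum_congr rfl fun i _ => by rw [coeff_add, add_mul]

/-- The element `τ`, as a unit of the ring of twisted Laurent series in `τ⁻¹`. -/
noncomputable def tau (θ : K ≃+* K) : (TwistedLaurent K θ)ˣ where
  val := monomial θ (-1) 1
  inv := monomial θ 1 1
  val_inv := by rw [monomial_mul_monomial, map_one, mul_one]; rfl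
  inv_val := by rw [monomial_mul_monomial, map_one, mul_one]; rfl

open Classical in
/-- The valuation `ord_{τ⁻¹}`: the least `i` with `aᵢ ≠ 0`, and `+∞` for the zero series. -/
noncomputable def ord (f : TwistedLaurent K θ) : WithTop ℤ :=
  if f = 0 then ⊤ else ((sInf {i : ℤ | f.coeff i ≠ 0} : ℤ) : WithTop ℤ)

/-- All coefficients of `f` lie in the set `s`. -/
def CoeffsIn (s : Set K) (f : TwistedLaurent K θ) : Prop := ∀ i, f.coeff i ∈ s

/-- The `τ⁻¹`-adic topology: `U` is open iff for each `f ∈ U` there is an `N` such that `U`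
contains all `g` with `ord (g - f) ≥ N`. -/
instance : TopologicalSpace (TwistedLaurent K θ) where
  IsOpen U := ∀ f ∈ U, ∃ N : ℤ, ∀ g : TwistedLaurent K θ,
    (∀ i < N, g.coeff i = f.coeff i) → g ∈ U
  isOpen_univ := fun _ _ => ⟨0, fun _ _ => trivial⟩
  isOpen_inter := fun U V hU hV f hf => by
    obtain ⟨M, hM⟩ := hU f hf.1
    obtain ⟨N, hN⟩ := hV f hf.2
    exact ⟨max M N, fun g hg => ⟨hM g fun i hi => hg i (lt_max_of_lt_left hi),
      hN g fun i hi => hg i (lt_max_of_lt_right hi)⟩⟩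
  isOpen_sUnion := fun S hS f ⟨U, hU, hf⟩ => by
    obtain ⟨N, hN⟩ := hS U hU f hf
    exact ⟨N, fun g hg => ⟨U, hU, hN g hg⟩⟩

end TwistedLaurent

/-! ### Discrete valuations, places, completions -/

/-- The additive form `ord(x) ∈ ℤ` of a `ℤᵐ⁰`-valued valuation (only meaningful for `x ≠ 0`). -/
noncomputable def addOrd {K : Type*} [Field K] (v : Valuation K ℤᵐ⁰) (x : K) : ℤ :=
  -WithZero.log (v x)

/-- A ring homomorphism from a finite field to a valued field lands in the valuation ring. -/
noncomputable def toValuationRing {k K : Type*} [Field k] [Finite k] [Field K]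
    (f : k →+* K) (v : Valuation K ℤᵐ⁰) : k →+* v.valuationSubring :=
  f.codRestrict v.valuationSubring.toSubring fun c => by
    change v (f c) ≤ 1
    by_cases hc : c = 0
    · simp [hc]
    · obtain ⟨n, hn, h⟩ := (isOfFinOrder_of_finite (Units.mk0 c hc)).exists_pow_eq_one
      have h' : c ^ n = 1 := by simpa [Units.ext_iff] using h
      have h'' : v (f c) ^ n = 1 := by rw [← map_pow, ← map_pow, h', map_one, map_one]
      exact (pow_le_one_iff hn.ne').1 h''.le

/-- The degree over the finite field `k` of the residue field of a valuation `v` on `K`, where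
the residue field is a `k`-vector space through `f : k →+* K`. -/
noncomputable def residueDegree {k K : Type*} [Field k] [Finite k] [Field K]
    (f : k →+* K) (v : Valuation K ℤᵐ⁰) : ℕ :=
  letI : Algebra k (IsLocalRing.ResidueField v.valuationSubring) :=
    ((IsLocalRing.residue v.valuationSubring).comp (toValuationRing f v)).toAlgebra
  Module.finrank k (IsLocalRing.ResidueField v.valuationSubring)

/-- A place of `F`, given by its normalized (surjective) discrete valuation. -/
@[ext]
structure Place (F : Type*) [Field F] where
  val : Valuation F ℤᵐ⁰
  surj : Function.Surjective val

namespace Place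

variable {F : Type*} [Field F] (v : Place F)

/-- The completion `F_v` of `F` at the place `v`. -/
abbrev Compl : Type _ := v.val.Completion

/-- The embedding of `F` into its completion. -/
noncomputable def embed : F →+* v.Compl :=
  (UniformSpace.Completion.coeRingHom (α := WithVal v.val)).comp
    (WithVal.equiv v.val).symm.toRingHom

/-- The normalized valuation on the completion `F_v`. -/
noncomputable def complVal : Valuation v.Compl ℤᵐ⁰ := Valued.v

/-- The degree `d_v` over `k` of the residue field of `F_v`. -/
noncomputable def degree (k : Type*) [Field k] [Finite k] [Algebra k F] : ℕ :=
  residueDegree (v.embed.comp (algebraMap k F)) v.complVal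

/-- The ring of functions that are regular away from the place `v`. -/
def regularAway : Subring F := ⨅ (w : Place F) (_ : w ≠ v), w.val.integer

end Place

/-! ### Central division algebras over a local field and their invariants -/

/-- `D` is a central division algebra (of finite dimension) over `K`. -/
structure IsCentralDivisionAlgebra (K D : Type*) [Field K] [Ring D] [Algebra K D] : Prop where
  central : Algebra.IsCentral K D
  finite : FiniteDimensional K D
  nontrivial : Nontrivial D
  isUnit : ∀ x : D, x ≠ 0 → IsUnit x

/-- The central division algebra `D` over the nonarchimedean local field `K`, with normalized
discrete valuation `v` and residue field of cardinality `Q`, has (Hasse) invariant `r` modulo `ℤ`.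

With `m² = [D : K]`, the unramified extension of `K` of degree `m` is generated by a root of unity
`ζ` of order `Qᵐ - 1`, and its Frobenius automorphism sends `ζ` to `ζ ^ Q`.  By definition the
invariant of `D` is the class of `w(γ)` in `ℚ/ℤ`, where `K(ζ) ⊆ D` is such a maximal subfield,
`γ ∈ Dˣ` is such that `x ↦ γ x γ⁻¹` induces the Frobenius automorphism on it, and
`w = [D : K]⁻¹ · ord ∘ N_{D/K}` is the valuation of `D` that extends `ord` on `K`
(`N_{D/K}(γ)` is the determinant of left multiplication by `γ`). -/
def HasInvariant {K : Type*} [Field K] (v : Valuation K ℤᵐ⁰) (D : Type*) [Ring D] [Algebra K D]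
    (r : ℚ) : Prop :=
  ∃ m : ℕ, 0 < m ∧ Module.finrank K D = m ^ 2 ∧
    ∃ ζ γ : Dˣ,
      orderOf ζ = Nat.card (IsLocalRing.ResidueField v.valuationSubring) ^ m - 1 ∧
      γ * ζ * γ⁻¹ = ζ ^ Nat.card (IsLocalRing.ResidueField v.valuationSubring) ∧
      ∃ z : ℤ, (addOrd v (Algebra.norm K (γ : D)) : ℚ) / Module.finrank K D = r + z

/-! ### Frobenius, twisted polynomials and Drinfeld modules -/

/-- The automorphism `x ↦ x ^ q` of an algebraically closed extension of the finite field `k`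
with `q` elements. -/
noncomputable def frob (k K : Type*) [Field k] [Fintype k] [Field K] [Algebra k K]
    [IsAlgClosed K] : K ≃+* K :=
  RingEquiv.ofBijective (FiniteField.frobeniusAlgHom k K : K →+* K)
    ⟨RingHom.injective _, fun x => by
      obtain ⟨z, hz⟩ := IsAlgClosed.exists_pow_nat_eq x (Fintype.card_pos (α := k))
      exact ⟨z, hz⟩⟩

section Drinfeld

variable (k F : Type*) [Field k] [Fintype k] [Field F] (infty : Place F)
  (L Lbar : Type*) [Field L] [Algebra k L] [Field Lbar] [Algebra L Lbar] [Algebra k Lbar]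
  [IsScalarTower k L Lbar] [IsAlgClosed Lbar]

/-- The skew field `L̄((τ⁻¹))`, with `τ a = a ^ q τ`. -/
abbrev Series : Type _ := TwistedLaurent Lbar (frob k Lbar)

/-- The twisted polynomial ring `L[τ]`, as the subring of `L̄((τ⁻¹))` of those series with
coefficients in `L` in which only nonnegative powers of `τ` occur. -/
def twistedPoly : Subring (Series k Lbar) where
  carrier := {f | f.CoeffsIn (Set.range (algebraMap L Lbar)) ∧ ∀ i > 0, f.coeff i = 0}
  zero_mem' := ⟨fun _ => ⟨0, map_zero _⟩, fun _ _ => rfl⟩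
  one_mem' := by
    refine ⟨fun i => ?_, fun i hi => ?_⟩
    · rw [TwistedLaurent.coeff_one]
      split_ifs
      exacts [⟨1, map_one _⟩, ⟨0, map_zero _⟩]
    · rw [TwistedLaurent.coeff_one, if_neg (by omega)]
  add_mem' := fun {f g} hf hg =>
    ⟨fun i => (algebraMap L Lbar).range.add_mem (hf.1 i) (hg.1 i),
      fun i hi => by rw [TwistedLaurent.coeff_add, hf.2 i hi, hg.2 i hi, add_zero]⟩
  neg_mem' := fun {f} hf =>
    ⟨fun i => (algebraMap L Lbar).range.neg_mem (hf.1 i),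
      fun i hi => by rw [TwistedLaurent.coeff_neg, hf.2 i hi, neg_zero]⟩
  mul_mem' := fun {f g} hf hg => by
    have hθ : ∀ (n : ℕ) (x : Lbar), x ∈ (algebraMap L Lbar).range →
        (frob k Lbar ^ n) x ∈ (algebraMap L Lbar).range := by
      intro n
      induction n with
      | zero => intro x hx; exact hx
      | succ n ih =>
        intro x hx
        rw [pow_succ, RingAut.mul_apply]
        exact ih _ ((algebraMap L Lbar).range.pow_mem hx (Fintype.card k))
    refine ⟨fun m => ?_, fun m hm => ?_⟩
    · rw [TwistedLaurent.coeff_mul]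
      refine finsum_induction (· ∈ (algebraMap L Lbar).range)
        (algebraMap L Lbar).range.zero_mem
        (fun _ _ hx hy => (algebraMap L Lbar).range.add_mem hx hy) fun i => ?_
      by_cases hi : 0 < i
      · rw [hf.2 i hi, zero_mul]
        exact (algebraMap L Lbar).range.zero_mem
      · refine (algebraMap L Lbar).range.mul_mem (hf.1 i) ?_
        obtain ⟨n, hn⟩ := Int.eq_ofNat_of_zero_le (show 0 ≤ -i by omega)
        rw [hn, zpow_natCast]
        exact hθ n _ (hg.1 _)
    · rw [TwistedLaurent.coeff_mul]
      refine finsum_eq_zero_of_forall_eq_zero fun i => ?_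
      by_cases hi : 0 < i
      · rw [hf.2 i hi, zero_mul]
      · rw [hg.2 (m - i) (by omega), map_zero, mul_zero]

/-- A Drinfeld module over `L`: a ring homomorphism `φ : A → L[τ]`, where `A` is the ring of
functions regular away from `∞`, such that `φ(A)` does not consist of constant polynomials.
(If `L` carries the `k`-structure `∂ ∘ φ|_k`, then `φ` is `k`-linear; any other `k`-structure on `L`
gives the same ring `L[τ]` and the same subfield `k̄`, so no compatibility has to be imposed.) -/
structure DrinfeldModule where
  toRingHom : infty.regularAway →+* twistedPoly k L Lbar
  nonconstant : ∃ a, ∃ i ≠ 0, (toRingHom a : Series k Lbar).coeff i ≠ 0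

namespace DrinfeldModule

variable {k F infty L Lbar}
variable [Algebra k F] (φ : DrinfeldModule k F infty L Lbar)

/-- `φ_a`, viewed in `L̄((τ⁻¹))`. -/
noncomputable def app (a : infty.regularAway) : Series k Lbar := (φ.toRingHom a : Series k Lbar)

/-- `φ` has rank `n`: `n > 0` and `ord_{τ⁻¹}(φ_a) = n d_∞ ord_∞(a)` for all nonzero `a ∈ A`. -/
def HasRank (n : ℕ) : Prop :=
  0 < n ∧ ∀ a : infty.regularAway, a ≠ 0 →
    (φ.app a).ord = ((n * infty.degree k * addOrd infty.val (a : F) : ℤ) : WithTop ℤ)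

/-- `Φ` is an extension of `φ` (of rank `n`) to a homomorphism `F_∞ → L^perf((τ⁻¹))` with
`ord_{τ⁻¹}(Φ(x)) = n d_∞ ord_∞(x)` for all nonzero `x ∈ F_∞`. -/
structure IsExtension (n : ℕ) (Φ : infty.Compl →+* Series k Lbar) : Prop where
  extends_app : ∀ a : infty.regularAway, Φ (infty.embed a) = φ.app a
  coeffs_perf : ∀ x, (Φ x).CoeffsIn (perfectClosure L Lbar : Set Lbar)
  ord_eq : ∀ x, x ≠ 0 →
    (Φ x).ord = ((n * infty.degree k * addOrd infty.complVal x : ℤ) : WithTop ℤ)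

/-- `D_φ`, the centralizer of `φ(A)` in `L̄((τ⁻¹))`. -/
noncomputable def centralizer : Subring (Series k Lbar) := Subring.centralizer (Set.range φ.app)

/-- `End_L(φ)`, the centralizer of `φ(A)` in `L[τ]`. -/
noncomputable def endRing : Subring (Series k Lbar) := twistedPoly k L Lbar ⊓ φ.centralizer

end DrinfeldModule

end Drinfeld

/-! ### The Weil group -/

theorem galSep_mem_algebraicClosure {k L Lbar : Type*} [Field k] [Field L] [Algebra k L]
    [Field Lbar] [Algebra L Lbar] [Algebra k Lbar] [IsScalarTower k L Lbar]
    {σ : Gal(separableClosure L Lbar/L)} (x : separableClosure L Lbar)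
    (hx : (x : Lbar) ∈ algebraicClosure k Lbar) : (σ x : Lbar) ∈ algebraicClosure k Lbar := by
  rw [mem_algebraicClosure_iff] at hx ⊢
  have : IsScalarTower k (separableClosure L Lbar) Lbar :=
    IsScalarTower.of_algebraMap_eq fun _ => rfl
  have h : IsAlgebraic k x :=
    (isAlgebraic_algebraMap_iff (algebraMap (separableClosure L Lbar) Lbar).injective).1 hx
  exact (h.algHom ((σ : separableClosure L Lbar →ₐ[L] separableClosure L Lbar).restrictScalars
    k)).algebraMap

section Weil

variable (k L Lbar : Type*) [Field k] [Fintype k] [Field L] [Algebra k L] [Field Lbar]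
  [Algebra L Lbar] [Algebra k Lbar] [IsScalarTower k L Lbar] [IsAlgClosed Lbar]

/-- The absolute Galois group `Gal(L^sep/L)`. -/
abbrev GalSep : Type _ := Gal(separableClosure L Lbar/L)

/-- `σ` acts on `k̄` (the algebraic closure of `k` in `L̄`, which lies in `L^sep`) as the `d`-th
power of the Frobenius `x ↦ x ^ q`. -/
def ActsAsFrobPow (σ : GalSep L Lbar) (d : ℤ) : Prop :=
  ∀ x : separableClosure L Lbar, (x : Lbar) ∈ algebraicClosure k Lbar →
    (σ x : Lbar) = (frob k Lbar ^ d) (x : Lbar)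

/-- The Weil group `W_L`, as a subgroup of `Gal(L^sep/L)`. -/
def weilSubgroup : Subgroup (GalSep L Lbar) where
  carrier := {σ | ∃ d : ℤ, ActsAsFrobPow k L Lbar σ d}
  one_mem' := ⟨0, fun x _ => rfl⟩
  mul_mem' := by
    rintro σ τ ⟨d, hd⟩ ⟨e, he⟩
    refine ⟨d + e, fun x hx => ?_⟩
    rw [zpow_add, RingAut.mul_apply, ← he x hx]
    exact hd _ (galSep_mem_algebraicClosure x hx)
  inv_mem' := by
    rintro σ ⟨d, hd⟩
    refine ⟨-d, fun x hx => ?_⟩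
    have h := hd (σ⁻¹ x) (galSep_mem_algebraicClosure x hx)
    have h' : σ (σ⁻¹ x) = x := σ.apply_symm_apply x
    rw [h'] at h
    rw [h, ← RingAut.mul_apply, ← zpow_add, neg_add_cancel, zpow_zero]
    rfl

/-- The Weil group `W_L`. -/
def WeilGroup : Type _ := weilSubgroup k L Lbar

noncomputable instance : Group (WeilGroup k L Lbar) :=
  inferInstanceAs (Group (weilSubgroup k L Lbar))

variable {k L Lbar}

/-- The automorphism of `L^sep` given by an element of the Weil group. -/
def WeilGroup.toGal (σ : WeilGroup k L Lbar) : GalSep L Lbar :=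
  (σ : weilSubgroup k L Lbar).1

/-- The degree `deg(σ)`: `σ` acts on `k̄` as `x ↦ x ^ (q ^ deg σ)`. -/
noncomputable def WeilGroup.deg (σ : WeilGroup k L Lbar) : ℤ :=
  Classical.choose (σ : weilSubgroup k L Lbar).2

/-- The usual topology of the Weil group: the coarsest one for which `W_L → Gal(L^sep/L)` (with
the Krull topology) and `deg : W_L → ℤ` (with `ℤ` discrete) are continuous; equivalently,
`Gal(L^sep/L k̄) = ker deg` carries the Krull topology and is open in `W_L`. -/
noncomputable instance : TopologicalSpace (WeilGroup k L Lbar) :=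
  TopologicalSpace.induced (fun σ => (σ.toGal, σ.deg)) inferInstance

/-- The action of `σ` on a series with coefficients in `L^sep`, coefficient by coefficient. -/
def WeilGroup.act (σ : WeilGroup k L Lbar) (f : Series k Lbar)
    (hf : f.CoeffsIn (separableClosure L Lbar : Set Lbar)) : Series k Lbar where
  coeff i := (σ.toGal ⟨f.coeff i, hf i⟩ : Lbar)
  bdd := by
    obtain ⟨N, hN⟩ := f.bdd
    refine ⟨N, fun i hi => ?_⟩
    have h : (⟨f.coeff i, hf i⟩ : separableClosure L Lbar) = 0 := Subtype.ext (hN i hi)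
    rw [h, map_zero]
    rfl

end Weil

/-! The main tool is the equation f u − u g = h in twisted Laurent series. If f and g both start in
degree N, then the coefficient of degree s + N involves u_s only through f_N θ^(−N)(u_s) − u_s
θ^(−s)(g_N), so u can be found term by term (`exists_mul_sub_mul_eq`), and its coefficients can be
located term by term (`coeffsIn_of_mul_sub_mul`). For N = −r < 0 and θ the Frobenius, the leading
equation is a x^(q^r) − b x = c. It is solvable over L̄; its roots lie in k̄ if a, b, c do, and in
L^sep if a, b, c do and b ≠ 0, because the derivative is the constant −b.

Extension to F_∞. Some φ_t has negative order, so t is transcendental over k and F is algebraic over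
k[t]. Hence φ is injective and F is the fraction field of A; nonzero series are units, so φ extends
to F. The order of the image is a positive multiple m of a normalized valuation
(`exists_place_of_ringHom`). Its place must be ∞, since t has a pole there and t is regular away
from ∞. Continuity then gives the extension to F_∞. Comparing leading terms of products with an
element of order −m shows that the residue field lies in F_(q^m), so d = d_∞ divides m, and the rank
is n = m/d.

Normal form (`exists_unit_normal`). Averaging over F_(q^d)^× conjugates the Teichmüller
representatives to constants; solving the equation above then conjugates a uniformizer to τ^(−m)
without disturbing the constants. The image becomes F_(q^d)((τ^(−nd))), with centralizer
F_(q^(nd))((τ^(−d))). There the centre, a basis with n² elements and the invariant are visible: γ =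
τ^d induces x ↦ x^(q^d) on F_(q^(nd)), and γ^n is the inverse of a uniformizer, so w(γ) = −1/n.

Weil group. For g with coefficients in k̄ one has σ(g) τ^(deg σ) = τ^(deg σ) g
(`seriesEquiv_mul_tau`). If u and v both conjugate φ(A) into k̄((τ⁻¹)), then u⁻¹v has coefficients
in k̄, because it intertwines two series of negative order over k̄; this applies also to v = σ(u).
These two facts show that σ(u) τ^(deg σ) u⁻¹ is independent of u, is multiplicative in σ, and
commutes with φ(A) and End_L(φ). -/

/-! ### Orders, term-by-term equations and inverses in twisted Laurent series -/

/-- Solving for the terms of a two-sided sequence one after the other. -/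
theorem exists_seq_of_step {K : Type*} [Zero K] (B : ℤ) (R : ℤ → (ℤ → K) → Prop)
    (hR : ∀ s g g', (∀ i ≤ s, g i = g' i) → R s g → R s g')
    (step : ∀ s ≥ B, ∀ g : ℤ → K, ∃ x, R s (Function.update g s x)) :
    ∃ g : ℤ → K, (∀ i < B, g i = 0) ∧ ∀ s ≥ B, R s g := by
  have step' : ∀ (n : ℕ) (g : ℤ → K), ∃ x, R (B + n) (Function.update g (B + n) x) :=
    fun n g => step _ (by omega) g
  choose x hx using step'
  let G : ℕ → ℤ → K := fun n => Nat.rec (fun _ => 0)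
    (fun n g => Function.update g (B + n) (x n g)) n
  have hG : ∀ n, G (n + 1) = Function.update (G n) (B + n) (x n (G n)) := fun n => rfl
  have hlow : ∀ n, ∀ i < B, G n i = 0 := by
    intro n
    induction n with
    | zero => intro i _; rfl
    | succ n ih =>
      intro i hi
      rw [hG, Function.update_of_ne (by omega), ih i hi]
  have hst : ∀ k n : ℕ, k + 1 ≤ n → G n (B + k) = G (k + 1) (B + k) := by
    intro k n hn
    induction n, hn using Nat.le_induction with
    | base => rfl
    | succ n hn ih => rw [hG, Function.update_of_ne (by omega), ih]
  refine ⟨fun i => G ((i - B).toNat + 1) i, fun i hi => hlow ((i - B).toNat + 1) i hi, fun s hs => ?_⟩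
  obtain ⟨k, rfl⟩ : ∃ k : ℕ, s = B + k := ⟨(s - B).toNat, by omega⟩
  -- The relation at B + k sees only entries up to B + k, and these are final from stage k + 1 on.
  refine hR _ (G (k + 1)) _ (fun i hi => ?_) (hG k ▸ hx k (G k))
  by_cases h : i < B
  · exact (hlow (k + 1) i h).trans (hlow ((i - B).toNat + 1) i h).symm
  · obtain ⟨j, rfl⟩ : ∃ j : ℕ, i = B + j := ⟨(i - B).toNat, by omega⟩
    have hj : (B + (j : ℤ) - B).toNat = j := by omega
    change G (k + 1) (B + j) = G ((B + (j : ℤ) - B).toNat + 1) (B + j)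
    rw [hst j (k + 1) (by omega), hj]

namespace TwistedLaurent

variable {K : Type*} [Field K] {θ : K ≃+* K}

@[simp] theorem coeff_sub (f g : TwistedLaurent K θ) (i : ℤ) :
    (f - g).coeff i = f.coeff i - g.coeff i := by
  rw [sub_eq_add_neg, coeff_add, coeff_neg, sub_eq_add_neg]

theorem coeff_sum {ι : Type*} (s : Finset ι) (f : ι → TwistedLaurent K θ) (i : ℤ) :
    (∑ j ∈ s, f j).coeff i = ∑ j ∈ s, (f j).coeff i := by
  classical
  induction s using Finset.induction_on with
  | empty => simp
  | insert a s ha ih => rw [Finset.sum_insert ha, Finset.sum_insert ha, coeff_add, ih]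

theorem coeff_mul_monomial (f : TwistedLaurent K θ) (j : ℤ) (a : K) (m : ℤ) :
    (f * monomial θ j a).coeff m = f.coeff (m - j) * (θ ^ (-(m - j))) a := by
  rw [coeff_mul, finsum_eq_single _ (m - j)]
  · simp [coeff_monomial]
  · intro i hi
    rw [coeff_monomial, if_neg (by omega), map_zero, mul_zero]

theorem coeff_monomial_mul (f : TwistedLaurent K θ) (j : ℤ) (a : K) (m : ℤ) :
    (monomial θ j a * f).coeff m = a * (θ ^ (-j)) (f.coeff (m - j)) := by
  rw [coeff_mul, finsum_eq_single _ j]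
  · simp [coeff_monomial]
  · intro i hi
    rw [coeff_monomial, if_neg hi, zero_mul]

theorem coeff_mul_of_lt {f g : TwistedLaurent K θ} {M N : ℤ} (hf : ∀ i < M, f.coeff i = 0)
    (hg : ∀ i < N, g.coeff i = 0) : ∀ i < M + N, (f * g).coeff i = 0 := fun i hi => by
  rw [coeff_mul_eq_sum f g hf hg i ∅ (by rw [Finset.Icc_eq_empty (by omega)]),
    Finset.sum_empty]

theorem coeff_mul_add {f g : TwistedLaurent K θ} {M N : ℤ} (hf : ∀ i < M, f.coeff i = 0)
    (hg : ∀ i < N, g.coeff i = 0) :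
    (f * g).coeff (M + N) = f.coeff M * (θ ^ (-M)) (g.coeff N) := by
  rw [coeff_mul_eq_sum f g hf hg (M + N) {M} (by simp), Finset.sum_singleton]
  congr 3
  omega

/-- `f` has order exactly `N`. -/
def IsOrd (f : TwistedLaurent K θ) (N : ℤ) : Prop := (∀ i < N, f.coeff i = 0) ∧ f.coeff N ≠ 0

theorem IsOrd.ne_zero {f : TwistedLaurent K θ} {N : ℤ} (h : f.IsOrd N) : f ≠ 0 := by
  rintro rfl
  exact h.2 rfl

theorem exists_isOrd {f : TwistedLaurent K θ} (hf : f ≠ 0) : ∃ N, f.IsOrd N := by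
  classical
  obtain ⟨M, hM⟩ := f.bdd
  obtain ⟨j, hj⟩ : ∃ j, f.coeff j ≠ 0 := by
    by_contra! h
    exact hf (TwistedLaurent.ext (funext h))
  obtain ⟨N, hN, hmin⟩ := Int.exists_least_of_bdd (P := fun i => f.coeff i ≠ 0)
    ⟨M, fun i hi => not_lt.1 fun h => hi (hM i h)⟩ ⟨j, hj⟩
  exact ⟨N, fun i hi => by_contra fun h => absurd (hmin i h) (not_le.2 hi), hN⟩

theorem IsOrd.ord_eq {f : TwistedLaurent K θ} {N : ℤ} (h : f.IsOrd N) :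
    f.ord = (N : WithTop ℤ) := by
  have hl : IsLeast {i : ℤ | f.coeff i ≠ 0} N :=
    ⟨h.2, fun i hi => not_lt.1 fun hlt => hi (h.1 i hlt)⟩
  rw [ord, if_neg h.ne_zero, hl.csInf_eq]

theorem ord_eq_iff {f : TwistedLaurent K θ} {N : ℤ} : f.ord = (N : WithTop ℤ) ↔ f.IsOrd N := by
  refine ⟨fun h => ?_, IsOrd.ord_eq⟩
  have hf : f ≠ 0 := by
    rintro rfl
    simp [ord] at h
  obtain ⟨M, hM⟩ := exists_isOrd hf
  rw [hM.ord_eq, WithTop.coe_inj] at h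
  exact h ▸ hM

theorem IsOrd.unique {f : TwistedLaurent K θ} {M N : ℤ} (h : f.IsOrd M) (h' : f.IsOrd N) :
    M = N := by
  have := h.ord_eq.symm.trans h'.ord_eq
  exact_mod_cast this

theorem IsOrd.mul {f g : TwistedLaurent K θ} {M N : ℤ} (hf : f.IsOrd M) (hg : g.IsOrd N) :
    (f * g).IsOrd (M + N) := by
  refine ⟨coeff_mul_of_lt hf.1 hg.1, ?_⟩
  rw [coeff_mul_add hf.1 hg.1]
  exact mul_ne_zero hf.2 ((map_ne_zero_iff _ (θ ^ (-M)).injective).2 hg.2)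

theorem isOrd_monomial {i : ℤ} {a : K} (ha : a ≠ 0) : (monomial θ i a).IsOrd i :=
  ⟨fun j hj => by rw [coeff_monomial, if_neg hj.ne], by rwa [coeff_monomial, if_pos rfl]⟩

theorem isOrd_one : (1 : TwistedLaurent K θ).IsOrd 0 := isOrd_monomial one_ne_zero

instance : Nontrivial (TwistedLaurent K θ) := ⟨1, 0, isOrd_one.ne_zero⟩

instance : NoZeroDivisors (TwistedLaurent K θ) where
  eq_zero_or_eq_zero_of_mul_eq_zero {f g} h := by
    by_contra! hne
    obtain ⟨M, hM⟩ := exists_isOrd hne.1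
    obtain ⟨N, hN⟩ := exists_isOrd hne.2
    exact (hM.mul hN).ne_zero h

/-- The equation `f u - u g = h` can be solved for `u`, if it can be solved for leading terms. -/
theorem exists_mul_sub_mul_eq (f g h : TwistedLaurent K θ) {N B : ℤ}
    (hf : ∀ i < N, f.coeff i = 0) (hg : ∀ i < N, g.coeff i = 0)
    (hh : ∀ i < B + N, h.coeff i = 0)
    (hs : ∀ (s : ℤ) (c : K), ∃ x, f.coeff N * (θ ^ (-N)) x - x * (θ ^ (-s)) (g.coeff N) = c) :
    ∃ u : TwistedLaurent K θ, (∀ i < B, u.coeff i = 0) ∧ f * u - u * g = h := by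
  obtain ⟨u, hu0, hu⟩ := exists_seq_of_step B
    (fun s u => (∑ i ∈ Finset.Icc N (s + N - B), f.coeff i * (θ ^ (-i)) (u (s + N - i))) -
      ∑ i ∈ Finset.Icc B s, u i * (θ ^ (-i)) (g.coeff (s + N - i)) = h.coeff (s + N))
    (by
      intro s u u' huu' hu
      rw [← hu]
      congr 1
      · refine Finset.sum_congr rfl fun i hi => ?_
        rw [Finset.mem_Icc] at hi
        rw [huu' _ (by omega)]
      · refine Finset.sum_congr rfl fun i hi => ?_
        rw [Finset.mem_Icc] at hi
        rw [huu' _ (by omega)])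
    (by
      intro s hsB u
      obtain ⟨x, hx⟩ := hs s (h.coeff (s + N) -
        ((∑ i ∈ Finset.Ioc N (s + N - B), f.coeff i * (θ ^ (-i)) (u (s + N - i))) -
          ∑ i ∈ Finset.Ico B s, u i * (θ ^ (-i)) (g.coeff (s + N - i))))
      refine ⟨x, ?_⟩
      -- The new entry x occurs only in the term i = N of the first sum and in the term i = s of the
      -- second.
      rw [← Finset.Ioc_insert_left (show N ≤ s + N - B by omega),
        ← Finset.Ico_insert_right hsB, Finset.sum_insert (by simp), Finset.sum_insert (by simp)]
      have h1 : ∀ i ∈ Finset.Ioc N (s + N - B),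
          f.coeff i * (θ ^ (-i)) (Function.update u s x (s + N - i)) =
            f.coeff i * (θ ^ (-i)) (u (s + N - i)) := by
        intro i hi
        rw [Finset.mem_Ioc] at hi
        rw [Function.update_of_ne (by omega)]
      have h2 : ∀ i ∈ Finset.Ico B s,
          Function.update u s x i * (θ ^ (-i)) (g.coeff (s + N - i)) =
            u i * (θ ^ (-i)) (g.coeff (s + N - i)) := by
        intro i hi
        rw [Finset.mem_Ico] at hi
        rw [Function.update_of_ne (by omega)]
      rw [Finset.sum_congr rfl h1, Finset.sum_congr rfl h2]
      simp only [add_sub_cancel_right, add_sub_cancel_left, Function.update_self]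
      linear_combination hx)
  refine ⟨⟨u, B, hu0⟩, hu0, ?_⟩
  ext l
  rcases lt_or_ge l (B + N) with hl | hl
  · rw [coeff_sub, coeff_mul_of_lt hf hu0 l (by omega), coeff_mul_of_lt hu0 hg l (by omega),
      sub_zero, hh l hl]
  · have := hu (l - N) (by omega)
    rw [sub_add_cancel] at this
    rw [coeff_sub, coeff_mul_eq_sum f _ hf hu0 l _ subset_rfl,
      coeff_mul_eq_sum _ g hu0 hg l _ subset_rfl]
    exact this

/-- If `f w - w g = h`, then the coefficients of `w` lie in a group `E`, if `E` is closed under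
taking solutions of the equation for the leading terms. -/
theorem coeffsIn_of_mul_sub_mul (E : AddSubgroup K) (f g w : TwistedLaurent K θ) {N : ℤ}
    (hf : ∀ i < N, f.coeff i = 0) (hg : ∀ i < N, g.coeff i = 0)
    (hfE : ∀ i, ∀ x ∈ E, f.coeff i * (θ ^ (-i)) x ∈ E)
    (hgE : ∀ s i : ℤ, ∀ x ∈ E, x * (θ ^ (-s)) (g.coeff i) ∈ E)
    (hh : (f * w - w * g).CoeffsIn E)
    (hroot : ∀ (s : ℤ) (x : K), f.coeff N * (θ ^ (-N)) x - x * (θ ^ (-s)) (g.coeff N) ∈ E → x ∈ E) :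
    w.CoeffsIn E := by
  obtain ⟨B, hB⟩ := w.bdd
  have key : ∀ n : ℕ, ∀ i < B + n, w.coeff i ∈ E := by
    intro n
    induction n with
    | zero =>
      intro i hi
      rw [hB i (by omega)]
      exact E.zero_mem
    | succ n ih =>
      intro s hs
      by_cases hlt : s < B + n
      · exact ih s hlt
      have hsB : B ≤ s := by omega
      refine hroot s _ ?_
      have := hh (s + N)
      rw [coeff_sub, coeff_mul_eq_sum f w hf hB (s + N) _ subset_rfl,
        coeff_mul_eq_sum w g hB hg (s + N) _ subset_rfl, add_sub_cancel_right,
        ← Finset.Ioc_insert_left (show N ≤ s + N - B by omega),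
        ← Finset.Ico_insert_right hsB, Finset.sum_insert (by simp),
        Finset.sum_insert (by simp)] at this
      simp only [add_sub_cancel_right, add_sub_cancel_left] at this
      have h1 : ∑ i ∈ Finset.Ioc N (s + N - B), f.coeff i * (θ ^ (-i)) (w.coeff (s + N - i)) ∈ E := by
        refine E.sum_mem fun i hi => hfE _ _ (ih _ ?_)
        rw [Finset.mem_Ioc] at hi
        omega
      have h2 : ∑ i ∈ Finset.Ico B s, w.coeff i * (θ ^ (-i)) (g.coeff (s + N - i)) ∈ E := by
        refine E.sum_mem fun i hi => hgE _ _ _ (ih _ ?_)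
        rw [Finset.mem_Ico] at hi
        omega
      have h3 := E.add_mem (E.sub_mem this h1) h2
      convert h3 using 1
      ring
  intro i
  refine key (i - B + 1).toNat i (by omega)

/-- This is `exists_mul_sub_mul_eq` with g = 0 and h = 1: the leading equation a θ^(−N)(x) = c with
a ≠ 0 is solvable because θ is bijective. -/
theorem exists_mul_eq_one {f : TwistedLaurent K θ} (hf : f ≠ 0) : ∃ g, f * g = 1 := by
  obtain ⟨N, hN⟩ := exists_isOrd hf
  obtain ⟨u, -, hu⟩ := exists_mul_sub_mul_eq f 0 1 (N := N) (B := -N) hN.1 (fun _ _ => rfl)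
    (fun i hi => by rw [coeff_one, if_neg (by omega)]) (fun s c =>
      ⟨(θ ^ (-N)).symm (c / f.coeff N), by
        rw [RingEquiv.apply_symm_apply, coeff_zero, map_zero, mul_zero, sub_zero,
          mul_div_cancel₀ _ hN.2]⟩)
  exact ⟨u, by simpa using hu⟩

theorem isUnit_of_ne_zero {f : TwistedLaurent K θ} (hf : f ≠ 0) : IsUnit f := by
  obtain ⟨g, hg⟩ := exists_mul_eq_one hf
  have hg0 : g ≠ 0 := by
    rintro rfl
    simp at hg
  obtain ⟨h, hh⟩ := exists_mul_eq_one hg0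
  have : h = f := by rw [← one_mul h, ← hg, mul_assoc, hh, mul_one]
  exact ⟨⟨f, g, hg, this ▸ hh⟩, rfl⟩

theorem exists_isOrd_unit (u : (TwistedLaurent K θ)ˣ) : ∃ N, (u : TwistedLaurent K θ).IsOrd N :=
  exists_isOrd u.ne_zero

theorem IsOrd.inv {u : (TwistedLaurent K θ)ˣ} {N : ℤ} (h : (u : TwistedLaurent K θ).IsOrd N) :
    (↑u⁻¹ : TwistedLaurent K θ).IsOrd (-N) := by
  obtain ⟨M, hM⟩ := exists_isOrd_unit u⁻¹
  have := (h.mul hM).unique (by rw [u.mul_inv]; exact isOrd_one)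
  obtain rfl : M = -N := by omega
  exact hM

theorem IsOrd.conj {f : TwistedLaurent K θ} {N : ℤ} (h : f.IsOrd N) (u : (TwistedLaurent K θ)ˣ) :
    (↑u⁻¹ * f * ↑u : TwistedLaurent K θ).IsOrd N := by
  obtain ⟨M, hM⟩ := exists_isOrd_unit u
  have := (hM.inv.mul h).mul hM
  rwa [show -M + N + M = N by ring] at this

theorem IsOrd.pow {f : TwistedLaurent K θ} {N : ℤ} (h : f.IsOrd N) (n : ℕ) :
    (f ^ n).IsOrd (n * N) := by
  induction n with
  | zero => simpa using isOrd_one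
  | succ n ih =>
    rw [pow_succ]
    have := ih.mul h
    rwa [show (n : ℤ) * N + N = ((n + 1 : ℕ) : ℤ) * N by push_cast; ring] at this

theorem tau_zpow (d : ℤ) : ((tau θ ^ d : (TwistedLaurent K θ)ˣ) : TwistedLaurent K θ) =
    monomial θ (-d) 1 := by
  have hnat : ∀ n : ℕ, ((tau θ ^ n : (TwistedLaurent K θ)ˣ) : TwistedLaurent K θ) =
      monomial θ (-(n : ℤ)) 1 := by
    intro n
    induction n with
    | zero => simp; rfl
    | succ n ih =>
      rw [pow_succ, Units.val_mul, ih]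
      change _ * monomial θ (-1) 1 = _
      rw [monomial_mul_monomial, map_one, mul_one]
      congr 1
      push_cast
      ring
  have hneg : ∀ n : ℕ, (((tau θ)⁻¹ ^ n : (TwistedLaurent K θ)ˣ) : TwistedLaurent K θ) =
      monomial θ (n : ℤ) 1 := by
    intro n
    induction n with
    | zero => simp; rfl
    | succ n ih =>
      rw [pow_succ, Units.val_mul, ih]
      change _ * monomial θ 1 1 = _
      rw [monomial_mul_monomial, map_one, mul_one]
      congr 1
  obtain ⟨n, rfl | rfl⟩ := d.eq_nat_or_neg
  · exact_mod_cast hnat n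
  · rw [zpow_neg, zpow_natCast, ← inv_pow, hneg, neg_neg]

end TwistedLaurent

/-! ### The τ⁻¹-adic topology, completeness, and operations on coefficients -/

namespace TwistedLaurent

variable {K : Type*} [Field K] {θ : K ≃+* K}

open Topology Filter

theorem nhds_hasBasis (f : TwistedLaurent K θ) :
    (𝓝 f).HasBasis (fun _ : ℤ => True) (fun N => {g | ∀ i < N, g.coeff i = f.coeff i}) := by
  refine ⟨fun s => ⟨fun h => ?_, ?_⟩⟩
  · obtain ⟨U, hUs, hU, hf⟩ := mem_nhds_iff.1 h
    obtain ⟨N, hN⟩ := hU f hf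
    exact ⟨N, trivial, fun g hg => hUs (hN g hg)⟩
  · rintro ⟨N, -, hN⟩
    exact mem_nhds_iff.2 ⟨_, hN, fun g hg => ⟨N, fun h hh i hi => (hh i hi).trans (hg i hi)⟩,
      fun i _ => rfl⟩

instance : IsTopologicalRing (TwistedLaurent K θ) where
  continuous_add := continuous_iff_continuousAt.2 fun p => by
    refine (((nhds_hasBasis p.1).prod_nhds (nhds_hasBasis p.2)).tendsto_iff
      (nhds_hasBasis (p.1 + p.2))).2 fun N _ => ⟨(N, N), ⟨trivial, trivial⟩, fun x hx i hi => ?_⟩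
    rw [coeff_add, coeff_add, hx.1 i hi, hx.2 i hi]
  continuous_neg := continuous_iff_continuousAt.2 fun f => by
    refine ((nhds_hasBasis f).tendsto_iff
      (nhds_hasBasis (-f))).2 fun N _ => ⟨N, trivial, fun x hx i hi => ?_⟩
    rw [coeff_neg, coeff_neg, hx i hi]
  continuous_mul := continuous_iff_continuousAt.2 fun ⟨f, g⟩ => by
    obtain ⟨M, hM⟩ := f.bdd
    obtain ⟨M', hM'⟩ := g.bdd
    refine (((nhds_hasBasis f).prod_nhds (nhds_hasBasis g)).tendsto_iff
      (nhds_hasBasis (f * g))).2 fun N _ =>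
      ⟨(max M (N - M'), N - M), ⟨trivial, trivial⟩, fun x hx i hi => ?_⟩
    have hx1 : ∀ i < max M (N - M'), x.1.coeff i = f.coeff i := hx.1
    have hx2 : ∀ i < N - M, x.2.coeff i = g.coeff i := hx.2
    -- Near f the first factor still vanishes below M, so both error terms vanish below N.
    have e : x.1 * x.2 = f * g + (x.1 * (x.2 - g) + (x.1 - f) * g) := by noncomm_ring
    change (x.1 * x.2).coeff i = (f * g).coeff i
    rw [e, coeff_add, coeff_add,
      coeff_mul_of_lt (f := x.1) (M := M) (N := N - M)
        (fun j hj => (hx1 j (lt_max_of_lt_left hj)).trans (hM j hj))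
        (fun j hj => (coeff_sub _ _ _).trans (sub_eq_zero.2 (hx2 j hj))) i (by omega),
      coeff_mul_of_lt (M := N - M') (N := M')
        (fun j hj => (coeff_sub _ _ _).trans (sub_eq_zero.2 (hx1 j (lt_max_of_lt_right hj)))) hM'
        i (by omega), add_zero, add_zero]

instance : T2Space (TwistedLaurent K θ) := by
  refine t2Space_iff_disjoint_nhds.2 fun f g h => ?_
  obtain ⟨i, hi⟩ : ∃ i, f.coeff i ≠ g.coeff i := by
    by_contra! hne
    exact h (TwistedLaurent.ext (funext hne))
  refine ((nhds_hasBasis f).disjoint_iff (nhds_hasBasis g)).2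
    ⟨i + 1, trivial, i + 1, trivial, Set.disjoint_left.2 fun x hx hx' => hi ?_⟩
  rw [← hx i (by omega), hx' i (by omega)]

noncomputable instance : UniformSpace (TwistedLaurent K θ) :=
  IsTopologicalAddGroup.rightUniformSpace _

instance : IsUniformAddGroup (TwistedLaurent K θ) := isUniformAddGroup_of_addCommGroup

instance : CompleteSpace (TwistedLaurent K θ) where
  complete {l} hl := by
    have hne := hl.1
    have hc : ∀ N : ℤ, ∃ c : TwistedLaurent K θ, ∀ᶠ g in l, ∀ i < N, g.coeff i = c.coeff i := by
      intro N
      have hU : {p : TwistedLaurent K θ × TwistedLaurent K θ |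
          ∀ i < N, p.2.coeff i = p.1.coeff i} ∈ uniformity (TwistedLaurent K θ) := by
        rw [uniformity_eq_comap_nhds_zero]
        refine ⟨_, (nhds_hasBasis 0).mem_of_mem (i := N) trivial, fun p hp i hi => ?_⟩
        have := hp i hi
        rwa [coeff_sub, coeff_zero, sub_eq_zero] at this
      obtain ⟨t, ht, htU⟩ := cauchy_iff.1 hl |>.2 _ hU
      obtain ⟨c, hc⟩ := hne.nonempty_of_mem ht
      exact ⟨c, mem_of_superset ht fun g hg => htU (Set.mk_mem_prod hc hg)⟩
    choose c hc using hc
    have hcc : ∀ N M i, i < N → i < M → (c N).coeff i = (c M).coeff i := by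
      intro N M i hN hM
      obtain ⟨g, hg⟩ := ((hc N).and (hc M)).exists
      rw [← hg.1 i hN, hg.2 i hM]
    -- Degree i is read off at precision i + 1, the first that controls it. In negative degrees the
    -- result agrees with the single series `c 0`, which bounds it below.
    refine ⟨⟨fun i => (c (i + 1)).coeff i, ?_⟩, (nhds_hasBasis _).ge_iff.2 fun N _ => ?_⟩
    · obtain ⟨B, hB⟩ := (c 0).bdd
      exact ⟨min B 0, fun i hi => by rw [hcc _ 0 i (by omega) (by omega), hB i (by omega)]⟩
    · filter_upwards [hc N] with g hg i hi
      rw [hg i hi]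
      exact hcc _ _ _ hi (by omega)

/-- The series with coefficients in a set form a closed set. -/
theorem isClosed_coeffsIn (s : Set K) : IsClosed {f : TwistedLaurent K θ | f.CoeffsIn s} := by
  refine isClosed_iff_nhds.2 fun f hf i => ?_
  obtain ⟨g, hg, hgs⟩ := hf _ ((nhds_hasBasis f).mem_of_mem (i := i + 1) trivial)
  rw [← hg i (by omega)]
  exact hgs i

/-- Applying an automorphism of the field that commutes with `θ` to the coefficients. -/
noncomputable def map (σ : K ≃+* K) (hσ : Commute σ θ) :
    TwistedLaurent K θ ≃+* TwistedLaurent K θ where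
  toFun f := ⟨fun i => σ (f.coeff i), by
    obtain ⟨N, hN⟩ := f.bdd
    exact ⟨N, fun i hi => by rw [hN i hi, map_zero]⟩⟩
  invFun f := ⟨fun i => σ.symm (f.coeff i), by
    obtain ⟨N, hN⟩ := f.bdd
    exact ⟨N, fun i hi => by rw [hN i hi, map_zero]⟩⟩
  left_inv f := by ext; simp
  right_inv f := by ext; simp
  map_add' f g := by ext; simp
  map_mul' f g := by
    ext m
    obtain ⟨M, hM⟩ := f.bdd
    obtain ⟨N, hN⟩ := g.bdd
    rw [coeff_mul_eq_sum (f := ⟨fun i => σ (f.coeff i), _⟩) (g := ⟨fun i => σ (g.coeff i), _⟩)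
      (M := M) (N := N) (fun i hi => by simp [hM i hi]) (fun i hi => by simp [hN i hi]) m _
      subset_rfl]
    simp only [coeff_mul_eq_sum f g hM hN m _ subset_rfl, map_sum, map_mul]
    refine Finset.sum_congr rfl fun i _ => ?_
    rw [← RingAut.mul_apply, ← RingAut.mul_apply, (hσ.zpow_right (-i)).eq]

open Classical in
/-- The part of a series that is supported on the multiples of `d`. -/
noncomputable def proj (d : ℤ) (f : TwistedLaurent K θ) : TwistedLaurent K θ where
  coeff i := if d ∣ i then f.coeff i else 0
  bdd := by
    obtain ⟨N, hN⟩ := f.bdd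
    exact ⟨N, fun i hi => by rw [hN i hi, ite_self]⟩

theorem coeff_proj_of_dvd {d i : ℤ} (h : d ∣ i) (f : TwistedLaurent K θ) :
    (proj d f).coeff i = f.coeff i := if_pos h

theorem coeff_proj_of_not_dvd {d i : ℤ} (h : ¬ d ∣ i) (f : TwistedLaurent K θ) :
    (proj d f).coeff i = 0 := if_neg h

/-- Series are graded by the degree modulo d, and a factor supported in class 0 preserves the
grading. -/
theorem proj_mul_of_left {d : ℤ} {f : TwistedLaurent K θ} (hf : ∀ i, ¬ d ∣ i → f.coeff i = 0)
    (g : TwistedLaurent K θ) : proj d (f * g) = f * proj d g := by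
  ext m
  by_cases hm : d ∣ m
  · rw [coeff_proj_of_dvd hm, coeff_mul, coeff_mul]
    refine finsum_congr fun i => ?_
    by_cases hi : d ∣ i
    · rw [coeff_proj_of_dvd (dvd_sub hm hi)]
    · rw [hf i hi, zero_mul, zero_mul]
  · rw [coeff_proj_of_not_dvd hm, coeff_mul]
    refine (finsum_eq_zero_of_forall_eq_zero fun i => ?_).symm
    by_cases hi : d ∣ i
    · rw [coeff_proj_of_not_dvd (fun h => hm ((dvd_sub_left hi).1 h)), map_zero, mul_zero]
    · rw [hf i hi, zero_mul]

theorem proj_mul_monomial {d j : ℤ} (hj : d ∣ j) (f : TwistedLaurent K θ) (a : K) :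
    proj d (f * monomial θ j a) = proj d f * monomial θ j a := by
  ext m
  rw [coeff_mul_monomial]
  by_cases hm : d ∣ m
  · rw [coeff_proj_of_dvd hm, coeff_proj_of_dvd (dvd_sub hm hj), coeff_mul_monomial]
  · rw [coeff_proj_of_not_dvd hm, coeff_proj_of_not_dvd (fun h => hm ((dvd_sub_left hj).1 h)),
      zero_mul]

end TwistedLaurent

/-! ### Powers of the Frobenius, their fixed fields, and trinomials a X^(q^r) − b X + c -/

section Frobenius

set_option linter.unusedSectionVars false

variable {k K : Type*} [Field k] [Fintype k] [Field K] [Algebra k K] [IsAlgClosed K]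

theorem frob_pow_apply (n : ℕ) (x : K) : (frob k K ^ n) x = x ^ Fintype.card k ^ n := by
  induction n generalizing x with
  | zero => simp
  | succ n ih =>
    rw [pow_succ, RingAut.mul_apply, ih]
    change (x ^ Fintype.card k) ^ _ = _
    rw [← pow_mul, ← pow_succ']

theorem frob_zpow_natCast_apply (n : ℕ) (x : K) :
    (frob k K ^ (n : ℤ)) x = x ^ Fintype.card k ^ n := by
  rw [zpow_natCast, frob_pow_apply]

theorem frob_zpow_apply_zpow_apply (i j : ℤ) (x : K) :
    (frob k K ^ i) ((frob k K ^ j) x) = (frob k K ^ (i + j)) x := by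
  rw [zpow_add, RingAut.mul_apply]

theorem one_lt_card_pow {r : ℕ} (hr : 0 < r) : 1 < Fintype.card k ^ r :=
  Nat.one_lt_pow hr.ne' Fintype.one_lt_card

theorem cast_card_pow_eq_zero {r : ℕ} (hr : 0 < r) : ((Fintype.card k ^ r : ℕ) : K) = 0 := by
  have : ((Fintype.card k : ℕ) : K) = 0 := by
    rw [← map_natCast (algebraMap k K), FiniteField.cast_card_eq_zero, map_zero]
  rw [Nat.cast_pow, this, zero_pow hr.ne']

/-- An automorphism of `K` commutes with the Frobenius. -/
theorem commute_frob (σ : K ≃+* K) : Commute σ (frob k K) := by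
  ext x
  exact map_pow σ x _

variable (k K) in
/-- The subfield of `K` fixed by the `r`-th power of the Frobenius. -/
noncomputable def frobFixed (r : ℕ) : Subfield K :=
  ((frob k K ^ r : K ≃+* K) : K →+* K).eqLocusField (RingHom.id K)

theorem mem_frobFixed {r : ℕ} {x : K} : x ∈ frobFixed k K r ↔ x ^ Fintype.card k ^ r = x := by
  rw [← frob_pow_apply]
  rfl

theorem frob_zpow_of_mem_frobFixed {r : ℕ} {x : K} (hx : x ∈ frobFixed k K r) {i : ℤ}
    (hi : (r : ℤ) ∣ i) : (frob k K ^ i) x = x := by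
  have h1 : (frob k K ^ r) x = x := hx
  have hs : frob k K ^ r ∈ MulAction.stabilizer (K ≃+* K) x := h1
  obtain ⟨j, rfl⟩ := hi
  rw [zpow_mul, zpow_natCast]
  exact zpow_mem hs j

-- X^(q^r) − X has derivative −1, so it is separable and has q^r distinct roots in K.
open Polynomial in
theorem natCard_frobFixed {r : ℕ} (hr : 0 < r) :
    Nat.card (frobFixed k K r) = Fintype.card k ^ r := by
  have hq := one_lt_card_pow (k := k) hr
  have hsep : (X ^ Fintype.card k ^ r - X : K[X]).Separable := by
    rw [separable_def, derivative_sub, derivative_X, derivative_X_pow, cast_card_pow_eq_zero hr,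
      C_0, zero_mul, zero_sub]
    exact isCoprime_one_right.neg_right
  have hne := FiniteField.X_pow_card_sub_X_ne_zero K hq
  rw [← FiniteField.X_pow_card_sub_X_natDegree_eq K hq,
    ← card_rootSet_eq_natDegree (K := K) hsep (IsAlgClosed.splits _), ← Nat.card_eq_fintype_card]
  refine Nat.card_congr (Equiv.subtypeEquivRight fun x => ?_)
  rw [mem_frobFixed, mem_rootSet_of_ne hne]
  simp [sub_eq_zero]

theorem finite_frobFixed {r : ℕ} (hr : 0 < r) : Finite (frobFixed k K r) :=
  Nat.finite_of_card_ne_zero (by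
    rw [natCard_frobFixed hr]; exact (zero_lt_one.trans (one_lt_card_pow hr)).ne')

theorem frobFixed_le_of_dvd {d m : ℕ} (h : d ∣ m) : frobFixed k K d ≤ frobFixed k K m := by
  intro x hx
  have := frob_zpow_of_mem_frobFixed hx (Int.natCast_dvd_natCast.2 h)
  rw [zpow_natCast] at this
  exact this

/-- A power of the Frobenius is trivial on the field with `q ^ d` elements only if the exponent
is a multiple of `d`. -/
theorem dvd_of_frob_zpow_eq {d : ℕ} (hd : 0 < d) {i : ℤ}
    (h : ∀ x ∈ frobFixed k K d, (frob k K ^ i) x = x) : (d : ℤ) ∣ i := by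
  obtain ⟨r, hr⟩ : ∃ r : ℕ, i % d = r := ⟨(i % d).toNat, by
    have := Int.emod_nonneg i (show (d : ℤ) ≠ 0 by omega)
    omega⟩
  have hrd : r < d := by
    have := Int.emod_lt_of_pos i (show (0 : ℤ) < d by omega)
    omega
  rcases Nat.eq_zero_or_pos r with rfl | hr0
  · exact Int.dvd_of_emod_eq_zero (by simpa using hr)
  -- The remainder r of i modulo d acts on the field with q^d elements as i does, hence trivially.
  -- For 0 < r < d this would embed that field into one with q^r elements.
  have hle : frobFixed k K d ≤ frobFixed k K r := by
    intro x hx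
    have h1 := h x hx
    rw [← Int.mul_ediv_add_emod i d, hr, add_comm, zpow_add, RingAut.mul_apply,
      frob_zpow_of_mem_frobFixed hx (dvd_mul_right _ _), zpow_natCast] at h1
    exact h1
  have := finite_frobFixed (k := k) (K := K) hr0
  have hc := Nat.card_le_card_of_injective _ (Set.inclusion_injective hle)
  change Nat.card (frobFixed k K d) ≤ Nat.card (frobFixed k K r) at hc
  rw [natCard_frobFixed hd, natCard_frobFixed hr0] at hc
  exact absurd ((Nat.pow_le_pow_iff_right Fintype.one_lt_card).1 hc) (by omega)

theorem frobFixed_le_algebraicClosure {r : ℕ} (hr : 0 < r) {x : K} (hx : x ∈ frobFixed k K r) :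
    x ∈ algebraicClosure k K := by
  rw [mem_algebraicClosure_iff]
  refine ⟨(Polynomial.X ^ Fintype.card k ^ r - Polynomial.X : Polynomial k),
    FiniteField.X_pow_card_sub_X_ne_zero k (one_lt_card_pow (k := k) hr), ?_⟩
  simpa [sub_eq_zero] using mem_frobFixed.1 hx

/-- A subfield that is closed under taking `q`-th roots is stable under the powers of the
Frobenius. -/
theorem frob_zpow_mem {S : Type*} [SetLike S K] [SubmonoidClass S K] {E : S}
    (hE : ∀ x : K, x ^ Fintype.card k ∈ E → x ∈ E) (i : ℤ) {x : K} (hx : x ∈ E) :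
    (frob k K ^ i) x ∈ E := by
  obtain ⟨n, rfl | rfl⟩ := i.eq_nat_or_neg
  · rw [frob_zpow_natCast_apply]
    exact pow_mem hx _
  · have key : ∀ (n : ℕ) (y : K), y ^ Fintype.card k ^ n ∈ E → y ∈ E := by
      intro n
      induction n with
      | zero => intro y hy; simpa using hy
      | succ n ih => intro y hy; exact hE _ (ih _ (by rwa [← pow_mul, ← pow_succ']))
    refine key n _ ?_
    rwa [← frob_zpow_natCast_apply, frob_zpow_apply_zpow_apply, add_neg_cancel, zpow_zero]

theorem frob_zpow_mem_algebraicClosure (i : ℤ) {x : K} (hx : x ∈ algebraicClosure k K) :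
    (frob k K ^ i) x ∈ algebraicClosure k K :=
  frob_zpow_mem (fun y hy => by
    rw [mem_algebraicClosure_iff] at hy ⊢
    exact hy.of_pow Fintype.card_pos) i hx

theorem frob_zpow_mem_perfectClosure {L : Type*} [Field L] [Algebra L K] [Algebra k L] (i : ℤ)
    {x : K} (hx : x ∈ perfectClosure L K) : (frob k K ^ i) x ∈ perfectClosure L K :=
  frob_zpow_mem (fun y hy => by
    obtain ⟨p, hp, n, hprime, hcard⟩ := FiniteField.card' k
    have : CharP L p := charP_of_injective_algebraMap (algebraMap k L).injective p
    have : Fact p.Prime := ⟨hprime⟩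
    rw [mem_perfectClosure_iff_pow_mem p] at hy ⊢
    obtain ⟨m, hm⟩ := hy
    exact ⟨n + m, by rwa [hcard, ← pow_mul, ← pow_add] at hm⟩) i hx

open Polynomial

/-- The trinomial `a X ^ (q ^ r) - b X + c`. -/
noncomputable def frobTrinomial (k : Type*) [Fintype k] {R : Type*} [CommRing R] (r : ℕ)
    (a b c : R) : R[X] :=
  C a * X ^ Fintype.card k ^ r - C b * X + C c

theorem natDegree_frobTrinomial {R : Type*} [Field R] {r : ℕ} (hr : 0 < r) {a : R} (ha : a ≠ 0)
    (b c : R) : (frobTrinomial k r a b c).natDegree = Fintype.card k ^ r := by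
  have hq := one_lt_card_pow (k := k) hr
  have h1 : (C a * X ^ Fintype.card k ^ r : R[X]).natDegree = Fintype.card k ^ r :=
    natDegree_C_mul_X_pow _ _ ha
  have h2 : (-(C b * X) + C c : R[X]).natDegree ≤ 1 := by
    rw [← neg_mul, ← C_neg]
    exact natDegree_linear_le
  rw [frobTrinomial, sub_eq_add_neg, add_assoc, natDegree_add_eq_left_of_natDegree_lt, h1]
  omega

theorem exists_frobTrinomial_root {r : ℕ} (hr : 0 < r) {a : K} (ha : a ≠ 0) (b c : K) :
    ∃ x, a * x ^ Fintype.card k ^ r - x * b = c := by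
  have hd : (frobTrinomial k r a b (-c)).degree ≠ 0 := by
    intro h
    have := natDegree_frobTrinomial (k := k) hr ha b (-c)
    rw [natDegree_eq_zero_iff_degree_le_zero.2 h.le] at this
    have := one_lt_card_pow (k := k) hr
    omega
  obtain ⟨x, hx⟩ := IsAlgClosed.exists_root _ hd
  refine ⟨x, ?_⟩
  simp only [frobTrinomial, IsRoot.def, eval_add, eval_sub, eval_mul, eval_C, eval_pow,
    eval_X] at hx
  linear_combination hx

/-- Any (q^r − 1)-th root of a⁻¹ will do; it supplies the nonzero leading coefficient of an
intertwining series. -/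
theorem exists_mul_frob_pow_eq_self {r : ℕ} (hr : 0 < r) {a : K} (ha : a ≠ 0) :
    ∃ x ≠ 0, a * x ^ Fintype.card k ^ r = x := by
  have hq := one_lt_card_pow (k := k) hr
  obtain ⟨x, hx⟩ := IsAlgClosed.exists_pow_nat_eq a⁻¹ (show 0 < Fintype.card k ^ r - 1 by omega)
  refine ⟨x, ?_, ?_⟩
  · rintro rfl
    rw [zero_pow (by omega)] at hx
    exact inv_ne_zero ha hx.symm
  · obtain ⟨n, hn⟩ : ∃ n, Fintype.card k ^ r = n + 1 := ⟨_, (Nat.sub_add_cancel hq.le).symm⟩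
    rw [hn, Nat.add_sub_cancel] at hx
    rw [hn, pow_succ, hx, ← mul_assoc, mul_inv_cancel₀ ha, one_mul]

theorem mem_algebraicClosure_of_frobTrinomial {r : ℕ} (hr : 0 < r) {a b x : K} (ha : a ≠ 0)
    (ha' : a ∈ algebraicClosure k K) (hb : b ∈ algebraicClosure k K)
    (hx : a * x ^ Fintype.card k ^ r - x * b ∈ algebraicClosure k K) :
    x ∈ algebraicClosure k K := by
  set E := algebraicClosure k K
  have halg : IsAlgebraic E x := by
    refine ⟨frobTrinomial k r (⟨a, ha'⟩ : E) ⟨b, hb⟩ (-⟨_, hx⟩), ?_, ?_⟩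
    · have ha0 : (⟨a, ha'⟩ : E) ≠ 0 := fun h => ha (congrArg Subtype.val h)
      intro h
      have h1 := natDegree_frobTrinomial (k := k) hr ha0 ⟨b, hb⟩ (-⟨_, hx⟩)
      rw [h, natDegree_zero] at h1
      have := one_lt_card_pow (k := k) hr
      omega
    · simp [frobTrinomial, IntermediateField.algebraMap_apply]
      ring
  have h2 := isIntegral_trans (R := k) (A := E) x halg.isIntegral
  exact mem_algebraicClosure_iff'.2 h2

variable {L : Type*} [Field L] [Algebra k L] [Algebra L K] [IsScalarTower k L K]

theorem algebraicClosure_le_separableClosure {x : K} (hx : x ∈ algebraicClosure k K) :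
    x ∈ separableClosure L K := by
  rw [mem_algebraicClosure_iff'] at hx
  exact mem_separableClosure_iff.2 (IsSeparable.tower_top L
    (PerfectField.separable_of_irreducible (minpoly.irreducible hx)))

/-- The trinomial over L^sep with root x has derivative the nonzero constant −b, so it is separable.
No condition on a is needed. -/
theorem mem_separableClosure_of_frobTrinomial {r : ℕ} (hr : 0 < r) {a b x : K} (hb0 : b ≠ 0)
    (ha' : a ∈ separableClosure L K) (hb : b ∈ separableClosure L K)
    (hx : a * x ^ Fintype.card k ^ r - x * b ∈ separableClosure L K) :
    x ∈ separableClosure L K := by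
  set E := separableClosure L K
  have hsep : (frobTrinomial k r (⟨a, ha'⟩ : E) ⟨b, hb⟩ (-⟨_, hx⟩)).Separable := by
    have hb0' : (⟨b, hb⟩ : E) ≠ 0 := fun h => hb0 (congrArg Subtype.val h)
    have hz : ((Fintype.card k ^ r : ℕ) : E) = 0 := (algebraMap E K).injective (by
      rw [map_natCast, cast_card_pow_eq_zero hr, map_zero])
    obtain ⟨v, hv⟩ := (isUnit_C.2 hb0'.isUnit).neg.exists_left_inv
    rw [separable_def, frobTrinomial, derivative_add, derivative_C, derivative_sub,
      derivative_C_mul_X_pow, derivative_C_mul, derivative_X, hz, mul_zero, C_0, zero_mul,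
      zero_sub, mul_one, add_zero]
    exact ⟨0, v, by rw [zero_mul, zero_add, hv]⟩
  have : IsSeparable E x := hsep.of_dvd (minpoly.dvd _ _ (by
    simp [frobTrinomial, IntermediateField.algebraMap_apply]
    ring))
  exact mem_separableClosure_iff.2 (IsSeparable.of_algebra_isSeparable_of_isSeparable L this)

end Frobenius

/-! ### The ring A, its fraction field, and valuations given by orders -/

section FunctionField

open Polynomial

/-- F has transcendence degree one over k, so any transcendental t is a transcendence basis by
itself. -/
theorem isAlgebraic_adjoin_of_transcendental {k F : Type*} [Field k] [Field F] [Algebra k F]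
    [Algebra k⟮X⟯ F] [IsScalarTower k k⟮X⟯ F] [FunctionField k F] {t : F}
    (ht : Transcendental k t) : Algebra.IsAlgebraic (Algebra.adjoin k {t}) F := by
  have : Algebra.IsAlgebraic k[X] k⟮X⟯ := IsLocalization.isAlgebraic k⟮X⟯ (nonZeroDivisors k[X])
  have h1 := (IsTranscendenceBasis.polynomial Unit k).algebraMap_comp (A := k⟮X⟯)
  have h2 := h1.algebraMap_comp (A := F)
  have h3 := h2.lift_cardinalMk_eq_trdeg
  have h4 : AlgebraicIndependent k (fun _ : Unit => t) := by
    rw [algebraicIndependent_unique_type_iff]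
    exact ht
  have h5 := h4.isTranscendenceBasis_of_lift_trdeg_le_of_finite h3.ge
  have := h5.isAlgebraic
  rwa [Set.range_const] at this

/-- Every element of the function field is algebraic over `k[t]`. -/
theorem isAlgebraic_polynomial_of_transcendental {k F : Type*} [Field k] [Field F] [Algebra k F]
    [Algebra k⟮X⟯ F] [IsScalarTower k k⟮X⟯ F] [FunctionField k F] {t : F}
    (ht : Transcendental k t) (x : F) :
    letI := (aeval (R := k) t).toRingHom.toAlgebra
    IsAlgebraic k[X] x := by
  let := (aeval (R := k) t).toRingHom.toAlgebra
  have := isAlgebraic_adjoin_of_transcendental ht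
  have hx : IsAlgebraic (Algebra.adjoin k {t}) x := Algebra.IsAlgebraic.isAlgebraic x
  let f : k[X] →+* Algebra.adjoin k {t} := (aeval (⟨t, Algebra.subset_adjoin rfl⟩ :
    Algebra.adjoin k {t})).toRingHom
  have hcomp : (algebraMap (Algebra.adjoin k {t}) F).comp f =
      (RingHom.id F).comp (algebraMap k[X] F) := by
    ext p
    · simp [f, RingHom.algebraMap_toAlgebra]
    · simp [f, RingHom.algebraMap_toAlgebra]
  refine IsAlgebraic.of_ringHom_of_comp_eq (S := Algebra.adjoin k {t}) f (RingHom.id F) hx ?_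
    Function.injective_id hcomp
  rintro ⟨y, hy⟩
  rw [Algebra.adjoin_singleton_eq_range_aeval] at hy
  obtain ⟨p, rfl⟩ := hy
  refine ⟨p, Subtype.ext ?_⟩
  have := RingHom.congr_fun hcomp p
  exact this

/-- An injective homomorphism from a domain to a (noncommutative) ring that maps nonzero elements
to units extends to the fraction field. -/
theorem exists_extension_fractionField {A F S : Type*} [CommRing A] [Field F] [Algebra A F]
    [IsFractionRing A F] [Ring S] (f : A →+* S) (hf : ∀ a ≠ 0, IsUnit (f a)) :
    ∃ g : F →+* S, ∀ a, g (algebraMap A F a) = f a := by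
  have : IsDomain A := (IsFractionRing.injective A F).isDomain _
  -- S is not commutative, so the localization is carried out in the double centralizer of the
  -- image. It is commutative because the image is, and it contains the inverses of the images of
  -- nonzero elements.
  let C := Subring.centralizer (Subring.centralizer (Set.range f) : Set S)
  have hle : ∀ x ∈ C, x ∈ Subring.centralizer (Set.range f) := by
    refine fun x hx => Subring.mem_centralizer_iff.2 ?_
    rintro _ ⟨a, rfl⟩
    refine Subring.mem_centralizer_iff.1 hx _ (Subring.mem_centralizer_iff.2 ?_)
    rintro _ ⟨b, rfl⟩
    rw [← map_mul, ← map_mul, mul_comm]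
  let : CommRing C := { C.toRing with
    mul_comm := fun x y => Subtype.ext (Subring.mem_centralizer_iff.1 y.2 _ (hle x x.2)) }
  have hfC : ∀ a, f a ∈ C := fun a => Subring.mem_centralizer_iff.2 fun y hy =>
    (Subring.mem_centralizer_iff.1 hy _ ⟨a, rfl⟩).symm
  let fC : A →+* C :=
    { toFun := fun a => ⟨f a, hfC a⟩
      map_one' := Subtype.ext (map_one f)
      map_zero' := Subtype.ext (map_zero f)
      map_mul' := fun a b => Subtype.ext (map_mul f a b)
      map_add' := fun a b => Subtype.ext (map_add f a b) }
  have hu : ∀ y : nonZeroDivisors A, IsUnit (fC y) := by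
    intro y
    obtain ⟨u, hu⟩ := hf y (nonZeroDivisors.coe_ne_zero y)
    have hmem : (↑u⁻¹ : S) ∈ C := Subring.mem_centralizer_iff.2 fun z hz => by
      have h1 : Commute z u := by rw [hu]; exact Subring.mem_centralizer_iff.1 (hfC y) z hz
      exact h1.units_inv_right
    refine IsUnit.of_mul_eq_one ⟨(↑u⁻¹ : S), hmem⟩ (Subtype.ext ?_)
    change f y * ↑u⁻¹ = 1
    rw [← hu, u.mul_inv]
  let g : F →+* C := IsLocalization.lift (M := nonZeroDivisors A) hu
  refine ⟨{ toFun := fun x => (g x : S)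
            map_one' := congrArg Subtype.val (map_one g)
            map_zero' := congrArg Subtype.val (map_zero g)
            map_mul' := fun x y => congrArg Subtype.val (map_mul g x y)
            map_add' := fun x y => congrArg Subtype.val (map_add g x y) }, fun a => ?_⟩
  exact congrArg Subtype.val (IsLocalization.lift_eq hu a)

/-- The valuation with prescribed orders of the nonzero elements. -/
noncomputable def valuationOfOrd {R : Type*} [Field R] (j : R → ℤ)
    (hmul : ∀ x y, x ≠ 0 → y ≠ 0 → j (x * y) = j x + j y)
    (hadd : ∀ x y, x ≠ 0 → y ≠ 0 → x + y ≠ 0 → min (j x) (j y) ≤ j (x + y)) :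
    Valuation R ℤᵐ⁰ := by
  classical
  exact
  { toFun := fun x => if x = 0 then 0 else WithZero.exp (-j x)
    map_zero' := if_pos rfl
    map_one' := by
      have := hmul 1 1 one_ne_zero one_ne_zero
      rw [mul_one] at this
      rw [if_neg one_ne_zero, show j 1 = 0 by omega, neg_zero, WithZero.exp_zero]
    map_mul' := fun x y => by
      by_cases hx : x = 0
      · simp [hx]
      by_cases hy : y = 0
      · simp [hy]
      rw [if_neg hx, if_neg hy, if_neg (mul_ne_zero hx hy), hmul x y hx hy, neg_add,
        WithZero.exp_add]
    map_add_le_max' := fun x y => by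
      by_cases hx : x = 0
      · simp [hx]
      by_cases hy : y = 0
      · simp [hy]
      by_cases hxy : x + y = 0
      · simp [hxy]
      rw [if_neg hx, if_neg hy, if_neg hxy, le_max_iff, WithZero.exp_le_exp, WithZero.exp_le_exp]
      have := hadd x y hx hy hxy
      omega }

theorem valuationOfOrd_apply {R : Type*} [Field R] (j : R → ℤ)
    (hmul : ∀ x y, x ≠ 0 → y ≠ 0 → j (x * y) = j x + j y)
    (hadd : ∀ x y, x ≠ 0 → y ≠ 0 → x + y ≠ 0 → min (j x) (j y) ≤ j (x + y)) {x : R} (hx : x ≠ 0) :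
    valuationOfOrd j hmul hadd x = WithZero.exp (-j x) :=
  if_neg hx

theorem valuation_eq_exp_neg_addOrd {R : Type*} [Field R] (v : Valuation R ℤᵐ⁰) {x : R}
    (hx : x ≠ 0) : v x = WithZero.exp (-addOrd v x) := by
  rw [addOrd, neg_neg, WithZero.exp_log (v.ne_zero_iff.2 hx)]

/-- Finite fields are contained in every valuation ring. -/
theorem valuation_algebraMap_le_one {k F : Type*} [Field k] [Finite k] [Field F] [Algebra k F]
    (v : Valuation F ℤᵐ⁰) (c : k) : v (algebraMap k F c) ≤ 1 :=
  (toValuationRing (algebraMap k F) v c).2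

namespace Place

variable {k F : Type*} [Field k] [Finite k] [Field F] [Algebra k F] (v : Place F)

theorem mem_regularAway {x : F} : x ∈ v.regularAway ↔ ∀ w : Place F, w ≠ v → w.val x ≤ 1 := by
  simp only [regularAway, Subring.mem_iInf]
  rfl

theorem algebraMap_mem_regularAway (c : k) : algebraMap k F c ∈ v.regularAway :=
  v.mem_regularAway.2 fun w _ => valuation_algebraMap_le_one w.val c

noncomputable instance : Algebra k v.regularAway :=
  ((algebraMap k F).codRestrict v.regularAway v.algebraMap_mem_regularAway).toAlgebra

instance : IsScalarTower k v.regularAway F := IsScalarTower.of_algebraMap_eq fun _ => rfl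

/-- Each valuation ring is integrally closed, so integral elements cannot acquire poles. -/
theorem mem_regularAway_of_isIntegral {R : Type*} [CommRing R] [Algebra R F]
    (hR : ∀ r : R, algebraMap R F r ∈ v.regularAway) {x : F} (hx : IsIntegral R x) :
    x ∈ v.regularAway := by
  refine v.mem_regularAway.2 fun w hw => ?_
  obtain ⟨p, hp, hpx⟩ := hx
  let g : R →+* w.val.integer := (algebraMap R F).codRestrict w.val.integer
    fun r => v.mem_regularAway.1 (hR r) w hw
  have : IsIntegral w.val.integer x := ⟨p.map g, hp.map g, by rw [eval₂_map]; exact hpx⟩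
  exact (Valuation.integer.integers w.val).mem_of_integral this

variable [Algebra k⟮X⟯ F] [IsScalarTower k k⟮X⟯ F] [FunctionField k F]

-- Every x in F is algebraic over k[t], so y x is integral over k[t] for some nonzero y in k[t].
-- Then y x and y lie in A.
include k in
theorem isFractionRing_regularAway {t : v.regularAway} (ht : Transcendental k (t : F)) :
    IsFractionRing v.regularAway F := by
  let := (aeval (R := k) (t : F)).toRingHom.toAlgebra
  have hmem : ∀ r : k[X], algebraMap k[X] F r ∈ v.regularAway := by
    intro r
    have : algebraMap k[X] F r = ((aeval t r : v.regularAway) : F) :=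
      aeval_algebraMap_apply F t r
    rw [this]
    exact (aeval t r : v.regularAway).2
  refine IsFractionRing.of_field _ _ fun x => ?_
  obtain ⟨y, hy, hint⟩ := (isAlgebraic_polynomial_of_transcendental ht x).exists_integral_multiple
  refine ⟨⟨_, v.mem_regularAway_of_isIntegral hmem hint⟩, ⟨_, hmem y⟩, ?_⟩
  have hne : algebraMap k[X] F y ≠ 0 := fun h => hy (transcendental_iff_injective.1 ht
    (h.trans (map_zero _).symm))
  change x = (y • x) / algebraMap k[X] F y
  rw [Algebra.smul_def, mul_div_cancel_left₀ _ hne]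

end Place

end FunctionField

/-! ### The valuation of a field induced by an embedding into twisted Laurent series -/

open Polynomial in
/-- The order of a polynomial expression in a series of negative order. -/
theorem TwistedLaurent.isOrd_eval₂ {K : Type*} [Field K] {θ : K ≃+* K} {k : Type*} [Field k]
    (f : k →+* TwistedLaurent K θ) (hf : ∀ c ≠ 0, (f c).IsOrd 0) {x : TwistedLaurent K θ} {N : ℤ}
    (hN : N < 0) (hx : x.IsOrd N) {p : k[X]} (hp : p ≠ 0) :
    (p.eval₂ f x).IsOrd (p.natDegree * N) := by
  have hterm : ∀ i, p.coeff i ≠ 0 → (f (p.coeff i) * x ^ i).IsOrd (i * N) := fun i hi => by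
    have := (hf _ hi).mul (hx.pow i)
    rwa [zero_add] at this
  -- As N < 0, the nonzero terms have pairwise different orders and the top term has the smallest.
  have hlow : ∀ i < p.natDegree, ∀ j ≤ p.natDegree * N, (f (p.coeff i) * x ^ i).coeff j = 0 := by
    intro i hi j hj
    by_cases h : p.coeff i = 0
    · rw [h, map_zero, zero_mul, coeff_zero]
    · refine (hterm i h).1 j (hj.trans_lt ?_)
      exact mul_lt_mul_of_neg_right (by exact_mod_cast hi) hN
  have htop := hterm p.natDegree (leadingCoeff_ne_zero.2 hp)
  rw [eval₂_eq_sum_range, Finset.sum_range_succ]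
  refine ⟨fun j hj => ?_, ?_⟩
  · rw [coeff_add, coeff_sum, htop.1 j hj, add_zero]
    exact Finset.sum_eq_zero fun i hi => hlow i (Finset.mem_range.1 hi) j hj.le
  · rw [coeff_add, coeff_sum, Finset.sum_eq_zero fun i hi =>
      hlow i (Finset.mem_range.1 hi) _ le_rfl, zero_add]
    exact htop.2

/-- Nonzero elements of a finite field are roots of unity, and orders are additive. -/
theorem TwistedLaurent.isOrd_of_finite {K : Type*} [Field K] {θ : K ≃+* K} {k : Type*} [Field k]
    [Finite k] (f : k →+* TwistedLaurent K θ) {c : k} (hc : c ≠ 0) : (f c).IsOrd 0 := by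
  obtain ⟨n, hn, h⟩ := (isOfFinOrder_of_finite (Units.mk0 c hc)).exists_pow_eq_one
  have h' : c ^ n = 1 := by simpa [Units.ext_iff] using h
  obtain ⟨N, hN⟩ := exists_isOrd ((map_ne_zero_iff f f.injective).2 hc)
  have := (hN.pow n).unique (by rw [← map_pow, h', map_one]; exact isOrd_one)
  obtain rfl : N = 0 := by
    rcases mul_eq_zero.1 this with h | h
    · omega
    · exact h
  exact hN

/-- A ring homomorphism from a field to twisted Laurent series that is not contained in the series
of order zero induces a multiple of a normalized discrete valuation. -/
theorem exists_place_of_ringHom {F K : Type*} [Field F] [Field K] {θ : K ≃+* K}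
    (Φ : F →+* TwistedLaurent K θ) {t : F} (ht : t ≠ 0) {N : ℤ} (hN : N < 0)
    (htN : (Φ t).IsOrd N) :
    ∃ (w : Place F) (m : ℕ), 0 < m ∧ ∀ x ≠ 0, (Φ x).IsOrd (m * addOrd w.val x) := by
  classical
  have hord : ∀ x : F, ∃ j : ℤ, x ≠ 0 → (Φ x).IsOrd j := fun x => by
    by_cases hx : x = 0
    · exact ⟨0, fun h => absurd hx h⟩
    · obtain ⟨j, hj⟩ := TwistedLaurent.exists_isOrd ((map_ne_zero_iff Φ Φ.injective).2 hx)
      exact ⟨j, fun _ => hj⟩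
  choose o ho using hord
  have hmul : ∀ x y, x ≠ 0 → y ≠ 0 → o (x * y) = o x + o y := fun x y hx hy =>
    (ho _ (mul_ne_zero hx hy)).unique (by rw [map_mul]; exact (ho x hx).mul (ho y hy))
  have hone : o 1 = 0 := by
    have := hmul 1 1 one_ne_zero one_ne_zero
    rw [mul_one] at this
    omega
  have hinv : ∀ x, x ≠ 0 → o x⁻¹ = -o x := fun x hx => by
    have := hmul x x⁻¹ hx (inv_ne_zero hx)
    rw [mul_inv_cancel₀ hx, hone] at this
    omega
  have hpow : ∀ (x : F) (n : ℕ), x ≠ 0 → o (x ^ n) = n * o x := fun x n hx =>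
    (ho _ (pow_ne_zero n hx)).unique (by rw [map_pow]; exact (ho x hx).pow n)
  have hzpow : ∀ (x : F) (n : ℤ), x ≠ 0 → o (x ^ n) = n * o x := fun x n hx => by
    obtain ⟨n, rfl | rfl⟩ := n.eq_nat_or_neg
    · rw [zpow_natCast, hpow x n hx]
    · rw [zpow_neg, zpow_natCast, hinv _ (pow_ne_zero n hx), hpow x n hx, neg_mul]
  have hex : ∃ n : ℕ, 0 < n ∧ ∃ x : F, x ≠ 0 ∧ o x = n := by
    refine ⟨(-N).toNat, by omega, t⁻¹, inv_ne_zero ht, ?_⟩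
    rw [hinv t ht, (ho t ht).unique htN]
    omega
  -- The least positive order m, attained at π, divides every order: otherwise a remainder modulo m
  -- would be a smaller positive order. Dividing by m normalizes the valuation.
  obtain ⟨hm, π, hπ0, hπ⟩ := Nat.find_spec hex
  set m := Nat.find hex with hmdef
  have hdvd : ∀ x, x ≠ 0 → (m : ℤ) ∣ o x := by
    intro x hx
    by_contra h
    have hpos : 0 < o x % m := lt_of_le_of_ne (Int.emod_nonneg _ (by omega))
      (fun h' => h (Int.dvd_of_emod_eq_zero h'.symm))
    have hlt : o x % m < m := Int.emod_lt_of_pos _ (by omega)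
    refine Nat.find_min hex (m := (o x % m).toNat) (by omega)
      ⟨by omega, x * π ^ (-(o x / m)), mul_ne_zero hx (zpow_ne_zero _ hπ0), ?_⟩
    rw [hmul _ _ hx (zpow_ne_zero _ hπ0), hzpow _ _ hπ0, hπ, Int.toNat_of_nonneg hpos.le,
      Int.emod_def]
    ring
  have hdiv : ∀ x, x ≠ 0 → m * (o x / m) = o x := fun x hx => Int.mul_ediv_cancel' (hdvd x hx)
  have hmz : (0 : ℤ) < m := by exact_mod_cast hm
  have hjmul : ∀ x y, x ≠ 0 → y ≠ 0 → o (x * y) / m = o x / m + o y / m := fun x y hx hy => by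
    rw [hmul x y hx hy, Int.add_ediv_of_dvd_left (hdvd x hx)]
  have hjadd : ∀ x y, x ≠ 0 → y ≠ 0 → x + y ≠ 0 →
      min (o x / m) (o y / m) ≤ o (x + y) / m := fun x y hx hy hxy => by
    have h : min (o x) (o y) ≤ o (x + y) := by
      by_contra! h
      refine (ho _ hxy).2 ?_
      rw [map_add, TwistedLaurent.coeff_add, (ho x hx).1 _ (h.trans_le (min_le_left _ _)),
        (ho y hy).1 _ (h.trans_le (min_le_right _ _)), add_zero]
    rcases min_le_iff.1 h with h | h
    · exact min_le_of_left_le (Int.ediv_le_ediv hmz h)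
    · exact min_le_of_right_le (Int.ediv_le_ediv hmz h)
  have hval : ∀ x, x ≠ 0 → addOrd (valuationOfOrd (fun x => o x / m) hjmul hjadd) x = o x / m := by
    intro x hx
    rw [addOrd, valuationOfOrd_apply _ _ _ hx, WithZero.log_exp, neg_neg]
  refine ⟨⟨valuationOfOrd (fun x => o x / m) hjmul hjadd, fun y => ?_⟩, m, hm, fun x hx => ?_⟩
  · by_cases hy : y = 0
    · exact ⟨0, by rw [map_zero, hy]⟩
    · refine ⟨π ^ (-WithZero.log y), ?_⟩
      rw [valuationOfOrd_apply _ _ _ (zpow_ne_zero _ hπ0), hzpow _ _ hπ0, hπ,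
        Int.mul_ediv_cancel _ hmz.ne', neg_neg, WithZero.exp_log hy]
  · rw [hval x hx, hdiv x hx]
    exact ho x hx

/-! ### Injectivity of φ and its extension to F -/

namespace DrinfeldModule

set_option linter.unusedSectionVars false

variable {k F : Type*} [Field k] [Fintype k] [Field F] {infty : Place F}
  {L Lbar : Type*} [Field L] [Algebra k L] [Field Lbar] [Algebra L Lbar] [Algebra k Lbar]
  [IsScalarTower k L Lbar] [IsAlgClosed Lbar] (φ : DrinfeldModule k F infty L Lbar)

/-- `a ↦ φ_a` as a homomorphism to twisted Laurent series. -/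
noncomputable def appHom : infty.regularAway →+* Series k Lbar :=
  (twistedPoly k L Lbar).subtype.comp φ.toRingHom

theorem appHom_apply (a : infty.regularAway) : φ.appHom a = φ.app a := rfl

/-- Series are indexed by powers of τ⁻¹, so a nonconstant polynomial in τ has a nonzero coefficient
at a negative index. This element a is the source of all later descent arguments. -/
theorem exists_app_isOrd_neg : ∃ a : infty.regularAway, ∃ r : ℕ, 0 < r ∧
    (φ.app a).IsOrd (-(r : ℤ)) := by
  obtain ⟨a, i, hi, hai⟩ := φ.nonconstant
  have hi' : i < 0 := by
    by_contra h
    exact hai ((φ.toRingHom a).2.2 i (by omega))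
  obtain ⟨N, hN⟩ := TwistedLaurent.exists_isOrd (f := φ.app a) (by
    intro h
    apply hai
    change (φ.app a).coeff i = 0
    rw [h]
    rfl)
  have hNi : N ≤ i := by
    by_contra! h
    exact hai (hN.1 i h)
  refine ⟨a, (-N).toNat, by omega, ?_⟩
  rwa [show (-((-N).toNat : ℤ)) = N by omega]

variable [Algebra k F]

/-- By `isOrd_eval₂` a nonzero polynomial in φ_t has a definite finite order, hence is not zero. -/
theorem transcendental_of_isOrd_neg {t : infty.regularAway} {N : ℤ} (hN : N < 0)
    (ht : (φ.app t).IsOrd N) : Transcendental k (t : F) := by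
  rw [transcendental_iff]
  intro p hp
  by_contra hp0
  have h := TwistedLaurent.isOrd_eval₂ (φ.appHom.comp (algebraMap k infty.regularAway))
    (fun c hc => TwistedLaurent.isOrd_of_finite _ hc) hN ht hp0
  refine h.ne_zero ?_
  rw [← appHom_apply, ← Polynomial.hom_eval₂]
  have : Polynomial.aeval t p = 0 := Subtype.ext ((Polynomial.aeval_algebraMap_apply F t p).symm.trans hp)
  change φ.appHom (Polynomial.aeval t p) = 0
  rw [this, map_zero]

variable [Algebra k⟮X⟯ F] [IsScalarTower k k⟮X⟯ F] [FunctionField k F]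

include φ in
theorem isFractionRing : IsFractionRing infty.regularAway F := by
  obtain ⟨t, r, hr, ht⟩ := φ.exists_app_isOrd_neg
  exact infty.isFractionRing_regularAway (k := k)
    (φ.transcendental_of_isOrd_neg (by omega) ht)

-- Since a is algebraic over k[t], it divides some nonzero p(t), and φ(p(t)) has finite order, so
-- φ_a cannot vanish.
open Polynomial in
theorem app_ne_zero {a : infty.regularAway} (ha : a ≠ 0) : φ.app a ≠ 0 := by
  obtain ⟨t, r, hr, ht⟩ := φ.exists_app_isOrd_neg
  have htr := φ.transcendental_of_isOrd_neg (by omega) ht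
  let i1 := (aeval (R := k) (t : F)).toRingHom.toAlgebra
  let i2 := (aeval (R := k) t).toRingHom.toAlgebra
  have : IsScalarTower k[X] infty.regularAway F :=
    IsScalarTower.of_algebraMap_eq fun p => aeval_algebraMap_apply F t p
  have halg : IsAlgebraic k[X] (a : F) := isAlgebraic_polynomial_of_transcendental htr (a : F)
  have halg' : IsAlgebraic k[X] a :=
    (isAlgebraic_algebraMap_iff (A := F) (Subtype.val_injective)).1 halg
  obtain ⟨p, hp, b, hb⟩ := halg'.exists_nonzero_dvd (mem_nonZeroDivisors_of_ne_zero ha)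
  intro h0
  have h := TwistedLaurent.isOrd_eval₂ (φ.appHom.comp (algebraMap k infty.regularAway))
    (fun c hc => TwistedLaurent.isOrd_of_finite _ hc) (by omega) ht hp
  refine h.ne_zero ?_
  rw [← appHom_apply, ← hom_eval₂]
  change φ.appHom (algebraMap k[X] infty.regularAway p) = 0
  rw [hb, map_mul, appHom_apply, h0, zero_mul]

/-- The extension of `φ` to `F`. -/
theorem exists_extension_functionField : ∃ (Φ : F →+* Series k Lbar) (m : ℕ), 0 < m ∧
    (∀ a : infty.regularAway, Φ a = φ.app a) ∧
    ∀ x ≠ 0, (Φ x).IsOrd (m * addOrd infty.val x) := by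
  have := φ.isFractionRing
  obtain ⟨Φ, hΦ⟩ := exists_extension_fractionField (F := F) φ.appHom
    fun a ha => TwistedLaurent.isUnit_of_ne_zero (φ.app_ne_zero ha)
  obtain ⟨t, r, hr, ht⟩ := φ.exists_app_isOrd_neg
  have ht' : (Φ (t : F)).IsOrd (-(r : ℤ)) := by
    have := hΦ t
    rw [appHom_apply] at this
    exact this ▸ ht
  have ht0 : (t : F) ≠ 0 := by
    intro h
    rw [h, map_zero] at ht'
    exact ht'.ne_zero rfl
  obtain ⟨w, m, hm, hw⟩ := exists_place_of_ringHom Φ ht0 (by omega) ht'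
  suffices h : w = infty from ⟨Φ, m, hm, hΦ, h ▸ hw⟩
  -- If w were not ∞, the element t of A would have nonnegative order at w, whereas its image has
  -- negative order.
  by_contra hne
  have h1 := infty.mem_regularAway.1 t.2 w hne
  rw [valuation_eq_exp_neg_addOrd _ ht0, ← WithZero.exp_zero, WithZero.exp_le_exp] at h1
  have h2 := (hw _ ht0).unique ht'
  have h3 : (0 : ℤ) ≤ m * addOrd w.val (t : F) := by
    have : (0 : ℤ) ≤ m := by omega
    exact mul_nonneg this (by omega)
  omega

end DrinfeldModule

/-! ### Passage to the completion F_∞ -/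

section Completion

open Topology Filter

theorem valued_nhds_hasBasis {K : Type*} [Field K] [hv : Valued K ℤᵐ⁰]
    (hs : Function.Surjective hv.v) (x : K) :
    (𝓝 x).HasBasis (fun _ : ℤ => True) (fun N => {y | hv.v (y - x) < WithZero.exp N}) := by
  refine ⟨fun s => ?_⟩
  rw [Valued.mem_nhds]
  constructor
  · rintro ⟨γ, hγ⟩
    refine ⟨WithZero.log (MonoidWithZeroHom.ValueGroup₀.embedding γ.1), trivial, fun y hy => hγ ?_⟩
    change hv.v (y - x) < _ at hy
    rw [WithZero.exp_log ((map_ne_zero _).2 γ.ne_zero)] at hy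
    exact (Valuation.restrict_lt_iff_lt_embedding _).2 hy
  · rintro ⟨N, -, hN⟩
    obtain ⟨z, hz⟩ := hs (WithZero.exp N)
    have hz0 : hv.v.restrict z ≠ 0 := by
      rw [Ne, Valuation.restrict_eq_zero_iff, hz]
      exact WithZero.exp_ne_zero
    refine ⟨Units.mk0 _ hz0, fun y hy => hN ?_⟩
    change hv.v (y - x) < _
    rw [← hz]
    exact (Valuation.restrict_lt_iff _).1 hy

/-- Completeness in purely valuation-theoretic form: by the ultrametric inequality, bounds on
consecutive differences bound all later ones, and the bounds pass to the limit. -/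
theorem exists_valued_limit {K : Type*} [Field K] [hv : Valued K ℤᵐ⁰] [CompleteSpace K]
    (hs : Function.Surjective hv.v) (s : ℕ → K)
    (h : ∀ i : ℕ, hv.v (s (i + 1) - s i) ≤ WithZero.exp (-(i : ℤ))) :
    ∃ y, ∀ i : ℕ, hv.v (y - s i) ≤ WithZero.exp (-(i : ℤ)) := by
  have hle : ∀ i n, i ≤ n → hv.v (s n - s i) ≤ WithZero.exp (-(i : ℤ)) := by
    intro i n hin
    induction n, hin using Nat.le_induction with
    | base => simp
    | succ n hn ih =>
      rw [← sub_add_sub_cancel _ (s n)]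
      refine (hv.v.map_add _ _).trans (max_le ((h n).trans ?_) ih)
      rw [WithZero.exp_le_exp]
      omega
  have hb := (valued_nhds_hasBasis hs (0 : K)).comap (fun p : K × K => p.2 - p.1)
  rw [← uniformity_eq_comap_nhds_zero] at hb
  have hc : CauchySeq s := hb.cauchySeq_iff.2 fun N _ => by
    refine ⟨(1 - N).toNat, fun i hi j hj => ?_⟩
    change hv.v (s j - s i - 0) < WithZero.exp N
    rw [sub_zero, ← sub_sub_sub_cancel_right _ _ (s (1 - N).toNat)]
    refine (hv.v.map_sub _ _).trans_lt ((max_le (hle _ _ hj) (hle _ _ hi)).trans_lt ?_)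
    rw [WithZero.exp_lt_exp]
    omega
  obtain ⟨y, hy⟩ := cauchySeq_tendsto_of_complete hc
  refine ⟨y, fun i => ?_⟩
  have h1 := hy.eventually ((valued_nhds_hasBasis hs y).mem_of_mem (i := -(i : ℤ)) trivial)
  obtain ⟨n, hn, hin⟩ := (h1.and (eventually_ge_atTop i)).exists
  have hn' : hv.v (s n - y) < WithZero.exp (-(i : ℤ)) := hn
  rw [← sub_add_sub_cancel _ (s n)]
  refine (hv.v.map_add _ _).trans (max_le ?_ (hle _ _ hin))
  rw [hv.v.map_sub_swap]
  exact hn'.le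

namespace Place

variable {F : Type*} [Field F] (v : Place F)

theorem complVal_embed (x : F) : v.complVal (v.embed x) = v.val x :=
  Valued.valuedCompletion_apply (WithVal.toVal v.val x)

theorem addOrd_complVal_embed (x : F) : addOrd v.complVal (v.embed x) = addOrd v.val x := by
  rw [addOrd, complVal_embed, addOrd]

theorem complVal_surjective : Function.Surjective v.complVal := fun y => by
  obtain ⟨x, hx⟩ := v.surj y
  exact ⟨v.embed x, by rw [complVal_embed, hx]⟩

theorem exists_complVal_limit (s : ℕ → v.Compl)
    (h : ∀ i : ℕ, v.complVal (s (i + 1) - s i) ≤ WithZero.exp (-(i : ℤ))) :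
    ∃ y, ∀ i : ℕ, v.complVal (y - s i) ≤ WithZero.exp (-(i : ℤ)) :=
  exists_valued_limit (K := v.Compl) v.complVal_surjective s h

variable {K : Type*} [Field K] {θ : K ≃+* K}

theorem continuous_of_isOrd {R : Type*} [Field R] [hv : Valued R ℤᵐ⁰]
    (hs : Function.Surjective hv.v) (Φ : R →+* TwistedLaurent K θ) {m : ℕ} (hm : 0 < m)
    (hΦ : ∀ x ≠ 0, (Φ x).IsOrd (m * addOrd hv.v x)) : Continuous Φ := by
  refine continuous_of_continuousAt_zero Φ ?_
  rw [ContinuousAt, map_zero]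
  -- The radius uses |N| so that ord x ≥ |N| gives m · ord x ≥ N for either sign of N, given m ≥ 1.
  refine ((valued_nhds_hasBasis hs 0).tendsto_iff (TwistedLaurent.nhds_hasBasis 0)).2
    fun N _ => ⟨-|N|, trivial, fun x hx i hi => ?_⟩
  change hv.v (x - 0) < _ at hx
  rw [sub_zero] at hx
  by_cases hx0 : x = 0
  · rw [hx0, map_zero]
  refine (hΦ x hx0).1 i (hi.trans_le ?_)
  rw [valuation_eq_exp_neg_addOrd _ hx0, WithZero.exp_lt_exp] at hx
  have h1 : |N| ≤ addOrd hv.v x := by omega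
  have h2 : (1 : ℤ) ≤ m := by omega
  nlinarith [le_abs_self N, abs_nonneg N]

/-- A homomorphism to twisted Laurent series that is compatible with the valuations extends to the
completion. -/
theorem exists_extension_compl (Φ₀ : F →+* TwistedLaurent K θ) {m : ℕ} (hm : 0 < m)
    (hΦ₀ : ∀ x ≠ 0, (Φ₀ x).IsOrd (m * addOrd v.val x)) :
    ∃ Φ : v.Compl →+* TwistedLaurent K θ, Continuous Φ ∧ (∀ x, Φ (v.embed x) = Φ₀ x) ∧
      ∀ x ≠ 0, (Φ x).IsOrd (m * addOrd v.complVal x) := by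
  let Ψ : WithVal v.val →+* TwistedLaurent K θ := Φ₀.comp (WithVal.equiv v.val).toRingHom
  have hΨ : Continuous Ψ := continuous_of_isOrd (R := WithVal v.val) (fun y => by
    obtain ⟨x, hx⟩ := v.surj y
    exact ⟨WithVal.toVal v.val x, hx⟩) Ψ hm fun x hx => hΦ₀ x.ofVal fun h => hx (by
      rw [← WithVal.toVal_ofVal v.val x, h, WithVal.toVal_zero])
  let Φ : v.Compl →+* TwistedLaurent K θ := UniformSpace.Completion.extensionHom Ψ hΨ
  have hc : Continuous Φ := UniformSpace.Completion.continuous_extension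
  have he : ∀ x, Φ (v.embed x) = Φ₀ x := fun x =>
    UniformSpace.Completion.extensionHom_coe Ψ hΨ (WithVal.toVal v.val x)
  refine ⟨Φ, hc, he, fun x hx => ?_⟩
  -- Near x ≠ 0 the valuation is constant, and so are the coefficients of the image up to and
  -- including degree m · ord x. By density the order can be checked at a point of F.
  have h1 := hc.continuousAt.preimage_mem_nhds ((TwistedLaurent.nhds_hasBasis (Φ x)).mem_of_mem
    (i := m * addOrd v.complVal x + 1) trivial)
  have h2 := Valued.locally_const (R := v.Compl) (x := x)
    ((Valuation.ne_zero_iff _).2 hx)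
  obtain ⟨y, ⟨z, rfl⟩, hy1, hy2⟩ := (UniformSpace.Completion.denseRange_coe
    (α := WithVal v.val)).inter_nhds_nonempty (inter_mem h1 h2)
  have hy1' : ∀ i < m * addOrd v.complVal x + 1,
    (Φ (v.embed z.ofVal)).coeff i = (Φ x).coeff i := hy1
  have hy2' : v.complVal (v.embed z.ofVal) = v.complVal x := hy2
  have hz : addOrd v.complVal x = addOrd v.val z.ofVal := by
    rw [addOrd, ← hy2', complVal_embed, addOrd]
  have hz0 : z.ofVal ≠ 0 := by
    intro h
    rw [h, map_zero, map_zero, eq_comm, Valuation.zero_iff] at hy2'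
    exact hx hy2'
  have h3 := hΦ₀ _ hz0
  rw [← he, ← hz] at h3
  exact ⟨fun i hi => (hy1' i (by omega)).symm.trans (h3.1 i hi),
    fun h => h3.2 ((hy1' _ (by omega)).trans h)⟩

theorem ringHom_ext_compl {Φ Φ' : v.Compl →+* TwistedLaurent K θ} (hΦ : Continuous Φ)
    (hΦ' : Continuous Φ') (h : ∀ x, Φ (v.embed x) = Φ' (v.embed x)) : Φ = Φ' := by
  refine RingHom.ext fun x => ?_
  have := (UniformSpace.Completion.denseRange_coe (α := WithVal v.val)).equalizer hΦ hΦ'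
    (funext fun z => h z.ofVal)
  exact congrFun this x

end Place

end Completion

/-! ### Local embeddings: residue field and Teichmüller representatives -/

/-- A homomorphism `Φ : R → L̄((τ⁻¹))` from a complete discretely valued field, such that the order
of `Φ(x)` is `m` times the order of `x`. -/
structure IsLocalEmbedding {k Lbar : Type*} [Field k] [Fintype k] [Field Lbar] [Algebra k Lbar]
    [IsAlgClosed Lbar] {R : Type*} [Field R] (v : Valuation R ℤᵐ⁰) (Φ : R →+* Series k Lbar)
    (m : ℕ) : Prop where
  surj : Function.Surjective v
  complete : ∀ s : ℕ → R, (∀ i : ℕ, v (s (i + 1) - s i) ≤ WithZero.exp (-(i : ℤ))) →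
    ∃ y, ∀ i : ℕ, v (y - s i) ≤ WithZero.exp (-(i : ℤ))
  pos : 0 < m
  isOrd : ∀ x ≠ 0, (Φ x).IsOrd (m * addOrd v x)

namespace IsLocalEmbedding

variable {k Lbar : Type*} [Field k] [Fintype k] [Field Lbar] [Algebra k Lbar]
    [IsAlgClosed Lbar] {R : Type*} [Field R] {v : Valuation R ℤᵐ⁰} {Φ : R →+* Series k Lbar}
    {m : ℕ} (h : IsLocalEmbedding v Φ m)

include h

theorem coeff_eq_zero {x : R} {N : ℤ} (hx : v x ≤ WithZero.exp (-N)) :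
    ∀ i < m * N, (Φ x).coeff i = 0 := by
  by_cases hx0 : x = 0
  · intro i _
    rw [hx0, map_zero, TwistedLaurent.coeff_zero]
  intro i hi
  rw [valuation_eq_exp_neg_addOrd v hx0, WithZero.exp_le_exp] at hx
  have := h.pos
  exact (h.isOrd x hx0).1 i (hi.trans_le (mul_le_mul_of_nonneg_left (by omega) (by omega)))

theorem coeff_eq_zero_of_le_one {x : R} (hx : v x ≤ 1) : ∀ i < 0, (Φ x).coeff i = 0 := by
  have := h.coeff_eq_zero (N := 0) (x := x) (by simpa using hx)
  simpa using this

theorem coeff_zero_eq_zero_iff {x : R} (hx : v x ≤ 1) : (Φ x).coeff 0 = 0 ↔ v x < 1 := by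
  by_cases hx0 : x = 0
  · simp [hx0]
  have ho := h.isOrd x hx0
  have hm := h.pos
  rw [valuation_eq_exp_neg_addOrd v hx0, ← WithZero.exp_zero, WithZero.exp_le_exp] at hx
  rw [valuation_eq_exp_neg_addOrd v hx0, ← WithZero.exp_zero, WithZero.exp_lt_exp]
  constructor
  · intro h0
    by_contra hn
    have : addOrd v x = 0 := by omega
    rw [this, mul_zero] at ho
    exact ho.2 h0
  · intro hlt
    exact ho.1 0 (mul_pos (by omega) (by omega))

theorem exists_isOrd (N : ℤ) : ∃ x : R, x ≠ 0 ∧ addOrd v x = N ∧ (Φ x).IsOrd (m * N) := by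
  obtain ⟨x, hx⟩ := h.surj (WithZero.exp (-N))
  have hx0 : x ≠ 0 := by
    rintro rfl
    rw [map_zero] at hx
    exact WithZero.exp_ne_zero hx.symm
  have ho : addOrd v x = N := by rw [addOrd, hx, WithZero.log_exp, neg_neg]
  exact ⟨x, hx0, ho, ho ▸ h.isOrd x hx0⟩

/-- The leading coefficient of the image of an integral element is fixed by a power of the
Frobenius. -/
theorem coeff_zero_mem_frobFixed {x : R} (hx : v x ≤ 1) : (Φ x).coeff 0 ∈ frobFixed k Lbar m := by
  obtain ⟨y, hy0, -, hy⟩ := h.exists_isOrd (-1)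
  rw [show (m : ℤ) * -1 = -(m : ℤ) by ring] at hy
  -- Here y has image of order −m. The leading coefficients of the equal products y x and x y differ
  -- by θ^m applied to the constant coefficient of the image of x.
  have h1 := TwistedLaurent.coeff_mul_add hy.1 (h.coeff_eq_zero_of_le_one hx)
  have h2 := TwistedLaurent.coeff_mul_add (h.coeff_eq_zero_of_le_one hx) hy.1
  rw [add_zero, neg_neg, frob_zpow_natCast_apply] at h1
  rw [zero_add, neg_zero, zpow_zero, ← map_mul, mul_comm x, map_mul, h1, mul_comm] at h2
  exact mem_frobFixed.2 (mul_right_cancel₀ hy.2 h2)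

/-- The embedding of the residue field given by the constant coefficients. -/
theorem exists_residueField_hom : ∃ f : IsLocalRing.ResidueField v.valuationSubring →+* Lbar,
    ∀ x : v.valuationSubring, f (IsLocalRing.residue _ x) = (Φ x).coeff 0 := by
  let g : v.valuationSubring →+* Lbar :=
    { toFun := fun x => (Φ x).coeff 0
      map_one' := by
        change (Φ 1).coeff 0 = 1
        rw [map_one, TwistedLaurent.coeff_one, if_pos rfl]
      map_zero' := by
        change (Φ 0).coeff 0 = 0
        rw [map_zero, TwistedLaurent.coeff_zero]
      map_mul' := fun x y => by
        change (Φ (x * y)).coeff 0 = _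
        have := TwistedLaurent.coeff_mul_add (h.coeff_eq_zero_of_le_one x.2)
          (h.coeff_eq_zero_of_le_one y.2)
        rw [map_mul]
        simpa using this
      map_add' := fun x y => by
        change (Φ (x + y)).coeff 0 = _
        rw [map_add, TwistedLaurent.coeff_add] }
  have hloc : IsLocalHom g := ⟨fun x hx => by
    have h1 : ¬ v (x : R) < 1 := fun hlt =>
      hx.ne_zero ((h.coeff_zero_eq_zero_iff x.2).2 hlt)
    have h2 : v (x : R) = 1 := le_antisymm x.2 (not_lt.1 h1)
    have hx0 : (x : R) ≠ 0 := by
      intro h0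
      rw [h0, map_zero] at h2
      exact zero_ne_one h2
    have hxi : v (x : R)⁻¹ ≤ 1 := by rw [map_inv₀, h2, inv_one]
    exact IsUnit.of_mul_eq_one ⟨(x : R)⁻¹, hxi⟩ (Subtype.ext (mul_inv_cancel₀ hx0))⟩
  exact ⟨IsLocalRing.ResidueField.lift g, fun x => IsLocalRing.ResidueField.lift_residue_apply g x⟩

theorem residueField_apply_mem {f : IsLocalRing.ResidueField v.valuationSubring →+* Lbar}
    (hf : ∀ x : v.valuationSubring, f (IsLocalRing.residue _ x) = (Φ x).coeff 0)
    (y : IsLocalRing.ResidueField v.valuationSubring) : f y ∈ frobFixed k Lbar m := by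
  obtain ⟨x, rfl⟩ := IsLocalRing.residue_surjective y
  rw [hf]
  exact h.coeff_zero_mem_frobFixed x.2

theorem finite_residueField : Finite (IsLocalRing.ResidueField v.valuationSubring) := by
  obtain ⟨f, hf⟩ := h.exists_residueField_hom
  have := finite_frobFixed (k := k) (K := Lbar) h.pos
  exact Finite.of_injective (fun y => (⟨f y, h.residueField_apply_mem hf y⟩ : frobFixed k Lbar m))
    fun x y hxy => f.injective (congrArg Subtype.val hxy)

/-- The residue field has `q ^ d` elements, where `d` is its degree, and `d` divides `m`. -/
theorem residueDegree_spec (g : k →+* R) : 0 < residueDegree g v ∧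
    Nat.card (IsLocalRing.ResidueField v.valuationSubring) =
      Fintype.card k ^ residueDegree g v ∧ residueDegree g v ∣ m := by
  let : Algebra k (IsLocalRing.ResidueField v.valuationSubring) :=
    ((IsLocalRing.residue v.valuationSubring).comp (toValuationRing g v)).toAlgebra
  have hfin := h.finite_residueField
  have hmod : Module.Finite k (IsLocalRing.ResidueField v.valuationSubring) :=
    Module.Finite.of_finite
  have hdef : residueDegree g v =
      Module.finrank k (IsLocalRing.ResidueField v.valuationSubring) := rfl
  rw [hdef]
  refine ⟨Module.finrank_pos, ?_, ?_⟩
  · rw [Module.natCard_eq_pow_finrank (K := k), Nat.card_eq_fintype_card]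
  -- The degree of the residue field is the order of its Frobenius, whose m-th power is trivial
  -- because the residue field embeds into the field with q^m elements.
  · rw [← FiniteField.orderOf_frobeniusAlgHom]
    refine orderOf_dvd_of_pow_eq_one (AlgHom.ext fun x => ?_)
    obtain ⟨f, hf⟩ := h.exists_residueField_hom
    have key : ∀ (n : ℕ) (x : IsLocalRing.ResidueField v.valuationSubring),
        (FiniteField.frobeniusAlgHom k _ ^ n) x = x ^ Fintype.card k ^ n := by
      intro n
      induction n with
      | zero => intro x; simp
      | succ n ih =>
        intro x
        rw [pow_succ, AlgHom.mul_apply, ih]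
        change (x ^ Fintype.card k) ^ _ = _
        rw [← pow_mul, ← pow_succ']
    rw [key]
    apply f.injective
    rw [map_pow]
    exact mem_frobFixed.1 (h.residueField_apply_mem hf x)

variable {d : ℕ}

/-- The residue field, having q^d elements, embeds into the field with q^d elements; by counting
this embedding is onto. -/
theorem exists_coeff_zero_eq (hd : 0 < d)
    (hcard : Nat.card (IsLocalRing.ResidueField v.valuationSubring) = Fintype.card k ^ d)
    {e : Lbar} (he : e ∈ frobFixed k Lbar d) : ∃ x, v x ≤ 1 ∧ (Φ x).coeff 0 = e := by
  obtain ⟨f, hf⟩ := h.exists_residueField_hom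
  have hfin := h.finite_residueField
  have hfin' := finite_frobFixed (k := k) (K := Lbar) hd
  have := Fintype.ofFinite (IsLocalRing.ResidueField v.valuationSubring)
  have hmem : ∀ y, f y ∈ frobFixed k Lbar d := fun y => mem_frobFixed.2 (by
    rw [← map_pow, ← hcard, Nat.card_eq_fintype_card, FiniteField.pow_card])
  let g : IsLocalRing.ResidueField v.valuationSubring → frobFixed k Lbar d :=
    fun y => ⟨f y, hmem y⟩
  have hg : Function.Injective g := fun x y hxy => f.injective (congrArg Subtype.val hxy)
  have hb : Function.Bijective g := (Nat.bijective_iff_injective_and_card g).2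
    ⟨hg, by rw [hcard, natCard_frobFixed hd]⟩
  obtain ⟨y, hy⟩ := hb.2 ⟨e, he⟩
  obtain ⟨x, rfl⟩ := IsLocalRing.residue_surjective y
  exact ⟨x, x.2, (hf x).symm.trans (congrArg Subtype.val hy)⟩

/-- Teichmüller representatives. -/
theorem exists_teichmuller (hd : 0 < d) (hchar : ((Fintype.card k : ℕ) : R) = 0)
    (hcard : Nat.card (IsLocalRing.ResidueField v.valuationSubring) = Fintype.card k ^ d)
    {e : Lbar} (he : e ∈ frobFixed k Lbar d) :
    ∃ x, x ^ Fintype.card k ^ d = x ∧ v x ≤ 1 ∧ (Φ x).coeff 0 = e := by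
  obtain ⟨p, hp, n, hprime, hq⟩ := FiniteField.card' k
  have hpR : CharP R p := by
    rw [hq, Nat.cast_pow, pow_eq_zero_iff n.pos.ne'] at hchar
    exact (CharP.charP_iff_prime_eq_zero hprime).2 hchar
  have : Fact p.Prime := ⟨hprime⟩
  have hexp : ExpChar R p := ExpChar.prime hprime
  set Q := Fintype.card k ^ d with hQ
  have hQp : ∀ i, Q ^ i = p ^ (n * d * i) := fun i => by rw [hQ, hq, ← pow_mul, ← pow_mul, mul_assoc]
  have hsub : ∀ (i : ℕ) (x y : R), (x - y) ^ Q ^ i = x ^ Q ^ i - y ^ Q ^ i := fun i x y => by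
    rw [hQp, sub_pow_expChar_pow]
  have hQ1 : 1 < Q := one_lt_card_pow hd
  obtain ⟨x, hx, hxe⟩ := h.exists_coeff_zero_eq hd hcard he
  have hfin := h.finite_residueField
  have := Fintype.ofFinite (IsLocalRing.ResidueField v.valuationSubring)
  have hx1 : v (x ^ Q - x) < 1 := by
    rw [← h.coeff_zero_eq_zero_iff]
    · obtain ⟨f, hf⟩ := h.exists_residueField_hom
      have h1 := hf (⟨x, hx⟩ ^ Q - ⟨x, hx⟩)
      rw [map_sub, map_pow, ← hcard, Nat.card_eq_fintype_card, FiniteField.pow_card, sub_self,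
        map_zero, ← Nat.card_eq_fintype_card, hcard] at h1
      exact h1.symm
    · exact (v.map_sub _ _).trans (max_le (by rw [map_pow]; exact pow_le_one' hx _) hx)
  have hx1' : v (x ^ Q - x) ≤ WithZero.exp (-1) := by
    by_cases h0 : x ^ Q - x = 0
    · rw [h0, map_zero]; exact zero_le
    · rw [valuation_eq_exp_neg_addOrd v h0, ← WithZero.exp_zero, WithZero.exp_lt_exp] at hx1
      rw [valuation_eq_exp_neg_addOrd v h0, WithZero.exp_le_exp]
      omega
  -- In characteristic p the difference is (x^Q − x)^(Q^i), of order at least Q^i ≥ i + 1. The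
  -- representative is the limit of the powers x^(Q^i).
  have hstep : ∀ i : ℕ, v (x ^ Q ^ (i + 1) - x ^ Q ^ i) ≤ WithZero.exp (-((i : ℤ) + 1)) := by
    intro i
    rw [pow_succ', pow_mul, ← hsub, map_pow]
    refine (pow_le_pow_left' hx1' _).trans ?_
    rw [← WithZero.exp_nsmul, WithZero.exp_le_exp]
    have : i < Q ^ i := Nat.lt_pow_self hQ1
    rw [nsmul_eq_mul]
    push_cast
    have : (i : ℤ) + 1 ≤ (Q : ℤ) ^ i := by exact_mod_cast this
    omega
  obtain ⟨y, hy⟩ := h.complete (fun i => x ^ Q ^ i) fun i => (hstep i).trans (by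
    rw [WithZero.exp_le_exp]
    omega)
  have hyQ : y ^ Q = y := by
    rw [← sub_eq_zero]
    by_contra hne
    obtain ⟨i, hi⟩ : ∃ i : ℕ, addOrd v (y ^ Q - y) < i :=
      ⟨(addOrd v (y ^ Q - y) + 1).toNat, by omega⟩
    have hi' : v (y ^ Q - y) ≤ WithZero.exp (-(i : ℤ)) := by
      have e : y ^ Q - y = (y - x ^ Q ^ i) ^ Q + (x ^ Q ^ (i + 1) - x ^ Q ^ i) -
          (y - x ^ Q ^ i) := by
        have := hsub 1 y (x ^ Q ^ i)
        rw [pow_one] at this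
        rw [this, ← pow_mul, ← pow_succ]
        ring
      rw [e]
      refine (v.map_sub _ _).trans (max_le ((v.map_add _ _).trans (max_le ?_ ?_)) (hy i))
      · rw [map_pow]
        refine (pow_le_pow_left' (hy i) _).trans ?_
        rw [← WithZero.exp_nsmul, WithZero.exp_le_exp, nsmul_eq_mul]
        have : (1 : ℤ) ≤ Q := by exact_mod_cast hQ1.le
        nlinarith
      · refine (hstep i).trans ?_
        rw [WithZero.exp_le_exp]
        omega
    rw [valuation_eq_exp_neg_addOrd v hne, WithZero.exp_le_exp] at hi'
    omega
  have hyx : v (y - x) < 1 := by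
    have h1 := hy 1
    rw [pow_one] at h1
    rw [← sub_add_sub_cancel y (x ^ Q) x]
    refine (v.map_add _ _).trans_lt (max_lt (h1.trans_lt ?_) hx1)
    rw [← WithZero.exp_zero, WithZero.exp_lt_exp]
    simp
  have hy1 : v y ≤ 1 := by
    rw [← sub_add_cancel y x]
    exact (v.map_add _ _).trans (max_le hyx.le hx)
  refine ⟨y, hyQ, hy1, ?_⟩
  have h2 := (h.coeff_zero_eq_zero_iff hyx.le).2 hyx
  rw [map_sub, TwistedLaurent.coeff_sub, sub_eq_zero] at h2
  rw [h2, hxe]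

/-- The difference is either 0 or a root of unity; the latter has valuation 1, but equal residues
make the valuation smaller than 1. -/
theorem teichmuller_unique {x y : R} (hsub : (x - y) ^ Fintype.card k ^ d = x - y)
    (hd : 0 < d) (hx : v x ≤ 1) (hy : v y ≤ 1) (hxy : (Φ x).coeff 0 = (Φ y).coeff 0) : x = y := by
  have h1 : v (x - y) ≤ 1 := (v.map_sub _ _).trans (max_le hx hy)
  have h2 : v (x - y) < 1 := (h.coeff_zero_eq_zero_iff h1).1 (by
    rw [map_sub, TwistedLaurent.coeff_sub, hxy, sub_self])
  by_contra hne
  have hne' : x - y ≠ 0 := sub_ne_zero.2 hne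
  have hQ := one_lt_card_pow (k := k) hd
  have h3 : (x - y) ^ (Fintype.card k ^ d - 1) = 1 := by
    refine mul_right_cancel₀ hne' ?_
    rw [← pow_succ, Nat.sub_add_cancel hQ.le, hsub, one_mul]
  have h4 : v (x - y) ^ (Fintype.card k ^ d - 1) < 1 := pow_lt_one' h2 (by omega)
  rw [← map_pow, h3, map_one] at h4
  exact lt_irrefl _ h4

end IsLocalEmbedding

theorem sub_pow_card_pow {k R : Type*} [Field k] [Fintype k] [Field R]
    (hchar : ((Fintype.card k : ℕ) : R) = 0) (d : ℕ) (x y : R) :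
    (x - y) ^ Fintype.card k ^ d = x ^ Fintype.card k ^ d - y ^ Fintype.card k ^ d := by
  obtain ⟨p, hp, n, hprime, hq⟩ := FiniteField.card' k
  have hpR : CharP R p := by
    rw [hq, Nat.cast_pow, pow_eq_zero_iff n.pos.ne'] at hchar
    exact (CharP.charP_iff_prime_eq_zero hprime).2 hchar
  have hexp : ExpChar R p := ExpChar.prime hprime
  rw [hq, ← pow_mul, sub_pow_expChar_pow]

/-! ### Monomials and conjugation to normal form -/

namespace TwistedLaurent

variable {K : Type*} [Field K] {θ : K ≃+* K}

theorem monomial_zero_mul_monomial_zero (a b : K) :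
    monomial θ 0 a * monomial θ 0 b = monomial θ 0 (a * b) := by
  rw [monomial_mul_monomial, add_zero, neg_zero, zpow_zero]
  rfl

theorem monomial_zero_right (i : ℤ) : monomial θ i (0 : K) = 0 := by
  ext j
  rw [coeff_monomial, ite_self, coeff_zero]

theorem monomial_one_mul_monomial_one (i j : ℤ) :
    monomial θ i (1 : K) * monomial θ j 1 = monomial θ (i + j) 1 := by
  rw [monomial_mul_monomial, map_one, mul_one]

theorem monomial_mul_comm_iff {j : ℤ} {a : K} {f : TwistedLaurent K θ} :
    f * monomial θ j a = monomial θ j a * f ↔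
      ∀ i, f.coeff i * (θ ^ (-i)) a = a * (θ ^ (-j)) (f.coeff i) := by
  constructor
  · intro h i
    have := congrArg (fun g => g.coeff (i + j)) h
    simpa only [coeff_mul_monomial, coeff_monomial_mul, add_sub_cancel_right] using this
  · intro h
    ext m
    rw [coeff_mul_monomial, coeff_monomial_mul, h]

/-- A ring homomorphism from a field maps the powers of `x` to powers of `τ`, if it does so for
`x` itself. -/
theorem map_zpow_eq_monomial {R : Type*} [Field R] (Ψ : R →+* TwistedLaurent K θ) {x : R} {i : ℤ}
    (hx : Ψ x = monomial θ i 1) (j : ℤ) : Ψ (x ^ j) = monomial θ (i * j) 1 := by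
  have hx0 : x ≠ 0 := by
    rintro rfl
    rw [map_zero] at hx
    exact (isOrd_monomial one_ne_zero).ne_zero hx.symm
  have hnat : ∀ n : ℕ, Ψ (x ^ n) = monomial θ (i * n) 1 := by
    intro n
    induction n with
    | zero => simp; rfl
    | succ n ih =>
      rw [pow_succ, map_mul, ih, hx, monomial_one_mul_monomial_one]
      congr 1
      push_cast
      ring
  obtain ⟨n, rfl | rfl⟩ := j.eq_nat_or_neg
  · rw [zpow_natCast, hnat]
  · have h1 : Ψ (x ^ (-(n : ℤ))) * Ψ (x ^ n) = 1 := by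
      rw [← map_mul, zpow_neg, zpow_natCast, inv_mul_cancel₀ (pow_ne_zero _ hx0), map_one]
    have h2 : monomial θ (i * -(n : ℤ)) (1 : K) * Ψ (x ^ n) = 1 := by
      rw [hnat, monomial_one_mul_monomial_one, mul_neg, neg_add_cancel]
      rfl
    exact mul_right_cancel₀ (right_ne_zero_of_mul_eq_one h1) (h1.trans h2.symm)

end TwistedLaurent

namespace IsLocalEmbedding

open TwistedLaurent

variable {k Lbar : Type*} [Field k] [Fintype k] [Field Lbar] [Algebra k Lbar]
    [IsAlgClosed Lbar] {R : Type*} [Field R] {v : Valuation R ℤᵐ⁰} {Φ : R →+* Series k Lbar}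
    {m : ℕ} (h : IsLocalEmbedding v Φ m) {d : ℕ}

include h

/-- Uniqueness of the representatives makes them multiplicative, since a product of representatives
is again a solution of x^(q^d) = x. -/
theorem exists_teichmuller_map (hd : 0 < d) (hchar : ((Fintype.card k : ℕ) : R) = 0)
    (hcard : Nat.card (IsLocalRing.ResidueField v.valuationSubring) = Fintype.card k ^ d) :
    ∃ T : frobFixed k Lbar d →*₀ R, ∀ e, v (T e) ≤ 1 ∧ (Φ (T e)).coeff 0 = e := by
  choose T hTQ hT1 hTe using fun e : frobFixed k Lbar d =>
    h.exists_teichmuller hd hchar hcard e.2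
  have huniq : ∀ (x : R) (e : frobFixed k Lbar d), x ^ Fintype.card k ^ d = x → v x ≤ 1 →
      (Φ x).coeff 0 = e → T e = x := by
    intro x e hx hx1 hxe
    refine h.teichmuller_unique (d := d) ?_ hd (hT1 e) hx1 ((hTe e).trans hxe.symm)
    rw [sub_pow_card_pow hchar, hTQ, hx]
  refine ⟨{ toFun := T, map_zero' := ?_, map_one' := ?_, map_mul' := fun a b => ?_ },
    fun e => ⟨hT1 e, hTe e⟩⟩
  · refine huniq 0 0 (zero_pow (zero_lt_one.trans (one_lt_card_pow hd)).ne') (by simp) ?_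
    rw [map_zero, coeff_zero]
    rfl
  · refine huniq 1 1 (one_pow _) (by simp) ?_
    rw [map_one, coeff_one, if_pos rfl]
    rfl
  · refine huniq _ _ (by rw [mul_pow, hTQ, hTQ]) (by rw [map_mul]; exact mul_le_one' (hT1 a) (hT1 b)) ?_
    have := coeff_mul_add (h.coeff_eq_zero_of_le_one (hT1 a)) (h.coeff_eq_zero_of_le_one (hT1 b))
    rw [add_zero, neg_zero, zpow_zero, hTe, hTe] at this
    rw [map_mul, this]
    rfl

omit h in
/-- The Teichmüller representatives can be conjugated to constants. -/
theorem exists_unit_teichmuller (hd : 0 < d) (T : frobFixed k Lbar d →*₀ R)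
    (hT : ∀ e, v (T e) ≤ 1 ∧ (Φ (T e)).coeff 0 = e) :
    ∃ u : (Series k Lbar)ˣ, ∀ e, Φ (T e) * (u : Series k Lbar) = (u : Series k Lbar) * monomial (frob k Lbar) 0 (e : Lbar) := by
  classical
  have hfin := finite_frobFixed (k := k) (K := Lbar) hd
  have := Fintype.ofFinite (frobFixed k Lbar d)
  -- Averaging over the finite group F_(q^d)^×: translating the summation index gives the
  -- intertwining relation. The constant coefficient of w is q^d − 1 = −1, so w ≠ 0.
  let w : Series k Lbar := ∑ e : (frobFixed k Lbar d)ˣ,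
    Φ (T e) * monomial (frob k Lbar) 0 ((e⁻¹ : (frobFixed k Lbar d)ˣ) : frobFixed k Lbar d).1
  have hw0 : w.coeff 0 ≠ 0 := by
    have h1 : w.coeff 0 = ∑ e : (frobFixed k Lbar d)ˣ, (1 : Lbar) := by
      rw [coeff_sum]
      refine Finset.sum_congr rfl fun e _ => ?_
      rw [coeff_mul_monomial, sub_zero, neg_zero, zpow_zero, (hT e).2]
      change ((e : frobFixed k Lbar d) : Lbar) * ((e⁻¹ : (frobFixed k Lbar d)ˣ) :
        frobFixed k Lbar d).1 = 1
      exact congrArg Subtype.val e.mul_inv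
    have h2 : Fintype.card (frobFixed k Lbar d) = Fintype.card k ^ d := by
      rw [← Nat.card_eq_fintype_card, natCard_frobFixed hd]
    rw [h1, Finset.sum_const, Finset.card_univ, Fintype.card_units, h2, nsmul_eq_mul, mul_one,
      Nat.cast_sub (one_lt_card_pow hd).le, cast_card_pow_eq_zero hd]
    simp
  have hwne : w ≠ 0 := fun h0 => hw0 (by rw [h0, coeff_zero])
  obtain ⟨u, hu⟩ := isUnit_of_ne_zero hwne
  refine ⟨u, fun e => ?_⟩
  rw [hu]
  by_cases he : e = 0
  · rw [he, map_zero, map_zero, zero_mul, ZeroMemClass.coe_zero, monomial_zero_right, mul_zero]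
  · obtain ⟨e, rfl⟩ : ∃ e' : (frobFixed k Lbar d)ˣ, (e' : frobFixed k Lbar d) = e :=
      ⟨Units.mk0 e he, rfl⟩
    rw [Finset.mul_sum, Finset.sum_mul]
    refine Fintype.sum_equiv (Equiv.mulLeft e) _ _ fun x => ?_
    rw [← mul_assoc, ← map_mul, ← map_mul, mul_assoc, monomial_zero_mul_monomial_zero,
      Equiv.coe_mulLeft, Units.val_mul]
    congr 2
    change _ = (((e * x)⁻¹ * e : (frobFixed k Lbar d)ˣ) : frobFixed k Lbar d).1
    congr 2
    group

/-- A conjugate of `Φ` maps a uniformizer to `τ⁻ᵐ` and the Teichmüller representatives to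
constants. -/
theorem exists_unit_normal (hd : 0 < d) (hdm : d ∣ m) (T : frobFixed k Lbar d →*₀ R)
    (hT : ∀ e, v (T e) ≤ 1 ∧ (Φ (T e)).coeff 0 = e) :
    ∃ (u : (Series k Lbar)ˣ) (π : R), addOrd v π = 1 ∧
      ↑u⁻¹ * Φ π * ↑u = monomial (frob k Lbar) m 1 ∧
      ∀ e, (↑u⁻¹ * Φ (T e) * ↑u : Series k Lbar) = monomial (frob k Lbar) 0 (e : Lbar) := by
  obtain ⟨u₁, hu₁⟩ := exists_unit_teichmuller hd T hT
  obtain ⟨π, hπ0, hπ, hπo⟩ := h.exists_isOrd 1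
  -- Inverting π makes the order negative, so that the leading equations below are polynomial, of
  -- the form a x^(q^m) − x = c.
  have hπi : (Φ π⁻¹).IsOrd (-(m : ℤ)) := by
    obtain ⟨N, hN⟩ := TwistedLaurent.exists_isOrd ((map_ne_zero_iff Φ Φ.injective).2 (inv_ne_zero hπ0))
    have := (hN.mul hπo).unique (by rw [← map_mul, inv_mul_cancel₀ hπ0, map_one]; exact isOrd_one)
    rwa [show N = -(m : ℤ) by omega] at hN
  obtain ⟨f, hf⟩ : ∃ f : Series k Lbar, f = ↑u₁⁻¹ * Φ π⁻¹ * ↑u₁ := ⟨_, rfl⟩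
  have hfo : f.IsOrd (-(m : ℤ)) := hf ▸ hπi.conj u₁
  have hu₁f : ↑u₁ * f = Φ π⁻¹ * ↑u₁ := by
    rw [hf, ← mul_assoc, ← mul_assoc, u₁.mul_inv, one_mul]
  have hfe : ∀ e : frobFixed k Lbar d, f * monomial (frob k Lbar) 0 (e : Lbar) = monomial (frob k Lbar) 0 (e : Lbar) * f := by
    intro e
    refine u₁.isUnit.mul_left_cancel ?_
    rw [← mul_assoc, hu₁f, mul_assoc, ← hu₁, ← mul_assoc, ← map_mul, mul_comm, map_mul, mul_assoc,
      ← hu₁f, ← mul_assoc, hu₁, mul_assoc]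
  -- Commuting with the constants of F_(q^d) confines f to degrees divisible by d.
  have hfd : ∀ i, ¬ (d : ℤ) ∣ i → f.coeff i = 0 := by
    intro i hi
    by_contra hne
    refine hi ((dvd_neg).1 (dvd_of_frob_zpow_eq (k := k) (K := Lbar) hd fun x hx => ?_))
    have := monomial_mul_comm_iff.1 (hfe ⟨x, hx⟩) i
    rw [neg_zero, zpow_zero, mul_comm] at this
    exact mul_right_cancel₀ hne this
  have hm := h.pos
  -- With x₀ as leading coefficient the terms of degree −m cancel, so a correction w starting in
  -- degree 1 suffices and x₀ + w is not zero.
  obtain ⟨x₀, hx₀, hx₀e⟩ := exists_mul_frob_pow_eq_self (k := k) hm hfo.2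
  set g := monomial (frob k Lbar) (-(m : ℤ)) 1 with hgdef
  have hgo : g.IsOrd (-(m : ℤ)) := isOrd_monomial one_ne_zero
  have hx₀o : (monomial (frob k Lbar) 0 x₀).IsOrd 0 := isOrd_monomial hx₀
  obtain ⟨w, hw, hweq⟩ := exists_mul_sub_mul_eq f g
    (-(f * monomial (frob k Lbar) 0 x₀ - monomial (frob k Lbar) 0 x₀ * g)) (N := -(m : ℤ)) (B := 1) hfo.1 hgo.1
    (fun i hi => by
      rw [coeff_neg, coeff_sub, neg_eq_zero]
      rcases lt_or_eq_of_le (show i ≤ -(m : ℤ) by omega) with hlt | rfl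
      · rw [coeff_mul_of_lt hfo.1 hx₀o.1 i (by omega), coeff_mul_of_lt hx₀o.1 hgo.1 i (by omega),
          sub_zero]
      · rw [coeff_mul_monomial, coeff_monomial_mul, sub_zero, neg_neg, frob_zpow_natCast_apply,
          hx₀e, hgdef, coeff_monomial, if_pos rfl, map_one, mul_one, sub_self])
    (fun s c => by
      obtain ⟨x, hx⟩ := exists_frobTrinomial_root (k := k) hm hfo.2 (1 : Lbar) c
      refine ⟨x, ?_⟩
      rw [neg_neg, frob_zpow_natCast_apply, hgdef, coeff_monomial, if_pos rfl, map_one]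
      exact hx)
  have hu₂ : f * (monomial (frob k Lbar) 0 x₀ + w) = (monomial (frob k Lbar) 0 x₀ + w) * g := by
    rw [mul_add, add_mul, ← sub_eq_zero]
    have := congrArg (fun z => z + (f * monomial (frob k Lbar) 0 x₀ - monomial (frob k Lbar) 0 x₀ * g)) hweq
    simp only [neg_add_cancel] at this
    rw [← this]
    abel
  -- Keeping only degrees divisible by d preserves the equation, because f and τ^m live in such
  -- degrees. It retains x₀ and makes the series commute with the constants already arranged.
  obtain ⟨w', hw'⟩ : ∃ w', w' = proj (d : ℤ) (monomial (frob k Lbar) 0 x₀ + w) := ⟨_, rfl⟩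
  have hfw : f * w' = w' * g := by
    rw [hw', ← proj_mul_of_left hfd, hu₂, proj_mul_monomial (by
      rw [dvd_neg]; exact Int.natCast_dvd_natCast.2 hdm)]
  have hw'0 : w' ≠ 0 := by
    intro h0
    apply hx₀
    have : w'.coeff 0 = x₀ := by
      rw [hw', coeff_proj_of_dvd (dvd_zero _), coeff_add, coeff_monomial, if_pos rfl,
        hw 0 (by omega), add_zero]
    rw [← this, h0, coeff_zero]
  have hw'e : ∀ e : frobFixed k Lbar d,
      w' * monomial (frob k Lbar) 0 (e : Lbar) = monomial (frob k Lbar) 0 (e : Lbar) * w' := by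
    refine fun e => monomial_mul_comm_iff.2 fun i => ?_
    rw [neg_zero, zpow_zero, mul_comm]
    by_cases hi : (d : ℤ) ∣ i
    · rw [frob_zpow_of_mem_frobFixed e.2 ((dvd_neg).2 hi)]
      rfl
    · rw [hw', coeff_proj_of_not_dvd hi, mul_zero, map_zero, mul_zero]
  obtain ⟨u₂, hu₂⟩ := isUnit_of_ne_zero hw'0
  rw [← hu₂] at hfw hw'e
  refine ⟨u₁ * u₂, π, hπ, ?_, fun e => ?_⟩
  · have h1 : ↑(u₁ * u₂)⁻¹ * Φ π⁻¹ * ↑(u₁ * u₂) = g := by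
      rw [mul_inv_rev, Units.val_mul, Units.val_mul]
      calc _ = ↑u₂⁻¹ * (↑u₁⁻¹ * Φ π⁻¹ * ↑u₁) * ↑u₂ := by simp only [mul_assoc]
        _ = g := by rw [← hf, mul_assoc, hfw, ← mul_assoc, u₂.inv_mul, one_mul]
    have h2 : ↑(u₁ * u₂)⁻¹ * Φ π * ↑(u₁ * u₂) * g = 1 := by
      rw [← h1]
      calc _ = ↑(u₁ * u₂)⁻¹ * Φ π * (↑(u₁ * u₂) * ↑(u₁ * u₂)⁻¹) * Φ π⁻¹ * ↑(u₁ * u₂) := by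
            simp only [mul_assoc]
        _ = 1 := by
            rw [Units.mul_inv, mul_one, mul_assoc _ (Φ π), ← map_mul, mul_inv_cancel₀ hπ0,
              map_one, mul_one, Units.inv_mul]
    have h3 : monomial (frob k Lbar) m 1 * g = 1 := by
      rw [hgdef, monomial_one_mul_monomial_one, add_neg_cancel]
      rfl
    exact mul_right_cancel₀ hgo.ne_zero (h2.trans h3.symm)
  · rw [mul_inv_rev, Units.val_mul, Units.val_mul]
    calc _ = ↑u₂⁻¹ * (↑u₁⁻¹ * (Φ (T e) * ↑u₁)) * ↑u₂ := by simp only [mul_assoc]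
      _ = _ := by
        rw [hu₁, ← mul_assoc ((u₁⁻¹ : (Series k Lbar)ˣ) : Series k Lbar), u₁.inv_mul, one_mul,
          mul_assoc, ← hw'e, ← mul_assoc, u₂.inv_mul, one_mul]

end IsLocalEmbedding

/-! ### Normal embeddings: image, centralizer and centre -/

/-- A local embedding that maps a uniformizer to `τ⁻ᵐ` and the Teichmüller representatives of
the residue field with `q ^ d` elements to constants. -/
structure IsNormalEmbedding {k Lbar : Type*} [Field k] [Fintype k] [Field Lbar] [Algebra k Lbar]
    [IsAlgClosed Lbar] {R : Type*} [Field R] (v : Valuation R ℤᵐ⁰) (Φ : R →+* Series k Lbar)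
    (m d : ℕ) (π : R) (T : frobFixed k Lbar d →*₀ R) : Prop extends IsLocalEmbedding v Φ m where
  pos_d : 0 < d
  dvd : d ∣ m
  card : Nat.card (IsLocalRing.ResidueField v.valuationSubring) = Fintype.card k ^ d
  addOrd_unif : addOrd v π = 1
  map_unif : Φ π = TwistedLaurent.monomial (frob k Lbar) m 1
  map_teichmuller : ∀ e, Φ (T e) = TwistedLaurent.monomial (frob k Lbar) 0 (e : Lbar)

namespace IsNormalEmbedding

open TwistedLaurent

variable {k Lbar : Type*} [Field k] [Fintype k] [Field Lbar] [Algebra k Lbar]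
    [IsAlgClosed Lbar] {R : Type*} [Field R] {v : Valuation R ℤᵐ⁰} {Φ : R →+* Series k Lbar}
    {m d : ℕ} {π : R} {T : frobFixed k Lbar d →*₀ R} (h : IsNormalEmbedding v Φ m d π T)

include h

theorem unif_ne_zero : π ≠ 0 := by
  rintro rfl
  have := h.addOrd_unif
  simp [addOrd] at this

theorem map_unif_zpow (j : ℤ) : Φ (π ^ j) = monomial (frob k Lbar) (m * j) 1 :=
  map_zpow_eq_monomial Φ h.map_unif j

theorem map_teichmuller_mul_zpow (e : frobFixed k Lbar d) (j : ℤ) :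
    Φ (T e * π ^ j) = monomial (frob k Lbar) (m * j) (e : Lbar) := by
  rw [map_mul, h.map_teichmuller, h.map_unif_zpow, monomial_mul_monomial, zero_add, neg_zero,
    zpow_zero, map_one, mul_one]

theorem valuation_unif_zpow (j : ℤ) : v (π ^ j) = WithZero.exp (-j) := by
  rw [map_zpow₀, valuation_eq_exp_neg_addOrd v h.unif_ne_zero, h.addOrd_unif,
    ← WithZero.exp_zsmul, smul_eq_mul, mul_neg, mul_one]

/-- Sharper than `coeff_zero_mem_frobFixed`: constant coefficients come from the residue field,
where y^(q^d) = y. -/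
theorem coeff_zero_mem {x : R} (hx : v x ≤ 1) : (Φ x).coeff 0 ∈ frobFixed k Lbar d := by
  obtain ⟨f, hf⟩ := h.exists_residueField_hom
  have hfin := h.finite_residueField
  have := Fintype.ofFinite (IsLocalRing.ResidueField v.valuationSubring)
  rw [← hf ⟨x, hx⟩, mem_frobFixed, ← map_pow, ← h.card, Nat.card_eq_fintype_card,
    FiniteField.pow_card]

theorem coeff_mul_addOrd_mem {x : R} (hx : x ≠ 0) :
    (Φ x).coeff (m * addOrd v x) ∈ frobFixed k Lbar d := by
  have h1 := h.coeff_zero_mem (x := x * π ^ (-addOrd v x)) (by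
    rw [map_mul, h.valuation_unif_zpow, valuation_eq_exp_neg_addOrd v hx, ← WithZero.exp_add]
    simp)
  rw [map_mul, h.map_unif_zpow, coeff_mul_monomial, map_one, mul_one] at h1
  convert h1 using 2
  ring

/-- The image of a normalized embedding consists of series in `τ⁻ᵐ` over the field with `q ^ d`
elements. -/
theorem coeff_spec (x : R) (i : ℤ) :
    (Φ x).coeff i ∈ frobFixed k Lbar d ∧ (¬ (m : ℤ) ∣ i → (Φ x).coeff i = 0) := by
  have hm := h.pos
  -- Subtracting T(e) π^(ord x), with e the leading coefficient, raises the order by at least one.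
  -- Once ord x > |i|, the coefficient of degree i is zero.
  have key : ∀ (n : ℕ) (x : R), (x = 0 ∨ |i| + 1 - n ≤ addOrd v x) →
      (Φ x).coeff i ∈ frobFixed k Lbar d ∧ (¬ (m : ℤ) ∣ i → (Φ x).coeff i = 0) := by
    intro n
    induction n with
    | zero =>
      intro x hx
      have h0 : (Φ x).coeff i = 0 := by
        by_cases hx0 : x = 0
        · rw [hx0, map_zero, coeff_zero]
        · refine (h.isOrd x hx0).1 i ?_
          have hx1 := hx.resolve_left hx0
          have h2 : (1 : ℤ) ≤ m := by omega
          push_cast at hx1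
          nlinarith [le_abs_self i, abs_nonneg i]
      exact ⟨h0 ▸ zero_mem _, fun _ => h0⟩
    | succ n ih =>
      intro x hx
      by_cases hx0 : x = 0
      · rw [hx0, map_zero, coeff_zero]
        exact ⟨zero_mem _, fun _ => rfl⟩
      have hx1 := hx.resolve_left hx0
      set e : frobFixed k Lbar d := ⟨_, h.coeff_mul_addOrd_mem hx0⟩ with he
      have h1 := ih (x - T e * π ^ addOrd v x) (by
        by_cases hne : x - T e * π ^ addOrd v x = 0
        · exact Or.inl hne
        refine Or.inr ?_
        by_contra hlt
        push_cast at hx1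
        have ho := h.isOrd _ hne
        have h2 : addOrd v (x - T e * π ^ addOrd v x) ≤ addOrd v x := by omega
        refine ho.2 ?_
        rw [map_sub, h.map_teichmuller_mul_zpow, coeff_sub, coeff_monomial]
        rcases lt_or_eq_of_le h2 with h3 | h3
        · have h4 : (m : ℤ) * addOrd v (x - T e * π ^ addOrd v x) < m * addOrd v x :=
            mul_lt_mul_of_pos_left h3 (by omega)
          rw [if_neg h4.ne, (h.isOrd x hx0).1 _ h4, sub_zero]
        · rw [h3, if_pos rfl, he, sub_self])
      rw [map_sub, h.map_teichmuller_mul_zpow, coeff_sub, coeff_monomial] at h1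
      by_cases hi : i = m * addOrd v x
      · rw [if_pos hi] at h1
        refine ⟨?_, fun hi' => absurd (hi ▸ dvd_mul_right _ _) hi'⟩
        have := add_mem h1.1 e.2
        rwa [sub_add_cancel] at this
      · rwa [if_neg hi, sub_zero] at h1
  refine key (|i| + 1 - addOrd v x).toNat x (Or.inr ?_)
  omega

/-- Every series in `τ⁻ᵐ` over the field with `q ^ d` elements is in the image of a normalized
embedding. -/
theorem exists_coeff_eq (c : ℤ → frobFixed k Lbar d) {B : ℤ} (hc : ∀ i < B, c i = 0) :
    ∃ x : R, ∀ i, (Φ x).coeff (m * i) = c i := by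
  have hm : (0 : ℤ) < m := by exact_mod_cast h.pos
  let s : ℕ → R := fun n => ∑ i ∈ Finset.range n, T (c (B + i)) * π ^ (i : ℤ)
  have hv : ∀ (e : frobFixed k Lbar d) (j : ℤ), v (T e * π ^ j) ≤ WithZero.exp (-j) := by
    intro e j
    have h1 : v (T e) ≤ 1 := by
      by_cases he : T e = 0
      · rw [he, map_zero]; exact zero_le_one
      · have h2 := h.isOrd _ he
        have he' : (e : Lbar) ≠ 0 := by
          intro h0
          rw [h.map_teichmuller, h0, monomial_zero_right] at h2
          exact h2.ne_zero rfl
        rw [h.map_teichmuller] at h2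
        have h3 := h2.unique (isOrd_monomial he')
        rw [valuation_eq_exp_neg_addOrd v he, (mul_eq_zero.1 h3).resolve_left hm.ne']
        simp
    rw [map_mul, h.valuation_unif_zpow]
    exact mul_le_of_le_one_left' h1
  obtain ⟨y, hy⟩ := h.complete s fun n => by
    change v (∑ i ∈ Finset.range (n + 1), _ - ∑ i ∈ Finset.range n, _) ≤ _
    rw [Finset.sum_range_succ, add_sub_cancel_left]
    exact hv _ _
  have hsn : ∀ n, Φ (s n) = ∑ i ∈ Finset.range n, monomial (frob k Lbar) (m * (i : ℤ))
      (c (B + i) : Lbar) := by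
    intro n
    rw [map_sum]
    exact Finset.sum_congr rfl fun i _ => h.map_teichmuller_mul_zpow _ _
  have hyc : ∀ n : ℕ, (Φ y).coeff (m * (n : ℤ)) = c (B + n) := by
    intro n
    have h1 := h.coeff_eq_zero (hy (n + 1)) (m * n) (by push_cast; nlinarith)
    rw [map_sub, coeff_sub, sub_eq_zero] at h1
    rw [h1, hsn, coeff_sum, Finset.sum_eq_single n]
    · rw [coeff_monomial, if_pos rfl]
    · intro j _ hj
      rw [coeff_monomial, if_neg]
      intro h2
      exact hj (by exact_mod_cast (mul_left_cancel₀ hm.ne' h2).symm)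
    · intro h2
      exact absurd (Finset.mem_range.2 (Nat.lt_succ_self n)) h2
  have hyneg : ∀ i < 0, (Φ y).coeff i = 0 := by
    have h1 := h.coeff_eq_zero (hy 0)
    intro i hi
    have h2 := h1 i (by simpa using hi)
    rwa [show s 0 = 0 from rfl, sub_zero] at h2
  -- The series y carries c shifted to start in degree 0. Multiplication by π^B undoes the shift,
  -- and the twist it causes fixes the values of c since d divides m.
  refine ⟨π ^ B * y, fun i => ?_⟩
  rw [map_mul, h.map_unif_zpow, coeff_monomial_mul, one_mul, ← mul_sub]
  rcases lt_or_ge i B with hi | hi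
  · rw [hyneg _ (mul_neg_of_pos_of_neg hm (by omega)), map_zero, hc i hi]
    rfl
  · obtain ⟨n, hn⟩ : ∃ n : ℕ, i - B = n := ⟨(i - B).toNat, by omega⟩
    rw [hn, hyc, show B + (n : ℤ) = i by omega]
    refine frob_zpow_of_mem_frobFixed (c i).2 (dvd_neg.2 (dvd_mul_of_dvd_left ?_ _))
    exact_mod_cast h.dvd

/-- The centralizer of the image of a normalized embedding. -/
theorem commute_iff {b : Series k Lbar} : (∀ x, Φ x * b = b * Φ x) ↔
    (∀ i, b.coeff i ∈ frobFixed k Lbar m) ∧ ∀ i, ¬ (d : ℤ) ∣ i → b.coeff i = 0 := by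
  constructor
  · intro hb
    refine ⟨fun i => ?_, fun i hi => ?_⟩
    -- Commuting with τ^m fixes the coefficients under x ↦ x^(q^m); commuting with the constants of
    -- F_(q^d) restricts the degrees.
    · have h1 := hb (π ^ (-1 : ℤ))
      rw [h.map_unif_zpow, eq_comm, monomial_mul_comm_iff] at h1
      have h2 := h1 i
      rw [map_one, mul_one, one_mul, mul_neg, mul_one, neg_neg, frob_zpow_natCast_apply] at h2
      exact mem_frobFixed.2 h2.symm
    · by_contra hne
      refine hi (dvd_neg.1 (dvd_of_frob_zpow_eq (k := k) (K := Lbar) h.pos_d fun x hx => ?_))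
      have h1 := hb (T ⟨x, hx⟩)
      rw [h.map_teichmuller, eq_comm, monomial_mul_comm_iff] at h1
      have h2 := h1 i
      rw [neg_zero, zpow_zero, mul_comm] at h2
      exact mul_right_cancel₀ hne h2
  · rintro ⟨hb1, hb2⟩ x
    ext l
    -- After i ↦ l − i the two sums agree term by term: a nonzero term has d ∣ i and m ∣ l − i, and
    -- then both twists are trivial.
    rw [coeff_mul, coeff_mul, ← finsum_comp_equiv (Equiv.subLeft l)]
    refine finsum_congr fun i => ?_
    rw [Equiv.subLeft_apply, sub_sub_cancel]
    by_cases hi : (d : ℤ) ∣ i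
    · by_cases hli : (m : ℤ) ∣ l - i
      · rw [frob_zpow_of_mem_frobFixed (hb1 i) (dvd_neg.2 hli),
          frob_zpow_of_mem_frobFixed (h.coeff_spec x _).1 (dvd_neg.2 hi), mul_comm]
      · rw [(h.coeff_spec x _).2 hli, zero_mul, map_zero, mul_zero]
    · rw [hb2 i hi, map_zero, mul_zero, zero_mul]

/-- The center of the centralizer of the image of a normalized embedding is the image. -/
theorem mem_range_of_commute {b : Series k Lbar} (hb : ∀ x, Φ x * b = b * Φ x)
    (hb' : ∀ c : Series k Lbar, (∀ x, Φ x * c = c * Φ x) → c * b = b * c) : ∃ x, Φ x = b := by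
  obtain ⟨hb1, hb2⟩ := h.commute_iff.1 hb
  have hm := h.pos
  -- The constants of F_(q^m) and τ^d lie in the centralizer. Commuting with the former confines b
  -- to degrees divisible by m; commuting with the latter puts its coefficients in F_(q^d).
  have hbm : ∀ i, ¬ (m : ℤ) ∣ i → b.coeff i = 0 := by
    intro i hi
    by_contra hne
    refine hi (dvd_neg.1 (dvd_of_frob_zpow_eq (k := k) (K := Lbar) hm fun x hx => ?_))
    have h1 := hb' (monomial (frob k Lbar) 0 x) (h.commute_iff.2 ⟨fun i => by
      rw [coeff_monomial]
      split_ifs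
      exacts [hx, zero_mem _], fun i hi => by
      rw [coeff_monomial, if_neg]
      rintro rfl
      exact hi (dvd_zero _)⟩)
    rw [eq_comm, monomial_mul_comm_iff] at h1
    have h2 := h1 i
    rw [neg_zero, zpow_zero, mul_comm] at h2
    exact mul_right_cancel₀ hne h2
  have hbd : ∀ i, b.coeff i ∈ frobFixed k Lbar d := by
    intro i
    have h1 := hb' (monomial (frob k Lbar) (-(d : ℤ)) 1) (h.commute_iff.2 ⟨fun i => by
      rw [coeff_monomial]
      split_ifs
      exacts [one_mem _, zero_mem _], fun i hi => by
      rw [coeff_monomial, if_neg]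
      rintro rfl
      exact hi (dvd_neg.2 dvd_rfl)⟩)
    rw [eq_comm, monomial_mul_comm_iff] at h1
    have h2 := h1 i
    rw [map_one, mul_one, one_mul, neg_neg, frob_zpow_natCast_apply] at h2
    exact mem_frobFixed.2 h2.symm
  obtain ⟨N, hN⟩ := b.bdd
  obtain ⟨x, hx⟩ := h.exists_coeff_eq (fun i => ⟨b.coeff (m * i), hbd _⟩) (B := -|N|) (by
    intro i hi
    refine Subtype.ext (hN _ ?_)
    have : (1 : ℤ) ≤ m := by omega
    nlinarith [neg_abs_le N, abs_nonneg N])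
  refine ⟨x, ?_⟩
  ext i
  by_cases hi : (m : ℤ) ∣ i
  · obtain ⟨j, rfl⟩ := hi
    exact hx j
  · rw [(h.coeff_spec x i).2 hi, hbm i hi]

end IsNormalEmbedding

/-! ### The centralizer as a central division algebra, and its invariant -/

/-- The conjugate `x ↦ u⁻¹ Φ(x) u` of a ring homomorphism. -/
def RingHom.conjUnit {R S : Type*} [Ring R] [Ring S] (Φ : R →+* S) (u : Sˣ) : R →+* S where
  toFun x := ↑u⁻¹ * Φ x * ↑u
  map_one' := by rw [map_one, mul_one, u.inv_mul]
  map_zero' := by rw [map_zero, mul_zero, zero_mul]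
  map_mul' x y := by
    rw [map_mul]
    calc _ = ↑u⁻¹ * Φ x * (↑u * ↑u⁻¹) * Φ y * ↑u := by
          rw [u.mul_inv, mul_one]; simp only [mul_assoc]
      _ = _ := by simp only [mul_assoc]
  map_add' x y := by rw [map_add, mul_add, add_mul]

theorem RingHom.conjUnit_apply {R S : Type*} [Ring R] [Ring S] (Φ : R →+* S) (u : Sˣ) (x : R) :
    Φ.conjUnit u x = ↑u⁻¹ * Φ x * ↑u := rfl

theorem RingHom.mul_conjUnit_apply {R S : Type*} [Ring R] [Ring S] (Φ : R →+* S) (u : Sˣ) (x : R) :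
    ↑u * Φ.conjUnit u x = Φ x * ↑u := by
  rw [conjUnit_apply, ← mul_assoc, ← mul_assoc, u.mul_inv, one_mul]

theorem RingHom.conjUnit_commute_iff {R S : Type*} [Ring R] [Ring S] (Φ : R →+* S) (u : Sˣ) (x : R)
    (b : S) : Φ.conjUnit u x * b = b * Φ.conjUnit u x ↔
      Φ x * (↑u * b * ↑u⁻¹) = ↑u * b * ↑u⁻¹ * Φ x := by
  have h1 : Φ x * (↑u * b * ↑u⁻¹) = ↑u * (Φ.conjUnit u x * b) * ↑u⁻¹ := by
    rw [← mul_assoc, ← mul_assoc, ← Φ.mul_conjUnit_apply, mul_assoc (↑u : S)]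
  have h2 : ↑u * b * ↑u⁻¹ * Φ x = ↑u * (b * Φ.conjUnit u x) * ↑u⁻¹ := by
    rw [conjUnit_apply]
    simp only [mul_assoc, u.mul_inv, mul_one]
  rw [h1, h2, Units.mul_left_inj, Units.mul_right_inj]

section FiniteFieldBasis

variable {k Lbar : Type*} [Field k] [Fintype k] [Field Lbar] [Algebra k Lbar] [IsAlgClosed Lbar]

/-- A basis of the field with `q ^ (n d)` elements over the field with `q ^ d` elements. -/
theorem exists_basis_frobFixed {n d : ℕ} (hn : 0 < n) (hd : 0 < d) : ∃ e : Fin n → Lbar,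
    (∀ i, e i ∈ frobFixed k Lbar (n * d)) ∧
    (∀ c : Fin n → frobFixed k Lbar d, ∑ i, (c i : Lbar) * e i = 0 → ∀ i, c i = 0) ∧
    ∀ b ∈ frobFixed k Lbar (n * d), ∃ c : Fin n → frobFixed k Lbar d,
      ∑ i, (c i : Lbar) * e i = b := by
  let : Algebra (frobFixed k Lbar d) (frobFixed k Lbar (n * d)) :=
    (Subfield.inclusion (frobFixed_le_of_dvd (k := k) (K := Lbar) (dvd_mul_left d n))).toAlgebra
  have hf1 := finite_frobFixed (k := k) (K := Lbar) hd
  have hf2 := finite_frobFixed (k := k) (K := Lbar) (mul_pos hn hd)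
  have hfin : Module.Finite (frobFixed k Lbar d) (frobFixed k Lbar (n * d)) :=
    Module.Finite.of_finite
  have hrank : Module.finrank (frobFixed k Lbar d) (frobFixed k Lbar (n * d)) = n := by
    have h1 := Module.natCard_eq_pow_finrank (K := frobFixed k Lbar d)
      (V := frobFixed k Lbar (n * d))
    rw [natCard_frobFixed hd, natCard_frobFixed (mul_pos hn hd), ← pow_mul] at h1
    have h2 := Nat.pow_right_injective (Fintype.one_lt_card (α := k)) h1
    rw [mul_comm d] at h2
    exact (Nat.eq_of_mul_eq_mul_right hd h2).symm
  let e := Module.finBasisOfFinrankEq (frobFixed k Lbar d) (frobFixed k Lbar (n * d)) hrank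
  have hsum : ∀ c : Fin n → frobFixed k Lbar d,
      ((∑ i, c i • e i : frobFixed k Lbar (n * d)) : Lbar) = ∑ i, (c i : Lbar) * (e i : Lbar) := by
    intro c
    rw [AddSubmonoidClass.coe_finsetSum]
    rfl
  refine ⟨fun i => e i, fun i => (e i).2, fun c hc => ?_, fun b hb => ?_⟩
  · refine Fintype.linearIndependent_iff.1 e.linearIndependent c (Subtype.ext ?_)
    rw [hsum, hc]
    rfl
  · refine ⟨fun i => e.repr ⟨b, hb⟩ i, ?_⟩
    rw [← hsum, e.sum_repr]

end FiniteFieldBasis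

namespace IsNormalEmbedding

open TwistedLaurent

variable {k Lbar : Type*} [Field k] [Fintype k] [Field Lbar] [Algebra k Lbar]
    [IsAlgClosed Lbar] {R : Type*} [Field R] {v : Valuation R ℤᵐ⁰} {Φ : R →+* Series k Lbar}
    {n d : ℕ} {π : R} {T : frobFixed k Lbar d →*₀ R} (h : IsNormalEmbedding v Φ (n * d) d π T)

include h

/-- The image lives in degrees divisible by nd, so of the n shifts by multiples of d exactly one
reaches a given class modulo nd. Linear algebra over R thereby becomes linear algebra over F_(q^d)
in each degree. -/
theorem coeff_sum_mul_monomial {e : Fin n → Lbar} (he : ∀ i, e i ∈ frobFixed k Lbar (n * d))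
    (x : Fin n × Fin n → R) (j : Fin n) (t : ℤ) :
    (∑ p, Φ (x p) * monomial (frob k Lbar) (d * (p.2 : ℕ)) (e p.1)).coeff
      (d * (j : ℕ) + (n * d : ℕ) * t) = ∑ i, (Φ (x (i, j))).coeff ((n * d : ℕ) * t) * e i := by
  have hd : (d : ℤ) ≠ 0 := by exact_mod_cast h.pos_d.ne'
  rw [coeff_sum, Fintype.sum_prod_type]
  refine Finset.sum_congr rfl fun i _ => ?_
  rw [Finset.sum_eq_single j]
  · rw [coeff_mul_monomial, add_sub_cancel_left,
      frob_zpow_of_mem_frobFixed (he i) (dvd_neg.2 (dvd_mul_right _ _))]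
  · intro j' _ hj'
    rw [coeff_mul_monomial, (h.coeff_spec _ _).2, zero_mul]
    rintro ⟨s, hs⟩
    refine hj' (Fin.ext ?_)
    have h1 : (j : ℤ) - (j' : ℕ) = n * (s - t) := by
      refine mul_left_cancel₀ hd ?_
      push_cast at hs
      linear_combination hs
    have hj1 := j.2
    have hj2 := j'.2
    have h2 : |((j : ℕ) : ℤ) - ((j' : ℕ) : ℤ)| < n := by rw [abs_lt]; omega
    have h3 := Int.eq_zero_of_abs_lt_dvd ⟨_, h1⟩ h2
    omega
  · intro hj
    exact absurd (Finset.mem_univ _) hj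

theorem eq_zero_of_sum_eq_zero {e : Fin n → Lbar} (he : ∀ i, e i ∈ frobFixed k Lbar (n * d))
    (hind : ∀ c : Fin n → frobFixed k Lbar d, ∑ i, (c i : Lbar) * e i = 0 → ∀ i, c i = 0)
    (x : Fin n × Fin n → R)
    (hx : ∑ p, Φ (x p) * monomial (frob k Lbar) (d * (p.2 : ℕ)) (e p.1) = 0) (p : Fin n × Fin n) :
    x p = 0 := by
  refine (map_eq_zero_iff Φ Φ.injective).1 ?_
  ext l
  by_cases hl : ((n * d : ℕ) : ℤ) ∣ l
  · obtain ⟨t, rfl⟩ := hl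
    have h1 := h.coeff_sum_mul_monomial he x p.2 t
    rw [hx, coeff_zero] at h1
    exact congrArg Subtype.val
      (hind (fun i => ⟨_, (h.coeff_spec (x (i, p.2)) ((n * d : ℕ) * t)).1⟩) h1.symm p.1)
  · exact (h.coeff_spec _ _).2 hl

theorem exists_sum_eq {e : Fin n → Lbar} (he : ∀ i, e i ∈ frobFixed k Lbar (n * d))
    (hind : ∀ c : Fin n → frobFixed k Lbar d, ∑ i, (c i : Lbar) * e i = 0 → ∀ i, c i = 0)
    (hspan : ∀ b ∈ frobFixed k Lbar (n * d), ∃ c : Fin n → frobFixed k Lbar d,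
      ∑ i, (c i : Lbar) * e i = b)
    {b : Series k Lbar} (hb : ∀ x, Φ x * b = b * Φ x) : ∃ x : Fin n × Fin n → R,
      ∑ p, Φ (x p) * monomial (frob k Lbar) (d * (p.2 : ℕ)) (e p.1) = b := by
  obtain ⟨hb1, hb2⟩ := h.commute_iff.1 hb
  have hnd := h.pos
  have hn : (0 : ℤ) < n := by exact_mod_cast Nat.pos_of_mul_pos_right hnd
  obtain ⟨M, hM⟩ := b.bdd
  choose r hr using fun b : frobFixed k Lbar (n * d) => hspan b b.2
  -- By independence the chosen coordinates of 0 vanish, which keeps the coordinate sequences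
  -- bounded below.
  have hr0 : ∀ i, r 0 i = 0 := hind _ (hr 0)
  have hx : ∀ p : Fin n × Fin n, ∃ x : R, ∀ t, (Φ x).coeff ((n * d : ℕ) * t) =
      r ⟨b.coeff (d * (p.2 : ℕ) + (n * d : ℕ) * t), hb1 _⟩ p.1 := by
    intro p
    refine h.exists_coeff_eq (fun t => r ⟨b.coeff (d * (p.2 : ℕ) + (n * d : ℕ) * t), hb1 _⟩ p.1)
      (B := -(|M| + d * (p.2 : ℕ))) fun t ht => ?_
    have h0 : (⟨b.coeff (d * (p.2 : ℕ) + (n * d : ℕ) * t), hb1 _⟩ : frobFixed k Lbar (n * d)) = 0 :=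
      Subtype.ext (hM _ (by
        have h1 : (1 : ℤ) ≤ (n * d : ℕ) := by exact_mod_cast hnd
        have h2 : (0 : ℤ) ≤ d * (p.2 : ℕ) := by positivity
        nlinarith [neg_abs_le M, abs_nonneg M]))
    rw [h0]
    exact hr0 _
  choose x hx using hx
  refine ⟨x, ?_⟩
  ext l
  by_cases hl : (d : ℤ) ∣ l
  · obtain ⟨s, rfl⟩ := hl
    obtain ⟨j, hj⟩ : ∃ j : Fin n, ((j : ℕ) : ℤ) = s % n := by
      have h1 := Int.emod_nonneg s hn.ne'
      have h2 := Int.emod_lt_of_pos s hn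
      exact ⟨⟨(s % n).toNat, by omega⟩, by simp [h1]⟩
    have hs : (d : ℤ) * s = d * (j : ℕ) + (n * d : ℕ) * (s / n) := by
      have := Int.emod_add_mul_ediv s n
      rw [hj]
      push_cast
      linear_combination (-(d : ℤ)) * this
    rw [hs, h.coeff_sum_mul_monomial he]
    simp only [hx]
    exact hr ⟨b.coeff (d * (j : ℕ) + (n * d : ℕ) * (s / n)), hb1 _⟩
  · rw [hb2 l hl, coeff_sum]
    refine Finset.sum_eq_zero fun p _ => ?_
    rw [coeff_mul_monomial, (h.coeff_spec _ _).2, zero_mul]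
    intro hdvd
    refine hl ((dvd_sub_left (dvd_mul_right (d : ℤ) _)).1 (dvd_trans ?_ hdvd))
    push_cast
    exact dvd_mul_left _ _

end IsNormalEmbedding

namespace IsNormalEmbedding

open TwistedLaurent

variable {k Lbar : Type*} [Field k] [Fintype k] [Field Lbar] [Algebra k Lbar]
    [IsAlgClosed Lbar] {R : Type*} [Field R] {v : Valuation R ℤᵐ⁰} {Φ : R →+* Series k Lbar}
    {u : (Series k Lbar)ˣ} {n d : ℕ} {π : R} {T : frobFixed k Lbar d →*₀ R}
    (h : IsNormalEmbedding v (Φ.conjUnit u) (n * d) d π T)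
    {D : Subring (Series k Lbar)} (hD : ∀ b, b ∈ D ↔ ∀ x, Φ x * b = b * Φ x)

include h

theorem pos_n : 0 < n := Nat.pos_of_mul_pos_right h.pos

include hD

theorem conj_monomial_mem (j : ℤ) {e : Lbar} (he : e ∈ frobFixed k Lbar (n * d)) :
    ↑u * monomial (frob k Lbar) (d * j) e * ↑u⁻¹ ∈ D := by
  refine (hD _).2 fun x => (Φ.conjUnit_commute_iff u x _).1 ?_
  revert x
  refine h.commute_iff.2 ⟨fun i => ?_, fun i hi => ?_⟩
  · rw [coeff_monomial]
    split_ifs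
    exacts [he, zero_mem _]
  · rw [coeff_monomial, if_neg]
    rintro rfl
    exact hi (dvd_mul_right _ _)

variable [Algebra R D] (halg : ∀ x, ((algebraMap R D x : D) : Series k Lbar) = Φ x)

include halg

/-- The basis is u e_i τ^(−dj) u⁻¹ with 0 ≤ j < n and e_i a basis of F_(q^(nd)) over F_(q^d). -/
theorem exists_basis_centralizer : Nonempty (Module.Basis (Fin n × Fin n) R D) := by
  obtain ⟨e, he, hind, hspan⟩ := exists_basis_frobFixed (k := k) (Lbar := Lbar) h.pos_n h.pos_d
  let B : Fin n × Fin n → D := fun p => ⟨_, h.conj_monomial_mem hD ((p.2 : ℕ) : ℤ) (he p.1)⟩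
  have hsum : ∀ x : Fin n × Fin n → R, ((∑ p, x p • B p : D) : Series k Lbar) =
      ↑u * (∑ p, Φ.conjUnit u (x p) * monomial (frob k Lbar) (d * (p.2 : ℕ)) (e p.1)) * ↑u⁻¹ := by
    intro x
    rw [AddSubmonoidClass.coe_finsetSum, Finset.mul_sum, Finset.sum_mul]
    refine Finset.sum_congr rfl fun p _ => ?_
    rw [Algebra.smul_def, Subring.coe_mul, halg, ← mul_assoc (↑u : Series k Lbar),
      Φ.mul_conjUnit_apply]
    simp only [B, mul_assoc]
  refine ⟨Module.Basis.mk (v := B) ?_ ?_⟩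
  · refine Fintype.linearIndependent_iff.2 fun x hx => ?_
    refine h.eq_zero_of_sum_eq_zero he hind x ?_
    have h1 := hsum x
    rw [hx, Subring.coe_zero, eq_comm, Units.mul_left_eq_zero, Units.mul_right_eq_zero] at h1
    exact h1
  · rintro ⟨b, hb⟩ -
    obtain ⟨x, hx⟩ := h.exists_sum_eq he hind hspan (b := ↑u⁻¹ * b * ↑u) fun x => by
      rw [Φ.conjUnit_commute_iff]
      have h1 : ↑u * (↑u⁻¹ * b * ↑u) * ↑u⁻¹ = b := by simp [mul_assoc]
      rw [h1]
      exact (hD b).1 hb x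
    have h2 : (⟨b, hb⟩ : D) = ∑ p, x p • B p := by
      refine Subtype.ext ?_
      rw [hsum, hx]
      simp [mul_assoc]
    rw [h2]
    exact Submodule.sum_mem _ fun p _ => Submodule.smul_mem _ _ (Submodule.subset_span ⟨p, rfl⟩)

/-- Conjugation by u reduces the centre to `mem_range_of_commute`; inverses taken in the skew field
of series still commute with the image. -/
theorem isCentralDivisionAlgebra : IsCentralDivisionAlgebra R D where
  central := by
    refine ⟨fun b hb => ?_⟩
    rw [Subalgebra.mem_center_iff] at hb
    have hconj : ∀ c : Series k Lbar, ↑u * (↑u⁻¹ * c * ↑u) * ↑u⁻¹ = c := fun c => by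
      simp [mul_assoc]
    obtain ⟨x, hx⟩ := h.mem_range_of_commute (b := ↑u⁻¹ * (b : Series k Lbar) * ↑u)
      (fun x => by
        rw [Φ.conjUnit_commute_iff, hconj]
        exact (hD b).1 b.2 x)
      (fun c hc => by
        have h1 : ↑u * c * ↑u⁻¹ ∈ D := (hD _).2 fun x => (Φ.conjUnit_commute_iff u x c).1 (hc x)
        have h2 : ↑u * c * ↑u⁻¹ * (b : Series k Lbar) = b * (↑u * c * ↑u⁻¹) :=
          congrArg Subtype.val (hb ⟨_, h1⟩)
        calc c * (↑u⁻¹ * b * ↑u) = ↑u⁻¹ * (↑u * c * ↑u⁻¹ * b) * ↑u := by simp [mul_assoc]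
          _ = ↑u⁻¹ * b * ↑u * c := by rw [h2]; simp [mul_assoc])
    refine Algebra.mem_bot.2 ⟨x, Subtype.ext ?_⟩
    rw [halg, ← hconj b, ← hx, Φ.mul_conjUnit_apply, mul_assoc, u.mul_inv, mul_one]
  finite := by
    obtain ⟨B⟩ := h.exists_basis_centralizer hD halg
    exact Module.Finite.of_basis B
  nontrivial := inferInstance
  isUnit b hb := by
    obtain ⟨y, hy⟩ := isUnit_of_ne_zero (fun h0 => hb (Subtype.ext h0) : (b : Series k Lbar) ≠ 0)
    have h1 : (↑y⁻¹ : Series k Lbar) ∈ D := (hD _).2 fun x =>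
      Commute.units_inv_right (u := y) (show Φ x * y = y * Φ x from hy ▸ (hD b).1 b.2 x)
    refine ⟨⟨b, ⟨_, h1⟩, Subtype.ext ?_, Subtype.ext ?_⟩, rfl⟩
    · change (b : Series k Lbar) * ↑y⁻¹ = 1
      rw [← hy, y.mul_inv]
    · change ↑y⁻¹ * (b : Series k Lbar) = 1
      rw [← hy, y.inv_mul]

/-- Take ζ = u z u⁻¹ with z a generator of F_(q^(nd))^×, and γ = u τ^d u⁻¹. Then γ^n = π⁻¹ has norm
π^(−n²), so the norm of γ has order −n, and division by n² gives −1/n exactly. -/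
theorem hasInvariant : HasInvariant v D (-1 / (n : ℚ)) := by
  obtain ⟨B⟩ := h.exists_basis_centralizer hD halg
  have hn := h.pos_n
  have hrank : Module.finrank R D = n ^ 2 := by
    rw [Module.finrank_eq_card_basis B, Fintype.card_prod, Fintype.card_fin, sq]
  have hfin := finite_frobFixed (k := k) (K := Lbar) (mul_pos hn h.pos_d)
  let f : frobFixed k Lbar (n * d) →* D :=
    { toFun := fun z => ⟨↑u * monomial (frob k Lbar) (d * 0) (z : Lbar) * ↑u⁻¹,
        h.conj_monomial_mem hD 0 z.2⟩
      map_one' := Subtype.ext (by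
        change ↑u * monomial (frob k Lbar) (d * 0) 1 * ↑u⁻¹ = 1
        rw [mul_zero]
        exact (congrArg (· * _) (mul_one _)).trans u.mul_inv)
      map_mul' := fun a b => Subtype.ext (by
        change ↑u * monomial (frob k Lbar) (d * 0) ((a : Lbar) * b) * ↑u⁻¹ =
          ↑u * monomial (frob k Lbar) (d * 0) (a : Lbar) * ↑u⁻¹ *
            (↑u * monomial (frob k Lbar) (d * 0) (b : Lbar) * ↑u⁻¹)
        rw [mul_zero, ← monomial_zero_mul_monomial_zero]
        simp [mul_assoc]) }
  have hf : ∀ z, ((f z : D) : Series k Lbar) = ↑u * monomial (frob k Lbar) 0 (z : Lbar) * ↑u⁻¹ :=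
    fun z => by
      change ↑u * monomial (frob k Lbar) (d * 0) (z : Lbar) * ↑u⁻¹ = _
      rw [mul_zero]
  have hfinj : Function.Injective f := fun a b hab => by
    have h1 := congrArg Subtype.val hab
    rw [hf, hf, Units.mul_left_inj, Units.mul_right_inj] at h1
    have h2 := congrArg (fun s => coeff s 0) h1
    simp only [coeff_monomial, if_true] at h2
    exact Subtype.ext h2
  obtain ⟨z, hz⟩ := IsCyclic.exists_generator (α := (frobFixed k Lbar (n * d))ˣ)
  have hg : ∀ j : ℤ, ((u * tau (frob k Lbar) ^ (-((d : ℤ) * j)) * u⁻¹ : (Series k Lbar)ˣ) :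
      Series k Lbar) = ↑u * monomial (frob k Lbar) (d * j) 1 * ↑u⁻¹ := fun j => by
    rw [Units.val_mul, Units.val_mul, tau_zpow, neg_neg]
  have hgD : ∀ j : ℤ, ((u * tau (frob k Lbar) ^ (-((d : ℤ) * j)) * u⁻¹ : (Series k Lbar)ˣ) :
      Series k Lbar) ∈ D := fun j => by
    rw [hg]
    exact h.conj_monomial_mem hD j (one_mem _)
  have hgg : ∀ i j : ℤ, i + j = 0 →
      ((u * tau (frob k Lbar) ^ i * u⁻¹ : (Series k Lbar)ˣ) : Series k Lbar) *
        ((u * tau (frob k Lbar) ^ j * u⁻¹ : (Series k Lbar)ˣ) : Series k Lbar) = 1 := by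
    intro i j hij
    rw [← Units.val_mul, ← Units.val_one, conj_mul, ← zpow_add, hij, zpow_zero, mul_one,
      mul_inv_cancel]
  let γ : Dˣ := ⟨⟨_, hgD (-1)⟩, ⟨_, hgD 1⟩, Subtype.ext (hgg _ _ (by ring)),
    Subtype.ext (hgg _ _ (by ring))⟩
  have hγ : ((γ : D) : Series k Lbar) = ↑u * monomial (frob k Lbar) (-d) 1 * ↑u⁻¹ := by
    rw [show (-d : ℤ) = d * (-1) by ring]
    exact hg (-1)
  have hγn : (γ : D) ^ n = algebraMap R D π⁻¹ := by
    refine Subtype.ext ?_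
    rw [halg, Subring.coe_pow]
    change ((u * tau (frob k Lbar) ^ (-((d : ℤ) * -1)) * u⁻¹ : (Series k Lbar)ˣ) :
      Series k Lbar) ^ n = _
    have h1 := h.map_unif_zpow (-1)
    rw [zpow_neg_one] at h1
    rw [← Units.val_pow_eq_pow_val, conj_pow, ← zpow_natCast, ← zpow_mul, Units.val_mul,
      Units.val_mul, tau_zpow,
      show -(-((d : ℤ) * -1) * (n : ℤ)) = ((n * d : ℕ) : ℤ) * -1 by push_cast; ring, ← h1,
      Φ.mul_conjUnit_apply, mul_assoc, u.mul_inv, mul_one]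
  refine ⟨n, hn, hrank, Units.map f z, γ, ?_, ?_, 0, ?_⟩
  · rw [orderOf_injective (Units.map f) (Units.map_injective hfinj),
      orderOf_eq_card_of_forall_mem_zpowers hz, h.card, ← pow_mul, mul_comm d,
      ← natCard_frobFixed (k := k) (K := Lbar) (mul_pos hn h.pos_d), Nat.card_units]
  · rw [mul_inv_eq_iff_eq_mul]
    refine Units.ext (Subtype.ext ?_)
    rw [← map_pow]
    change ((γ : D) : Series k Lbar) * ((f z : D) : Series k Lbar) =
      ((f ((z ^ _ : (frobFixed k Lbar (n * d))ˣ) : frobFixed k Lbar (n * d)) : D) : Series k Lbar) *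
        ((γ : D) : Series k Lbar)
    rw [hf, hf, hγ, h.card, Units.val_pow_eq_pow_val, SubmonoidClass.coe_pow]
    have h1 : monomial (frob k Lbar) (-d) 1 * monomial (frob k Lbar) 0 (z : Lbar) =
        monomial (frob k Lbar) 0 ((z : Lbar) ^ Fintype.card k ^ d) *
          monomial (frob k Lbar) (-d) 1 := by
      rw [monomial_mul_monomial, monomial_mul_monomial, add_zero, zero_add, one_mul, neg_neg,
        frob_zpow_natCast_apply, map_one, mul_one]
    calc _ = ↑u * (monomial (frob k Lbar) (-d) 1 * monomial (frob k Lbar) 0 (z : Lbar)) * ↑u⁻¹ := by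
          simp [mul_assoc]
      _ = _ := by rw [h1]; simp [mul_assoc]
  · have h1 := congrArg (Algebra.norm R) hγn
    rw [map_pow, Algebra.norm_algebraMap, hrank] at h1
    have h2 : ∀ (x : R) (i : ℕ), addOrd v (x ^ i) = i * addOrd v x := fun x i => by
      simp [addOrd]
    have h3 : addOrd v π⁻¹ = -1 := by
      rw [← h.addOrd_unif]
      simp [addOrd]
    have h4 := congrArg (addOrd v) h1
    rw [h2, h2, h3] at h4
    have hn' : (n : ℚ) ≠ 0 := by exact_mod_cast hn.ne'
    have h5 : (addOrd v (Algebra.norm R (γ : D)) : ℚ) = -n := by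
      refine mul_left_cancel₀ hn' ?_
      have h6 : (n : ℚ) * (addOrd v (Algebra.norm R (γ : D)) : ℚ) = (n : ℚ) ^ 2 * (-1) := by
        exact_mod_cast h4
      linear_combination h6
    rw [hrank, h5]
    push_cast
    field_simp
    ring

end IsNormalEmbedding

/-! ### Existence and uniqueness of the rank and of the extension to F_∞ -/

theorem Place.compl_induction {F : Type*} [Field F] (v : Place F) {p : v.Compl → Prop}
    (hp : IsClosed {x | p x}) (h : ∀ f, p (v.embed f)) (x : v.Compl) : p x :=
  (UniformSpace.Completion.denseRange_coe (α := WithVal v.val)).induction_on x hp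
    fun z => h z.ofVal

theorem IsLocalEmbedding.continuous {k Lbar : Type*} [Field k] [Fintype k] [Field Lbar]
    [Algebra k Lbar] [IsAlgClosed Lbar] {F : Type*} [Field F] {v : Place F}
    {Φ : v.Compl →+* Series k Lbar} {m : ℕ} (h : IsLocalEmbedding v.complVal Φ m) :
    Continuous Φ :=
  Place.continuous_of_isOrd (R := v.Compl) v.complVal_surjective Φ h.pos h.isOrd

namespace DrinfeldModule

set_option linter.unusedSectionVars false

open TwistedLaurent

variable {k F : Type*} [Field k] [Fintype k] [Field F] [Algebra k F]
    [Algebra k⟮X⟯ F] [IsScalarTower k k⟮X⟯ F] [FunctionField k F] {infty : Place F}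
    {L Lbar : Type*} [Field L] [Algebra k L] [Field Lbar] [Algebra L Lbar] [Algebra k Lbar]
    [IsScalarTower k L Lbar] [IsAlgClosed Lbar] (φ : DrinfeldModule k F infty L Lbar)

include φ in
theorem exists_mul_eq (f : F) : ∃ a b : infty.regularAway, b ≠ 0 ∧ (b : F) * f = a := by
  have := φ.isFractionRing
  obtain ⟨⟨a, b⟩, hab⟩ := IsLocalization.surj (nonZeroDivisors infty.regularAway) f
  refine ⟨a, b, nonZeroDivisors.ne_zero b.2, ?_⟩
  rw [mul_comm]
  exact hab

theorem exists_isLocalEmbedding : ∃ (Φ : infty.Compl →+* Series k Lbar) (m : ℕ),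
    IsLocalEmbedding infty.complVal Φ m ∧ ∀ a : infty.regularAway, Φ (infty.embed a) = φ.app a := by
  obtain ⟨Φ₀, m, hm, happ, hord⟩ := φ.exists_extension_functionField
  obtain ⟨Φ, -, hΦ, hΦo⟩ := infty.exists_extension_compl Φ₀ hm hord
  exact ⟨Φ, m, ⟨infty.complVal_surjective, infty.exists_complVal_limit, hm, hΦo⟩,
    fun a => (hΦ a).trans (happ a)⟩

section

variable {φ} {Φ : infty.Compl →+* Series k Lbar} {m : ℕ}
  (h : IsLocalEmbedding infty.complVal Φ m)
  (happ : ∀ a : infty.regularAway, Φ (infty.embed a) = φ.app a)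

include h happ

theorem isOrd_app {a : infty.regularAway} (ha : a ≠ 0) :
    (φ.app a).IsOrd (m * addOrd infty.val (a : F)) := by
  rw [← happ, ← infty.addOrd_complVal_embed]
  exact h.isOrd _ ((map_ne_zero infty.embed).2 fun h0 => ha (Subtype.ext h0))

theorem degree_spec : 0 < infty.degree k ∧
    Nat.card (IsLocalRing.ResidueField infty.complVal.valuationSubring) =
      Fintype.card k ^ infty.degree k ∧ infty.degree k ∣ m :=
  h.residueDegree_spec (infty.embed.comp (algebraMap k F))

/-- One element a with ord_∞(a) ≠ 0 determines the factor of proportionality. -/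
theorem hasRank_iff {n : ℕ} : φ.HasRank n ↔ n * infty.degree k = m := by
  constructor
  · intro hn
    obtain ⟨a, r, hr, ha⟩ := φ.exists_app_isOrd_neg
    have ha0 : a ≠ 0 := by
      rintro rfl
      exact ha.ne_zero (map_zero φ.appHom)
    have h1 := (isOrd_app h happ ha0).unique ha
    have h2 := (ord_eq_iff.1 (hn.2 a ha0)).unique ha
    have h3 : addOrd infty.val (a : F) ≠ 0 := by
      intro h0
      rw [h0] at h1
      omega
    exact_mod_cast mul_right_cancel₀ h3 (h2.trans h1.symm)
  · rintro rfl
    refine ⟨Nat.pos_of_mul_pos_right h.pos, fun a ha => ord_eq_iff.2 ?_⟩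
    have := isOrd_app h happ ha
    push_cast at this
    exact this

/-- The condition is closed, so by density x may be taken in F. Then the image solves φ_b w = φ_a,
whose leading equation b_N θ^(−N)(x) = c stays in L^perf, a field stable under the Frobenius and its
inverse. -/
theorem coeffsIn_perfectClosure (x : infty.Compl) :
    (Φ x).CoeffsIn (perfectClosure L Lbar : Set Lbar) := by
  refine infty.compl_induction (p := fun x => (Φ x).CoeffsIn (perfectClosure L Lbar : Set Lbar))
    ((isClosed_coeffsIn _).preimage h.continuous) (fun f => ?_) x
  obtain ⟨a, b, hb, hab⟩ := φ.exists_mul_eq f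
  have hL : ∀ (a : infty.regularAway) (i : ℤ), (φ.app a).coeff i ∈ perfectClosure L Lbar := by
    intro a i
    obtain ⟨y, hy⟩ := (φ.toRingHom a).2.1 i
    change ((φ.toRingHom a : twistedPoly k L Lbar) : Series k Lbar).coeff i ∈ _
    rw [← hy]
    exact IntermediateField.algebraMap_mem _ _
  have hbo := isOrd_app h happ hb
  refine coeffsIn_of_mul_sub_mul (N := m * addOrd infty.val (b : F))
    (perfectClosure L Lbar).toSubfield.toSubring.toAddSubgroup (φ.app b) 0 _ hbo.1
    (fun _ _ => rfl) (fun i x hx => ?_) (fun s i x hx => ?_) ?_ (fun s x hx => ?_)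
  · exact (perfectClosure L Lbar).mul_mem (hL b i) (frob_zpow_mem_perfectClosure (k := k) (L := L) _ hx)
  · rw [coeff_zero, map_zero, mul_zero]
    exact zero_mem _
  · rw [mul_zero, sub_zero, ← happ, ← map_mul, ← map_mul, hab, happ]
    exact hL a
  · rw [coeff_zero, map_zero, mul_zero, sub_zero] at hx
    have h1 : (frob k Lbar ^ (-(m * addOrd infty.val (b : F)))) x ∈ perfectClosure L Lbar := by
      have := mul_mem (inv_mem (hL b (m * addOrd infty.val (b : F)))) hx
      rwa [inv_mul_cancel_left₀ hbo.2] at this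
    have h2 := frob_zpow_mem_perfectClosure (k := k) (L := L) (m * addOrd infty.val (b : F)) h1
    rwa [← RingAut.mul_apply, ← zpow_add, add_neg_cancel, zpow_zero] at h2

/-- Commuting with A extends to fractions by cancelling φ_a, and to F_∞ by continuity. -/
theorem mem_centralizer_iff (b : Series k Lbar) :
    b ∈ φ.centralizer ↔ ∀ x, Φ x * b = b * Φ x := by
  rw [centralizer, Subring.mem_centralizer_iff]
  constructor
  · intro hb x
    refine infty.compl_induction (p := fun x => Φ x * b = b * Φ x)
      (isClosed_eq (h.continuous.mul continuous_const) (continuous_const.mul h.continuous))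
      (fun f => ?_) x
    obtain ⟨c, a, ha, hac⟩ := φ.exists_mul_eq f
    refine mul_left_cancel₀ (φ.app_ne_zero ha) ?_
    have hf : φ.app a * Φ (infty.embed f) = φ.app c := by
      rw [← happ, ← map_mul, ← map_mul, hac, happ]
    rw [← mul_assoc, hf, ← mul_assoc, hb _ ⟨a, rfl⟩, mul_assoc, hf, hb _ ⟨c, rfl⟩]
  · rintro hb _ ⟨a, rfl⟩
    rw [← happ]
    exact hb _

end

theorem existsUnique_hasRank : ∃! n, φ.HasRank n := by
  obtain ⟨Φ, m, h, happ⟩ := φ.exists_isLocalEmbedding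
  obtain ⟨hd, -, n, hn⟩ := degree_spec h happ
  refine ⟨n, (hasRank_iff h happ).2 (by rw [hn, mul_comm]), fun n' hn' => ?_⟩
  refine Nat.eq_of_mul_eq_mul_right hd ?_
  rw [(hasRank_iff h happ).1 hn', hn, mul_comm]

variable {φ} in
theorem IsExtension.isLocalEmbedding {n : ℕ} (hn : φ.HasRank n)
    {Φ : infty.Compl →+* Series k Lbar} (hΦ : φ.IsExtension n Φ) :
    IsLocalEmbedding infty.complVal Φ (n * infty.degree k) where
  surj := infty.complVal_surjective
  complete := infty.exists_complVal_limit
  pos := by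
    obtain ⟨Φ, m, h, happ⟩ := φ.exists_isLocalEmbedding
    rw [(hasRank_iff h happ).1 hn]
    exact h.pos
  isOrd x hx := by
    have := ord_eq_iff.1 (hΦ.ord_eq x hx)
    push_cast
    exact this

theorem existsUnique_isExtension {n : ℕ} (hn : φ.HasRank n) :
    ∃! Φ : infty.Compl →+* Series k Lbar, φ.IsExtension n Φ := by
  obtain ⟨Φ, m, h, happ⟩ := φ.exists_isLocalEmbedding
  refine ⟨Φ, ⟨happ, coeffsIn_perfectClosure h happ, fun x hx => ord_eq_iff.2 ?_⟩, ?_⟩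
  · have := h.isOrd x hx
    rw [← (hasRank_iff h happ).1 hn] at this
    push_cast at this
    exact this
  · intro Φ' hΦ'
    -- The prescribed orders force continuity, so agreement on A gives agreement on F and then on
    -- F_∞.
    refine infty.ringHom_ext_compl (hΦ'.isLocalEmbedding hn).continuous h.continuous fun f => ?_
    obtain ⟨a, b, hb, hab⟩ := φ.exists_mul_eq f
    refine mul_left_cancel₀ (φ.app_ne_zero hb) ?_
    rw [← happ, ← map_mul, ← map_mul, hab, happ, happ, ← hΦ'.extends_app, ← map_mul, ← map_mul,
      hab, hΦ'.extends_app]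

end DrinfeldModule

/-! ### Fields of coefficients of intertwining series -/

section Descent

open TwistedLaurent

variable {k L Lbar : Type*} [Field k] [Fintype k] [Field L] [Algebra k L] [Field Lbar]
    [Algebra L Lbar] [Algebra k Lbar] [IsScalarTower k L Lbar] [IsAlgClosed Lbar]

/-- A series that intertwines two series of negative order over `k̄` has coefficients in `k̄`. -/
theorem coeffsIn_algebraicClosure_of_mul_eq {f g w : Series k Lbar} {r : ℕ} (hr : 0 < r)
    (hf : f.IsOrd (-(r : ℤ))) (hg : g.IsOrd (-(r : ℤ)))
    (hfk : f.CoeffsIn (algebraicClosure k Lbar : Set Lbar))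
    (hgk : g.CoeffsIn (algebraicClosure k Lbar : Set Lbar)) (hw : f * w = w * g) :
    w.CoeffsIn (algebraicClosure k Lbar : Set Lbar) := by
  refine coeffsIn_of_mul_sub_mul (algebraicClosure k Lbar).toSubfield.toSubring.toAddSubgroup
    f g w hf.1 hg.1 (fun i x hx => ?_) (fun s i x hx => ?_) (fun i => ?_) fun s x hx => ?_
  · exact (algebraicClosure k Lbar).mul_mem (hfk i) (frob_zpow_mem_algebraicClosure _ hx)
  · exact (algebraicClosure k Lbar).mul_mem hx (frob_zpow_mem_algebraicClosure _ (hgk i))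
  · rw [hw, sub_self]
    exact (algebraicClosure k Lbar).zero_mem
  · rw [neg_neg, frob_zpow_natCast_apply] at hx
    exact mem_algebraicClosure_of_frobTrinomial hr hf.2 (hfk _)
      (frob_zpow_mem_algebraicClosure _ (hgk _)) hx

/-- A series that intertwines a twisted polynomial over `L` of positive degree and a series over
`k̄` has coefficients in `L^sep`. -/
theorem coeffsIn_separableClosure_of_mul_eq {f g w : Series k Lbar} {r : ℕ} (hr : 0 < r)
    (hf : f.IsOrd (-(r : ℤ))) (hg : g.IsOrd (-(r : ℤ))) (hfL : f ∈ twistedPoly k L Lbar)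
    (hgk : g.CoeffsIn (algebraicClosure k Lbar : Set Lbar)) (hw : f * w = w * g) :
    w.CoeffsIn (separableClosure L Lbar : Set Lbar) := by
  have hfs : ∀ i, f.coeff i ∈ separableClosure L Lbar := fun i => by
    obtain ⟨y, hy⟩ := hfL.1 i
    rw [← hy]
    exact IntermediateField.algebraMap_mem _ _
  have hgs : ∀ s i : ℤ, (frob k Lbar ^ s) (g.coeff i) ∈ separableClosure L Lbar := fun s i =>
    algebraicClosure_le_separableClosure (k := k) (frob_zpow_mem_algebraicClosure _ (hgk i))
  refine coeffsIn_of_mul_sub_mul (separableClosure L Lbar).toSubfield.toSubring.toAddSubgroup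
    f g w hf.1 hg.1 (fun i x hx => ?_) (fun s i x hx => ?_) (fun i => ?_) fun s x hx => ?_
  -- L^sep need not contain q-th roots of its elements. As f is a polynomial in τ, only nonnegative
  -- powers of the Frobenius are applied to the coefficients of w.
  · rcases lt_or_ge 0 i with hi | hi
    · rw [hfL.2 i hi, zero_mul]
      exact (separableClosure L Lbar).zero_mem
    · obtain ⟨j, hj⟩ := Int.eq_ofNat_of_zero_le (show 0 ≤ -i by omega)
      rw [hj, frob_zpow_natCast_apply]
      have hx' : x ∈ separableClosure L Lbar := hx
      exact (separableClosure L Lbar).mul_mem (hfs i) (pow_mem hx' _)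
  · exact (separableClosure L Lbar).mul_mem hx (hgs _ i)
  · rw [hw, sub_self]
    exact (separableClosure L Lbar).zero_mem
  · rw [neg_neg, frob_zpow_natCast_apply] at hx
    exact mem_separableClosure_of_frobTrinomial hr
      ((map_ne_zero_iff _ (RingEquiv.injective _)).2 hg.2) (hfs _) (hgs _ _) hx

end Descent

/-! ### The degree, the topology of the Weil group, and its action on series -/

namespace WeilGroup

open TwistedLaurent

variable {k L Lbar : Type*} [Field k] [Fintype k] [Field L] [Algebra k L] [Field Lbar]
    [Algebra L Lbar] [Algebra k Lbar] [IsScalarTower k L Lbar] [IsAlgClosed Lbar]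

theorem toGal_apply_eq (σ : WeilGroup k L Lbar) (x : separableClosure L Lbar)
    (hx : (x : Lbar) ∈ algebraicClosure k Lbar) :
    (σ.toGal x : Lbar) = (frob k Lbar ^ σ.deg) (x : Lbar) :=
  Classical.choose_spec (σ : weilSubgroup k L Lbar).2 x hx

theorem deg_eq_of_actsAsFrobPow {σ : WeilGroup k L Lbar} {d : ℤ}
    (hd : ActsAsFrobPow k L Lbar σ.toGal d) : σ.deg = d := by
  have h : ∀ x ∈ algebraicClosure k Lbar, (frob k Lbar ^ (σ.deg - d)) x = x := fun x hx => by
    have h1 := frob_zpow_mem_algebraicClosure (-d) hx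
    have h2 := hd ⟨_, algebraicClosure_le_separableClosure (L := L) (k := k) h1⟩ h1
    rw [toGal_apply_eq σ _ h1] at h2
    simp only [frob_zpow_apply_zpow_apply] at h2
    rwa [← sub_eq_add_neg, add_neg_cancel, zpow_zero] at h2
  -- The Frobenius has infinite order on k̄: a finite field of degree exceeding the absolute value
  -- of the exponent forces the exponent to be 0.
  have h1 := dvd_of_frob_zpow_eq (k := k) (K := Lbar) (d := (σ.deg - d).natAbs + 1)
    (Nat.succ_pos _) fun x hx => h x (frobFixed_le_algebraicClosure (Nat.succ_pos _) hx)
  have h2 := Int.eq_zero_of_abs_lt_dvd h1 (by rw [Int.abs_eq_natAbs]; omega)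
  omega

theorem deg_mul (σ τ : WeilGroup k L Lbar) : (σ * τ).deg = σ.deg + τ.deg := by
  refine deg_eq_of_actsAsFrobPow fun x hx => ?_
  rw [← frob_zpow_apply_zpow_apply, ← toGal_apply_eq τ x hx]
  exact toGal_apply_eq σ _ (galSep_mem_algebraicClosure x hx)

theorem deg_one : (1 : WeilGroup k L Lbar).deg = 0 :=
  deg_eq_of_actsAsFrobPow fun _ _ => rfl

theorem deg_inv (σ : WeilGroup k L Lbar) : σ⁻¹.deg = -σ.deg := by
  have := deg_mul σ σ⁻¹
  rw [mul_inv_cancel, deg_one] at this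
  omega

theorem continuous_toGal_deg :
    Continuous fun σ : WeilGroup k L Lbar => (σ.toGal, σ.deg) :=
  continuous_induced_dom

theorem continuous_deg : Continuous (deg : WeilGroup k L Lbar → ℤ) :=
  continuous_snd.comp continuous_toGal_deg

theorem continuous_toGal : Continuous (toGal : WeilGroup k L Lbar → GalSep L Lbar) :=
  continuous_fst.comp continuous_toGal_deg

theorem continuous_inv : Continuous fun σ : WeilGroup k L Lbar => σ⁻¹ := by
  refine continuous_induced_rng.2 (Continuous.prodMk ?_ ?_)
  · exact continuous_toGal.inv
  · refine (continuous_deg.neg).congr fun σ => (deg_inv σ).symm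

theorem eventually_toGal_apply_eq (σ : WeilGroup k L Lbar) (x : separableClosure L Lbar) :
    ∀ᶠ τ in nhds σ, τ.toGal x = σ.toGal x := by
  have h1 : IsOpen (MulAction.stabilizer (GalSep L Lbar) x : Set (GalSep L Lbar)) :=
    stabilizer_isOpen_of_isIntegral x
  have h2 : Continuous fun τ : WeilGroup k L Lbar => σ.toGal⁻¹ * τ.toGal :=
    continuous_const.mul continuous_toGal
  have h3 := (h1.preimage h2).mem_nhds (x := σ) (by
    change σ.toGal⁻¹ * σ.toGal ∈ MulAction.stabilizer _ x
    rw [inv_mul_cancel]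
    exact one_mem _)
  filter_upwards [h3] with τ hτ
  have h4 : (σ.toGal⁻¹ * τ.toGal) • x = x := hτ
  rw [mul_smul, inv_smul_eq_iff] at h4
  exact h4

variable [Algebra.IsAlgebraic L Lbar]

theorem normal_of_isAlgClosed : Normal L Lbar :=
  have : IsAlgClosure L Lbar := ⟨inferInstance, inferInstance⟩
  IsAlgClosure.normal L Lbar

/-- An extension of an element of the Weil group to an automorphism of `L̄`. -/
noncomputable def lift (σ : WeilGroup k L Lbar) : Lbar ≃ₐ[L] Lbar :=
  have : Normal L Lbar := normal_of_isAlgClosed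
  σ.toGal.liftNormal Lbar

theorem lift_apply (σ : WeilGroup k L Lbar) (x : separableClosure L Lbar) :
    σ.lift x = σ.toGal x :=
  have : Normal L Lbar := normal_of_isAlgClosed
  σ.toGal.liftNormal_commutes Lbar x

theorem lift_apply_of_mem (σ : WeilGroup k L Lbar) {x : Lbar}
    (hx : x ∈ algebraicClosure k Lbar) : σ.lift x = (frob k Lbar ^ σ.deg) x :=
  (σ.lift_apply ⟨x, algebraicClosure_le_separableClosure (L := L) (k := k) hx⟩).trans
    (toGal_apply_eq σ _ hx)

/-- The coefficientwise action of an element of the Weil group on all series, through a chosen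
extension to `L̄`. -/
noncomputable def seriesEquiv (σ : WeilGroup k L Lbar) : Series k Lbar ≃+* Series k Lbar :=
  TwistedLaurent.map σ.lift.toRingEquiv (commute_frob _)

theorem coeff_seriesEquiv (σ : WeilGroup k L Lbar) (f : Series k Lbar) (i : ℤ) :
    (σ.seriesEquiv f).coeff i = σ.lift (f.coeff i) := rfl

theorem act_eq_seriesEquiv (σ : WeilGroup k L Lbar) (f : Series k Lbar)
    (hf : f.CoeffsIn (separableClosure L Lbar : Set Lbar)) : σ.act f hf = σ.seriesEquiv f := by
  ext i
  exact (σ.lift_apply ⟨f.coeff i, hf i⟩).symm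

theorem seriesEquiv_of_mem_twistedPoly (σ : WeilGroup k L Lbar) {f : Series k Lbar}
    (hf : f ∈ twistedPoly k L Lbar) : σ.seriesEquiv f = f := by
  ext i
  obtain ⟨y, hy⟩ := hf.1 i
  rw [coeff_seriesEquiv, ← hy, σ.lift.commutes]

/-- On k̄ the action of σ is the power deg σ of the Frobenius, which is conjugation by τ^(deg σ). -/
theorem seriesEquiv_mul_tau (σ : WeilGroup k L Lbar) {f : Series k Lbar}
    (hf : f.CoeffsIn (algebraicClosure k Lbar : Set Lbar)) :
    σ.seriesEquiv f * ↑(tau (frob k Lbar) ^ σ.deg) = ↑(tau (frob k Lbar) ^ σ.deg) * f := by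
  ext i
  rw [tau_zpow, coeff_mul_monomial, coeff_monomial_mul, map_one, mul_one, one_mul,
    coeff_seriesEquiv, lift_apply_of_mem _ (hf _), neg_neg]

theorem coeffsIn_seriesEquiv (σ : WeilGroup k L Lbar) {f : Series k Lbar}
    (hf : f.CoeffsIn (algebraicClosure k Lbar : Set Lbar)) :
    (σ.seriesEquiv f).CoeffsIn (algebraicClosure k Lbar : Set Lbar) := fun i => by
  rw [coeff_seriesEquiv, lift_apply_of_mem _ (hf _)]
  exact frob_zpow_mem_algebraicClosure _ (hf _)

/-- The lifts to L̄ are chosen separately for each element; on coefficients in L^sep they are given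
by the group itself, so no comparison of lifts is needed. -/
theorem seriesEquiv_mul (σ τ : WeilGroup k L Lbar) {f : Series k Lbar}
    (hf : f.CoeffsIn (separableClosure L Lbar : Set Lbar)) :
    (σ * τ).seriesEquiv f = σ.seriesEquiv (τ.seriesEquiv f) := by
  ext i
  have h1 : ∀ ρ : WeilGroup k L Lbar, ρ.lift (f.coeff i) = ρ.toGal ⟨f.coeff i, hf i⟩ := fun ρ =>
    ρ.lift_apply ⟨f.coeff i, hf i⟩
  rw [coeff_seriesEquiv, coeff_seriesEquiv, coeff_seriesEquiv, h1, h1, lift_apply]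
  rfl

theorem isOrd_seriesEquiv (σ : WeilGroup k L Lbar) {f : Series k Lbar} {N : ℤ} (hf : f.IsOrd N) :
    (σ.seriesEquiv f).IsOrd N :=
  ⟨fun i hi => by rw [coeff_seriesEquiv, hf.1 i hi, map_zero],
    (map_ne_zero_iff _ σ.lift.injective).2 hf.2⟩

/-- To a given precision only finitely many coefficients matter, and each has an open stabilizer. -/
theorem continuous_seriesEquiv {f : Series k Lbar}
    (hf : f.CoeffsIn (separableClosure L Lbar : Set Lbar)) :
    Continuous fun σ : WeilGroup k L Lbar => σ.seriesEquiv f := by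
  refine continuous_iff_continuousAt.2 fun σ => ?_
  refine (nhds_hasBasis (σ.seriesEquiv f)).tendsto_right_iff.2 fun N _ => ?_
  obtain ⟨B, hB⟩ := f.bdd
  have h1 : ∀ᶠ τ in nhds σ, ∀ i ∈ Finset.Ico B N, (τ.seriesEquiv f).coeff i =
      (σ.seriesEquiv f).coeff i := by
    refine (Filter.eventually_all_finset _).2 fun i _ => ?_
    filter_upwards [σ.eventually_toGal_apply_eq ⟨f.coeff i, hf i⟩] with τ hτ
    have h2 : ∀ ρ : WeilGroup k L Lbar, (ρ.seriesEquiv f).coeff i = ρ.toGal ⟨f.coeff i, hf i⟩ :=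
      fun ρ => ρ.lift_apply ⟨f.coeff i, hf i⟩
    rw [h2, h2, hτ]
  filter_upwards [h1] with τ hτ i hi
  rcases lt_or_ge i B with hiB | hiB
  · rw [coeff_seriesEquiv, coeff_seriesEquiv, hB i hiB, map_zero, map_zero]
  · exact hτ i (Finset.mem_Ico.2 ⟨hiB, hi⟩)

end WeilGroup

/-! ### The representation of the Weil group attached to φ -/

namespace DrinfeldModule

open TwistedLaurent

set_option linter.unusedSectionVars false

variable {k F : Type*} [Field k] [Fintype k] [Field F] {infty : Place F}
    {L Lbar : Type*} [Field L] [Algebra k L] [Field Lbar] [Algebra L Lbar] [Algebra k Lbar]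
    [IsScalarTower k L Lbar] [IsAlgClosed Lbar]

/-- The conjugate of `φ` by the series `u` has coefficients in `k̄`. -/
def IsTrivializing (φ : DrinfeldModule k F infty L Lbar) (u : (Series k Lbar)ˣ) : Prop :=
  ∀ a : infty.regularAway,
    (↑u⁻¹ * φ.app a * ↑u : Series k Lbar).CoeffsIn (algebraicClosure k Lbar : Set Lbar)

variable {φ : DrinfeldModule k F infty L Lbar} {u v : (Series k Lbar)ˣ}

theorem IsTrivializing.coeffsIn_separableClosure (hu : φ.IsTrivializing u) :
    (u : Series k Lbar).CoeffsIn (separableClosure L Lbar : Set Lbar) := by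
  obtain ⟨a, r, hr, ha⟩ := φ.exists_app_isOrd_neg
  refine coeffsIn_separableClosure_of_mul_eq hr ha (ha.conj u) (φ.toRingHom a).2 (hu a) ?_
  rw [← mul_assoc, ← mul_assoc, u.mul_inv, one_mul]

theorem IsTrivializing.coeffsIn_inv_mul (hu : φ.IsTrivializing u) (hv : φ.IsTrivializing v) :
    (↑u⁻¹ * ↑v : Series k Lbar).CoeffsIn (algebraicClosure k Lbar : Set Lbar) := by
  obtain ⟨a, r, hr, ha⟩ := φ.exists_app_isOrd_neg
  refine coeffsIn_algebraicClosure_of_mul_eq hr (ha.conj u) (ha.conj v) (hu a) (hv a) ?_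
  simp only [mul_assoc, u.mul_inv_cancel_left, v.mul_inv_cancel_left]

/-- The conjugate of f commutes with u⁻¹ φ_a u, a series of negative order over k̄ for suitable a.
-/
theorem IsTrivializing.coeffsIn_conj [Algebra k F] (hu : φ.IsTrivializing u) {f : Series k Lbar}
    (hf : f ∈ φ.centralizer) :
    (↑u⁻¹ * f * ↑u : Series k Lbar).CoeffsIn (algebraicClosure k Lbar : Set Lbar) := by
  obtain ⟨a, r, hr, ha⟩ := φ.exists_app_isOrd_neg
  refine coeffsIn_algebraicClosure_of_mul_eq hr (ha.conj u) (ha.conj u) (hu a) (hu a) ?_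
  have h1 : φ.app a * f = f * φ.app a := Subring.mem_centralizer_iff.1 hf _ ⟨a, rfl⟩
  have h2 : φ.app a * (f * ↑u) = f * (φ.app a * ↑u) := by rw [← mul_assoc, h1, mul_assoc]
  simp only [mul_assoc, u.mul_inv_cancel_left, h2]

variable [Algebra.IsAlgebraic L Lbar]

open WeilGroup

theorem IsTrivializing.map_seriesEquiv (hu : φ.IsTrivializing u) (σ : WeilGroup k L Lbar) :
    φ.IsTrivializing (Units.map (σ.seriesEquiv : Series k Lbar →* Series k Lbar) u) := fun a => by
  have h1 := σ.coeffsIn_seriesEquiv (hu a)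
  rw [map_mul, map_mul, σ.seriesEquiv_of_mem_twistedPoly (f := φ.app a) (φ.toRingHom a).2] at h1
  exact h1

/-- The series `σ(u) τ^{deg σ} u⁻¹`. -/
noncomputable def weilSeries (u : (Series k Lbar)ˣ) (σ : WeilGroup k L Lbar) : Series k Lbar :=
  σ.seriesEquiv u * ↑(tau (frob k Lbar) ^ σ.deg) * ↑u⁻¹

/-- Applying σ to f u = u g, where g has coefficients in k̄, gives f σ(u) = σ(u) σ(g), and σ(g)
moves past τ^(deg σ) as g. This covers both φ(A) and End_L(φ). -/
theorem weilSeries_mul_comm {f : Series k Lbar} (hfL : f ∈ twistedPoly k L Lbar)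
    (hf : (↑u⁻¹ * f * ↑u : Series k Lbar).CoeffsIn (algebraicClosure k Lbar : Set Lbar))
    (σ : WeilGroup k L Lbar) : weilSeries u σ * f = f * weilSeries u σ := by
  have h1 := σ.seriesEquiv_mul_tau hf
  have h2 : f * σ.seriesEquiv u = σ.seriesEquiv u * σ.seriesEquiv (↑u⁻¹ * f * ↑u) := by
    rw [← map_mul]
    simp only [mul_assoc, u.mul_inv_cancel_left]
    rw [map_mul, σ.seriesEquiv_of_mem_twistedPoly hfL]
  calc weilSeries u σ * f
      = σ.seriesEquiv u * (↑(tau (frob k Lbar) ^ σ.deg) * (↑u⁻¹ * f * ↑u)) * ↑u⁻¹ := by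
        simp only [weilSeries, mul_assoc, u.mul_inv, mul_one]
    _ = σ.seriesEquiv u * σ.seriesEquiv (↑u⁻¹ * f * ↑u) * ↑(tau (frob k Lbar) ^ σ.deg) * ↑u⁻¹ := by
        rw [← h1, ← mul_assoc]
    _ = f * weilSeries u σ := by
        rw [← h2]
        simp only [weilSeries, mul_assoc]

theorem IsTrivializing.weilSeries_mem_centralizer [Algebra k F] (hu : φ.IsTrivializing u)
    (σ : WeilGroup k L Lbar) : weilSeries u σ ∈ φ.centralizer := by
  refine Subring.mem_centralizer_iff.2 ?_
  rintro _ ⟨a, rfl⟩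
  exact (weilSeries_mul_comm (φ.toRingHom a).2 (hu a) σ).symm

theorem weilSeries_mul_right {w : Series k Lbar}
    (hw : w.CoeffsIn (algebraicClosure k Lbar : Set Lbar)) (σ : WeilGroup k L Lbar) :
    σ.seriesEquiv (↑u * w) * ↑(tau (frob k Lbar) ^ σ.deg) = weilSeries u σ * (↑u * w) := by
  rw [map_mul, mul_assoc, σ.seriesEquiv_mul_tau hw]
  simp only [weilSeries, mul_assoc, u.inv_mul_cancel_left]

/-- Apply `weilSeries_mul_right` to w = u⁻¹v, whose coefficients lie in k̄. -/
theorem IsTrivializing.weilSeries_eq (hu : φ.IsTrivializing u) (hv : φ.IsTrivializing v)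
    (σ : WeilGroup k L Lbar) : weilSeries v σ = weilSeries u σ := by
  have h1 := weilSeries_mul_right (u := u) (hu.coeffsIn_inv_mul hv) σ
  rw [u.mul_inv_cancel_left] at h1
  rw [weilSeries, h1, mul_assoc, v.mul_inv, mul_one]

/-- The series τ(u), for the group element τ, is again trivializing, so `weilSeries_mul_right`
applies to w = u⁻¹ τ(u) and evaluates σ(τ(u)). -/
theorem IsTrivializing.weilSeries_mul (hu : φ.IsTrivializing u) (σ τ : WeilGroup k L Lbar) :
    weilSeries u (σ * τ) = weilSeries u σ * weilSeries u τ := by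
  have h1 := weilSeries_mul_right (u := u) (hu.coeffsIn_inv_mul (hu.map_seriesEquiv τ)) σ
  rw [u.mul_inv_cancel_left] at h1
  change σ.seriesEquiv (τ.seriesEquiv u) * _ = weilSeries u σ * τ.seriesEquiv u at h1
  rw [weilSeries, σ.seriesEquiv_mul τ hu.coeffsIn_separableClosure, deg_mul, zpow_add,
    Units.val_mul, ← mul_assoc, h1]
  simp only [weilSeries, mul_assoc]

theorem weilSeries_one (hu : (u : Series k Lbar).CoeffsIn (separableClosure L Lbar : Set Lbar)) :
    weilSeries u (1 : WeilGroup k L Lbar) = 1 := by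
  have h1 : (1 : WeilGroup k L Lbar).seriesEquiv (u : Series k Lbar) = u := by
    rw [← act_eq_seriesEquiv _ _ hu]
    rfl
  rw [weilSeries, h1, deg_one, zpow_zero, Units.val_one, mul_one, u.mul_inv]

theorem isOrd_weilSeries (u : (Series k Lbar)ˣ) (σ : WeilGroup k L Lbar) :
    (weilSeries u σ).IsOrd (-σ.deg) := by
  obtain ⟨N, hN⟩ := exists_isOrd_unit u
  have h1 := ((σ.isOrd_seriesEquiv hN).mul (g := ↑(tau (frob k Lbar) ^ σ.deg)) (by
    rw [tau_zpow]
    exact isOrd_monomial one_ne_zero)).mul hN.inv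
  rwa [show N + -σ.deg + -N = -σ.deg by ring] at h1

theorem continuous_weilSeries
    (hu : (u : Series k Lbar).CoeffsIn (separableClosure L Lbar : Set Lbar)) :
    Continuous (weilSeries (L := L) u) :=
  ((continuous_seriesEquiv hu).mul
    ((continuous_of_discreteTopology (f := fun d : ℤ =>
      ((tau (frob k Lbar) ^ d : (Series k Lbar)ˣ) : Series k Lbar))).comp continuous_deg)).mul
    continuous_const

/-- The representation `σ ↦ σ(u) τ^{deg σ} u⁻¹` of the Weil group. -/
noncomputable def weilRep [Algebra k F] (hu : φ.IsTrivializing u) :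
    WeilGroup k L Lbar →* (φ.centralizer)ˣ :=
  MonoidHom.toHomUnits
    { toFun := fun σ => ⟨weilSeries u σ, hu.weilSeries_mem_centralizer σ⟩
      map_one' := Subtype.ext (weilSeries_one hu.coeffsIn_separableClosure)
      map_mul' := fun σ τ => Subtype.ext (hu.weilSeries_mul σ τ) }

theorem weilRep_apply [Algebra k F] (hu : φ.IsTrivializing u) (σ : WeilGroup k L Lbar) :
    ((weilRep hu σ : φ.centralizer) : Series k Lbar) = weilSeries u σ := rfl

theorem continuous_weilRep [Algebra k F] (hu : φ.IsTrivializing u) :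
    Continuous (weilRep hu) := by
  have h1 : Continuous fun σ : WeilGroup k L Lbar => (weilRep hu σ : φ.centralizer) :=
    (continuous_weilSeries hu.coeffsIn_separableClosure).subtype_mk _
  -- The topology of the unit group also records inverses, and these are the values at σ⁻¹.
  refine Units.continuous_iff.2 ⟨h1, (h1.comp WeilGroup.continuous_inv).congr fun σ => ?_⟩
  simp only [Function.comp_apply, map_inv]

variable [Algebra k F] [Algebra k⟮X⟯ F] [IsScalarTower k k⟮X⟯ F] [FunctionField k F]

theorem exists_isNormalEmbedding {n : ℕ} (hn : φ.HasRank n) {Φ : infty.Compl →+* Series k Lbar}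
    (hΦ : φ.IsExtension n Φ) : ∃ (u : (Series k Lbar)ˣ) (π : infty.Compl)
      (T : frobFixed k Lbar (infty.degree k) →*₀ infty.Compl),
      IsNormalEmbedding infty.complVal (Φ.conjUnit u) (n * infty.degree k) (infty.degree k) π T := by
  have h := hΦ.isLocalEmbedding hn
  obtain ⟨hd, hcard, hdvd⟩ := degree_spec h hΦ.extends_app
  have hchar : ((Fintype.card k : ℕ) : infty.Compl) = 0 := by
    rw [← map_natCast (infty.embed.comp (algebraMap k F)), FiniteField.cast_card_eq_zero, map_zero]
  obtain ⟨T, hT⟩ := h.exists_teichmuller_map hd hchar hcard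
  obtain ⟨u, π, hπ, hu, huT⟩ := h.exists_unit_normal hd hdvd T hT
  exact ⟨u, π, T, ⟨h.surj, h.complete, h.pos, fun x hx => (h.isOrd x hx).conj u⟩, hd, hdvd, hcard,
    hπ, hu, huT⟩

theorem IsExtension.isTrivializing {n : ℕ} {Φ : infty.Compl →+* Series k Lbar}
    (hΦ : φ.IsExtension n Φ) (hu : ∀ x : infty.Compl,
      (↑u⁻¹ * Φ x * ↑u : Series k Lbar).CoeffsIn (algebraicClosure k Lbar : Set Lbar)) :
    φ.IsTrivializing u := fun a => by
  rw [← hΦ.extends_app]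
  exact hu _

end DrinfeldModule

/-! ### The theorem -/

theorem lemmaL
    (k F : Type*) [Field k] [Fintype k] [Field F] [Algebra k F]
    [Algebra k⟮X⟯ F] [IsScalarTower k k⟮X⟯ F] [FunctionField k F]
    (hconst : algebraicClosure k F = ⊥)
    (infty : Place F)
    (L Lbar : Type*) [Field L] [Algebra k L] [Field Lbar] [Algebra L Lbar] [Algebra k Lbar]
    [IsScalarTower k L Lbar] [IsAlgClosed Lbar] [Algebra.IsAlgebraic L Lbar]
    (φ : DrinfeldModule k F infty L Lbar) :
    (∃! n : ℕ, φ.HasRank n) ∧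
    ∀ n : ℕ, φ.HasRank n →
      (∃! Φ : infty.Compl →+* Series k Lbar, φ.IsExtension n Φ) ∧
      ∀ Φ : infty.Compl →+* Series k Lbar, φ.IsExtension n Φ →
        -- a conjugating series exists, and all such series have coefficients in `L^sep`
        (∃ u : (Series k Lbar)ˣ, ∀ x : infty.Compl,
          (↑u⁻¹ * Φ x * ↑u : Series k Lbar).CoeffsIn (algebraicClosure k Lbar : Set Lbar)) ∧
        (∀ u : (Series k Lbar)ˣ,
          (∀ x : infty.Compl,
            (↑u⁻¹ * Φ x * ↑u : Series k Lbar).CoeffsIn (algebraicClosure k Lbar : Set Lbar)) →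
          (u : Series k Lbar).CoeffsIn (separableClosure L Lbar : Set Lbar)) ∧
        -- `D_φ` is a central `F_∞`-division algebra, via `Φ`, of invariant `-1/n`
        (∃ _ : Algebra infty.Compl φ.centralizer,
          (∀ x : infty.Compl,
            ((algebraMap infty.Compl φ.centralizer x : φ.centralizer) : Series k Lbar) = Φ x) ∧
          IsCentralDivisionAlgebra infty.Compl φ.centralizer ∧
          HasInvariant infty.complVal φ.centralizer (-1 / (n : ℚ))) ∧
        -- the representation `ρ_∞`, given by the same formula for every conjugating series
        (∃ ρ : WeilGroup k L Lbar →* (φ.centralizer)ˣ,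
          (∀ u : (Series k Lbar)ˣ,
            (∀ x : infty.Compl,
              (↑u⁻¹ * Φ x * ↑u : Series k Lbar).CoeffsIn (algebraicClosure k Lbar : Set Lbar)) →
            ∀ (hu : (u : Series k Lbar).CoeffsIn (separableClosure L Lbar : Set Lbar))
              (σ : WeilGroup k L Lbar),
              ((ρ σ : φ.centralizer) : Series k Lbar) =
                σ.act u hu * ↑(TwistedLaurent.tau (frob k Lbar) ^ σ.deg) * ↑u⁻¹) ∧
          Continuous ρ ∧
          (∀ σ : WeilGroup k L Lbar,
            ((ρ σ : φ.centralizer) : Series k Lbar).ord = ((-σ.deg : ℤ) : WithTop ℤ)) ∧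
          ∀ (σ : WeilGroup k L Lbar), ∀ f ∈ φ.endRing,
            ((ρ σ : φ.centralizer) : Series k Lbar) * f =
              f * ((ρ σ : φ.centralizer) : Series k Lbar)) := by
  refine ⟨φ.existsUnique_hasRank, fun n hn => ⟨φ.existsUnique_isExtension hn, fun Φ hΦ => ?_⟩⟩
  obtain ⟨u, π, T, h⟩ := DrinfeldModule.exists_isNormalEmbedding hn hΦ
  have hmem := DrinfeldModule.mem_centralizer_iff (hΦ.isLocalEmbedding hn) hΦ.extends_app
  have hu : ∀ x : infty.Compl,
      (↑u⁻¹ * Φ x * ↑u : Series k Lbar).CoeffsIn (algebraicClosure k Lbar : Set Lbar) :=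
    fun x i => frobFixed_le_algebraicClosure h.pos_d (h.coeff_spec x i).1
  have htriv := hΦ.isTrivializing hu
  refine ⟨⟨u, hu⟩, fun v hv => (hΦ.isTrivializing hv).coeffsIn_separableClosure, ?_,
    DrinfeldModule.weilRep htriv, fun v hv hvL σ => ?_, DrinfeldModule.continuous_weilRep htriv,
    fun σ => TwistedLaurent.ord_eq_iff.2 (DrinfeldModule.isOrd_weilSeries u σ), fun σ f hf => ?_⟩
  · let f : infty.Compl →+* φ.centralizer := Φ.codRestrict φ.centralizer fun x =>
      (hmem _).2 fun y => by rw [← map_mul, mul_comm, map_mul]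
    let alg : Algebra infty.Compl φ.centralizer := f.toAlgebra' fun x b =>
      Subtype.ext ((hmem b).1 b.2 x)
    exact ⟨alg, fun _ => rfl, h.isCentralDivisionAlgebra hmem fun _ => rfl,
      h.hasInvariant hmem fun _ => rfl⟩
  · rw [σ.act_eq_seriesEquiv, DrinfeldModule.weilRep_apply,
      ← htriv.weilSeries_eq (hΦ.isTrivializing hv)]
    rfl
  · exact DrinfeldModule.weilSeries_mul_comm hf.1 (htriv.coeffsIn_conj hf.2) σ
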